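/- Let $1<s<2$, let $n\ge 1$ be an integer with $n>2s$, let $p>\frac{n+2s}{n-2s}$, and put $b=3-2s\in(-1,1)$. Points of $\mathbb R^{n+1}_+=\{(x,y):x\in\mathbb R^n,\ y>0\}$ are written $X=(x,y)$, and $\Delta_b f=y^{-b}\,\mathrm{div}(y^b\nabla f)$. Let $m\ge1$, let $C_{n,s}\in\mathbb R$ be a constant, and let $v=(v_i)_{i=1}^m$ be a classical solution of $$\Delta_b^2v_i=0\ \text{ in }\mathbb R^{n+1}_+,\qquad \lim_{y\to0}y^b\partial_yv_i=0,\qquad \lim_{y\to0}y^b\partial_y\Delta_bv_i=C_{n,s}|v|^{p-1}v_i\ \text{ on }\partial\mathbb R^{n+1}_+,\qquad |v|^2=\sum_{i=1}^m v_i^2,$$ that is: $v_i\in C^4(\mathbb R^{n+1}_+)$; $v_i$ and its tangential derivatives $\partial_{x_1}v_i,\dots,\partial_{x_n}v_i$ belong to $C^2(\overline{\mathbb R^{n+1}_+})$; $\Delta_bv_i$ extends continuously to $\overline{\mathbb R^{n+1}_+}$; and both boundary limits hold as $(x',y)\to(x,0)$ with $y>0$, for every $x\in\mathbb R^n$. For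 $x_0\in\partial\mathbb R^{n+1}_+=\mathbb R^n$ and $\lambda>0$ let $B_\lambda=B_\lambda(x_0)$ be the ball in $\mathbb R^{n+1}$, $r=|X-x_0|$, let $\partial/\partial r$ be the radial derivative with respect to $x_0$, and let $$\begin{aligned} E_s(v,\lambda,x_0)={}&\lambda^{2s\frac{p+1}{p-1}-n}\Big(\int_{\mathbb R^{n+1}_+\cap B_\lambda}\tfrac12y^{b}\sum_i|\Delta_bv_i|^2-\frac{C_{n,s}}{p+1}\int_{\partial\mathbb R^{n+1}_+\cap B_\lambda}|v|^{p+1}\Big)\\ &-\frac{s}{p-1}\Big(\frac{p+2s-1}{p-1}-n-b\Big)\lambda^{-3+2s+\frac{4s}{p-1}-n}\int_{\mathbb R^{n+1}_+\cap\partial B_\lambda}y^{b}|v|^2\\ &-\frac{s}{p-1}\Big(\frac{p+2s-1}{p-1}-n-b\Big)\frac{d}{d\lambda}\Big[\lambda^{\frac{4s}{p-1}+2s-2-n}\int_{\mathbb R^{n+1}_+\cap\partial B_\lambda}y^{b}|v|^2\Big]\\ &+\frac12\lambda^3\frac{d}{d\lambda}\Big[\lambda^{\frac{4s}{p-1}+2s-3-n}\int_{\mathbb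 R^{n+1}_+\cap\partial B_\lambda}y^{b}\sum_i\Big(\frac{2s}{p-1}\lambda^{-1}v_i+\frac{\partial v_i}{\partial r}\Big)^2\Big]\\ &+\frac12\frac{d}{d\lambda}\Big[\lambda^{2s\frac{p+1}{p-1}-n}\int_{\mathbb R^{n+1}_+\cap\partial B_\lambda}y^{b}\sum_i\Big(|\nabla v_i|^2-\Big|\frac{\partial v_i}{\partial r}\Big|^2\Big)\Big]\\ &+\frac12\lambda^{2s\frac{p+1}{p-1}-n-1}\int_{\mathbb R^{n+1}_+\cap\partial B_\lambda}y^{b}\sum_i\Big(|\nabla v_i|^2-\Big|\frac{\partial v_i}{\partial r}\Big|^2\Big). \end{aligned}$$ Then, for every $x_0$, all integrals and derivatives in this formula exist for every $\lambda>0$, the function $\lambda\mapsto E_s(v,\lambda,x_0)$ is differentiable and nondecreasing on $(0,\infty)$, and for every $\lambda>0$ $$\frac{dE_s(v,\lambda,x_0)}{d\lambda}\ \ge\ C(n,s,p)\,\lambda^{\frac{4s}{p-1}+2s-2-n}\int_{\mathbb R^{n+1}_+\cap\partial B_\lambda(x_0)}y^{3-2s}\sum_{i=1}^m\Big(\frac{2s}{p-1}r^{-1}v_i+\frac{\partial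 v_i}{\partial r}\Big)^2,$$ where $C(n,s,p)>0$ depends only on $n$, $s$ and $p$ (not on $\lambda$, $x_0$, $v$, $m$ or $C_{n,s}$). -/

import Mathlib

open Filter Topology MeasureTheory Set

noncomputable section

namespace YangExtension

/-- The ambient space `ℝ^{n+1}`, with points `X = (x, y)`: the first `n` coordinates are `x`, the
last one is `y`. -/
abbrev Space (n : ℕ) : Type := EuclideanSpace ℝ (Fin (n + 1))

/-- The last coordinate `y` of `X = (x, y)`. -/
def yCoord {n : ℕ} (X : Space n) : ℝ := X (Fin.last n)

/-- The open half-space `ℝ^{n+1}_+ = {y > 0}`. -/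
def halfSpace (n : ℕ) : Set (Space n) := {X | 0 < yCoord X}

/-- The closed half-space `{y ≥ 0}`. -/
def closedHalfSpace (n : ℕ) : Set (Space n) := {X | 0 ≤ yCoord X}

/-- The boundary point `(x, 0)`. -/
def bdry {n : ℕ} (x : EuclideanSpace ℝ (Fin n)) : Space n :=
  WithLp.toLp 2 (Fin.snoc (α := fun _ => ℝ) (fun i => x i) 0)

/-- The partial derivative `∂_j f` (for `j = Fin.last n` this is `∂_y f`). -/
def pderiv {n : ℕ} (j : Fin (n + 1)) (f : Space n → ℝ) (X : Space n) : ℝ :=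
  lineDeriv ℝ f X (EuclideanSpace.single j 1)

/-- `Δ_b f = y^{-b} div (y^b ∇f)`; it is only ever used at points with `y > 0`. -/
def weightedLaplacian {n : ℕ} (b : ℝ) (f : Space n → ℝ) (X : Space n) : ℝ :=
  yCoord X ^ (-b) * ∑ j, pderiv j (fun Z => yCoord Z ^ b * pderiv j f Z) X

/-- The squared Euclidean length `|∇f|²`. -/
def gradSq {n : ℕ} (f : Space n → ℝ) (X : Space n) : ℝ := ∑ j, pderiv j f X ^ 2

/-- The radial derivative `∂f/∂r` with respect to the centre `c`, `r = |X - c|`. -/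
def radialDeriv {n : ℕ} (c : Space n) (f : Space n → ℝ) (X : Space n) : ℝ :=
  lineDeriv ℝ f X (‖X - c‖⁻¹ • (X - c))

/-- The Euclidean length `|v| = (∑ v_i²)^{1/2}` of the vector `v(X)`. -/
def vecNorm {n m : ℕ} (v : Fin m → Space n → ℝ) (X : Space n) : ℝ := √(∑ i, v i X ^ 2)

/-- The surface measure on the sphere `∂B_r(c)` in `ℝ^{n+1}`: the image of the surface measure
of the unit sphere under `ω ↦ c + r ω`, multiplied by `r^n`. -/
def surfaceMeasure {n : ℕ} (c : Space n) (r : ℝ) : Measure (Space n) :=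
  ENNReal.ofReal (r ^ n) •
    Measure.map (fun ω : Metric.sphere (0 : Space n) 1 => c + r • (ω : Space n))
      (volume : Measure (Space n)).toSphere

/-- `v = (v_i)` is a classical solution of the extension system, with `b = 3 - 2s`:
`Δ_b² v_i = 0` for `y > 0`, `lim_{y → 0} y^b ∂_y v_i = 0` and
`lim_{y → 0} y^b ∂_y Δ_b v_i = κ |v|^{p-1} v_i`.
Both limits are taken in the half-space at each of its boundary points, so that the two fluxes are
continuous up to the boundary. Only the values of `v` on the closed half-space matter. -/
structure IsClassicalSolution {n m : ℕ} (s p κ : ℝ) (v : Fin m → Space n → ℝ) : Prop where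
  /-- `v` is of class `C⁴` in the open half-space. -/
  smooth : ∀ i, ContDiffOn ℝ 4 (v i) (halfSpace n)
  /-- `v` is of class `C²` up to the boundary. -/
  regular : ∀ i, ContDiffOn ℝ 2 (v i) (closedHalfSpace n)
  /-- The tangential derivatives `∂_{x_j} v` are of class `C²` up to the boundary. -/
  regular_tangential : ∀ i (j : Fin n),
    ContDiffOn ℝ 2 (pderiv j.castSucc (v i)) (closedHalfSpace n)
  /-- `Δ_b v` extends continuously to the boundary. -/
  regular_laplacian : ∀ i (x : EuclideanSpace ℝ (Fin n)), ∃ l : ℝ,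
    Tendsto (weightedLaplacian (3 - 2 * s) (v i)) (𝓝[halfSpace n] (bdry x)) (𝓝 l)
  equation : ∀ i, ∀ X ∈ halfSpace n,
    weightedLaplacian (3 - 2 * s) (weightedLaplacian (3 - 2 * s) (v i)) X = 0
  neumann : ∀ i (x : EuclideanSpace ℝ (Fin n)),
    Tendsto (fun X => yCoord X ^ (3 - 2 * s) * pderiv (Fin.last n) (v i) X)
      (𝓝[halfSpace n] (bdry x)) (𝓝 0)
  flux : ∀ i (x : EuclideanSpace ℝ (Fin n)),
    Tendsto (fun X => yCoord X ^ (3 - 2 * s) *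
        pderiv (Fin.last n) (weightedLaplacian (3 - 2 * s) (v i)) X)
      (𝓝[halfSpace n] (bdry x)) (𝓝 (κ * vecNorm v (bdry x) ^ (p - 1) * v i (bdry x)))

section Energy

variable {n m : ℕ} (s p κ : ℝ) (v : Fin m → Space n → ℝ) (x₀ : EuclideanSpace ℝ (Fin n))

/-- The bulk density `y^{3-2s} ∑ |Δ_b v_i|²`. -/
def bulkDensity (X : Space n) : ℝ :=
  yCoord X ^ (3 - 2 * s) * ∑ i, weightedLaplacian (3 - 2 * s) (v i) X ^ 2

/-- The density `y^{3-2s} |v|²`. -/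
def massDensity (X : Space n) : ℝ := yCoord X ^ (3 - 2 * s) * vecNorm v X ^ 2

/-- The density `y^{3-2s} ∑ ((2s/(p-1)) r⁻¹ v_i + ∂_r v_i)²`, where `r = |X - x₀|`
(so that `r = λ` on `∂B_λ(x₀)`). -/
def homogeneityDensity (X : Space n) : ℝ :=
  yCoord X ^ (3 - 2 * s) *
    ∑ i, (2 * s / (p - 1) * ‖X - bdry x₀‖⁻¹ * v i X + radialDeriv (bdry x₀) (v i) X) ^ 2

/-- The density `y^{3-2s} ∑ (|∇v_i|² - |∂_r v_i|²)`. -/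
def tangentialDensity (X : Space n) : ℝ :=
  yCoord X ^ (3 - 2 * s) *
    ∑ i, (gradSq (v i) X - radialDeriv (bdry x₀) (v i) X ^ 2)

/-- The integral of `f` over the half-sphere `ℝ^{n+1}_+ ∩ ∂B_r(x₀)`. -/
def halfSphereIntegral (r : ℝ) (f : Space n → ℝ) : ℝ :=
  ∫ X in halfSpace n, f X ∂(surfaceMeasure (bdry x₀) r)

/-- `λ^{4s/(p-1)+2s-2-n} ∫ y^{3-2s} |v|²` over the half-sphere of radius `λ = r`. -/
def massBracket (r : ℝ) : ℝ :=
  r ^ (4 * s / (p - 1) + 2 * s - 2 - n) * halfSphereIntegral x₀ r (massDensity s v)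

/-- `λ^{4s/(p-1)+2s-3-n} ∫ y^{3-2s} ∑ ((2s/(p-1)) λ⁻¹ v_i + ∂_r v_i)²`, `λ = r`. -/
def homogeneityBracket (r : ℝ) : ℝ :=
  r ^ (4 * s / (p - 1) + 2 * s - 3 - n) *
    halfSphereIntegral x₀ r (homogeneityDensity s p v x₀)

/-- `λ^{2s(p+1)/(p-1)-n} ∫ y^{3-2s} ∑ (|∇v_i|² - |∂_r v_i|²)`, `λ = r`. -/
def tangentialBracket (r : ℝ) : ℝ :=
  r ^ (2 * s * (p + 1) / (p - 1) - n) * halfSphereIntegral x₀ r (tangentialDensity s v x₀)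

/-- The energy `E_s(v, λ, x₀)` with `λ = r`. -/
def energy (r : ℝ) : ℝ :=
  r ^ (2 * s * (p + 1) / (p - 1) - n) *
      ((∫ X in halfSpace n ∩ Metric.ball (bdry x₀) r, 1 / 2 * bulkDensity s v X) -
        κ / (p + 1) * ∫ x in Metric.ball x₀ r, vecNorm v (bdry x) ^ (p + 1))
    - s / (p - 1) * ((p + 2 * s - 1) / (p - 1) - n - (3 - 2 * s)) *
        r ^ (-3 + 2 * s + 4 * s / (p - 1) - n) * halfSphereIntegral x₀ r (massDensity s v)
    - s / (p - 1) * ((p + 2 * s - 1) / (p - 1) - n - (3 - 2 * s)) *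
        deriv (massBracket s p v x₀) r
    + 1 / 2 * r ^ 3 * deriv (homogeneityBracket s p v x₀) r
    + 1 / 2 * deriv (tangentialBracket s p v x₀) r
    + 1 / 2 * r ^ (2 * s * (p + 1) / (p - 1) - n - 1) *
        halfSphereIntegral x₀ r (tangentialDensity s v x₀)

/-- Every integral in the energy at radius `λ = r` converges and every derivative in it exists. -/
structure EnergyWellDefined (r : ℝ) : Prop where
  bulk : IntegrableOn (bulkDensity s v) (halfSpace n ∩ Metric.ball (bdry x₀) r)
  boundary : IntegrableOn (fun x => vecNorm v (bdry x) ^ (p + 1)) (Metric.ball x₀ r)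
  mass : IntegrableOn (massDensity s v) (halfSpace n) (surfaceMeasure (bdry x₀) r)
  homogeneity :
    IntegrableOn (homogeneityDensity s p v x₀) (halfSpace n) (surfaceMeasure (bdry x₀) r)
  tangential :
    IntegrableOn (tangentialDensity s v x₀) (halfSpace n) (surfaceMeasure (bdry x₀) r)
  mass_deriv : DifferentiableAt ℝ (massBracket s p v x₀) r
  homogeneity_deriv : DifferentiableAt ℝ (homogeneityBracket s p v x₀) r
  tangential_deriv : DifferentiableAt ℝ (tangentialBracket s p v x₀) r

end Energy

end YangExtension

end

noncomputable section

namespace YangExtension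

/-! ### Polar coordinates in a normed space. -/

section Polar

/-! Put α = 2s/(p-1), c = (x₀, 0), and let D be differentiation along dilations about c (`Dil`). The
operator D + α (`twist`) generates the scaling v ↦ r^α v(c + r·) that leaves the problem invariant.
Transported to the unit half-ball or half-sphere, the volume and sphere terms of the energy become
integrals over a fixed domain, and differentiating them in r inserts D + α. For one component v
write w = Δ_b v, u₁ = (D + α)v, u₂ = (D + α)u₁, and let L (`sphLap`) be the weighted Laplacian along
the spheres, so that r²w = D²v + (n+b-1)Dv + Lv.

Since Δ_b is homogeneous of degree -2 about a boundary point, Dw + (α+2)w = Δ_b u₁. The derivative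
of the bulk term is therefore a multiple of ∫ y^b w Δ_b u₁, and because Δ_b w = 0, Green's formula
(`green_identity`) turns it into an integral over the half-sphere plus the flux of w paired with u₁
on the flat boundary. Summed over components, that flux term is exactly the derivative of the
|v|^{p+1} term, so the two cancel whatever the constant κ is.

On the half-sphere w is eliminated in favour of L. The operator L commutes with D and is symmetric,
with -∫ y^b f Lf = ∫ y^b (r²|∇f|² - (Df)²) ≥ 0. The remaining terms of the energy, written as
pairings of v, u₁, u₂, Lv (`componentEnergy`, `energy_eq`), are those whose derivatives cancel
everything without a sign. By `sphere_balance` what survives is r^{2α-1} times 2∫u₂² + 2(A+B)∫u₁² +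
2∫(r²|∇u₁|² - (Du₁)²), with A = n+b-1-2α and B = α(n+b-1-α). The middle term is the density in the
asserted bound, and supercriticality means α < (n-2s)/2, which makes A+B positive
(`monotonicityConstant_pos`).

Two analytic points need care. At y = 0 the third normal derivative of v is controlled only after
multiplication by y; but c lies on the boundary, so D supplies a factor y with each normal
derivative, and Dv, D²v, D³v, Dw are locally bounded. The divergence theorem on half-balls
(`half_ball_divergence`) comes from fields cut off by the square of (R²-|X-c|²)₊, after which two
derivatives in R recover the sharp balance without integrating by parts on a curved domain. -/

lemma sphere_integral_indicator_ball {E : Type*} [NormedAddCommGroup E] [NormedSpace ℝ E]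
    [MeasurableSpace E] (μ : Measure E) (c : E) (f : E → ℝ) {R r : ℝ} (hr : 0 < r) :
    ∫ ω : Metric.sphere (0 : E) 1, (Metric.ball c R).indicator f (c + r • (ω : E)) ∂μ.toSphere =
      (Iio R).indicator
        (fun r => ∫ ω : Metric.sphere (0 : E) 1, f (c + r • (ω : E)) ∂μ.toSphere) r := by
  have hmem : ∀ ω : Metric.sphere (0 : E) 1, c + r • (ω : E) ∈ Metric.ball c R ↔ r ∈ Iio R := by
    intro ω
    have : ‖(ω : E)‖ = 1 := by simp
    simp [norm_smul, this, abs_of_pos hr]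
  by_cases h : r ∈ Iio R
  · rw [indicator_of_mem h]
    exact integral_congr_ae (Eventually.of_forall fun ω => indicator_of_mem ((hmem ω).2 h) _)
  · rw [indicator_of_notMem h]
    rw [← integral_zero (Metric.sphere (0 : E) 1) ℝ (μ := μ.toSphere)]
    exact integral_congr_ae (Eventually.of_forall fun ω =>
      indicator_of_notMem (fun h' => h ((hmem ω).1 h')) _)

variable {E : Type*} [NormedAddCommGroup E] [NormedSpace ℝ E] [MeasurableSpace E] [BorelSpace E]
  [FiniteDimensional ℝ E] [Nontrivial E] (μ : Measure E) [μ.IsAddHaarMeasure]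

/-- The punctured space is a product of sphere and half-line, compatibly with the measures, and
removing the origin loses nothing because Haar measure has no atoms here. -/
lemma integrable_iff_integrable_polar {f : E → ℝ} :
    Integrable f μ ↔ Integrable (fun z : Metric.sphere (0 : E) 1 × Ioi (0 : ℝ) =>
      f ((z.2 : ℝ) • (z.1 : E)))
      (μ.toSphere.prod (Measure.volumeIoiPow (Module.finrank ℝ E - 1))) := by
  let g : Metric.sphere (0 : E) 1 × Ioi (0 : ℝ) → ℝ := fun z => f ((z.2 : ℝ) • (z.1 : E))
  have key := μ.measurePreserving_homeomorphUnitSphereProd.integrable_comp_emb (g := g)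
    (Homeomorph.measurableEmbedding _)
  rw [← restrict_compl_singleton (μ := μ) 0, ← IntegrableOn,
    integrableOn_iff_comap_subtypeVal (measurableSet_singleton _).compl, restrict_compl_singleton,
    ← key]
  apply integrable_congr
  refine Eventually.of_forall fun x => ?_
  have hx : ‖(x : E)‖ ≠ 0 := norm_ne_zero_iff.2 x.2
  simp [g, smul_smul, hx]

lemma integral_eq_integral_polar_prod (f : E → ℝ) :
    ∫ x, f x ∂μ = ∫ z : Metric.sphere (0 : E) 1 × Ioi (0 : ℝ), f ((z.2 : ℝ) • (z.1 : E))
      ∂(μ.toSphere.prod (Measure.volumeIoiPow (Module.finrank ℝ E - 1))) := by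
  let g : Metric.sphere (0 : E) 1 × Ioi (0 : ℝ) → ℝ := fun z => f ((z.2 : ℝ) • (z.1 : E))
  have key := μ.measurePreserving_homeomorphUnitSphereProd.integral_comp
    (Homeomorph.measurableEmbedding _) g
  rw [← restrict_compl_singleton (μ := μ) 0,
    ← integral_subtype_comap (measurableSet_singleton _).compl, restrict_compl_singleton, ← key]
  apply integral_congr_ae
  refine Eventually.of_forall fun x => ?_
  have hx : ‖(x : E)‖ ≠ 0 := norm_ne_zero_iff.2 x.2
  simp [g, smul_smul, hx]

lemma integral_volumeIoiPow (k : ℕ) (g : ℝ → ℝ) :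
    ∫ r : Ioi (0 : ℝ), g r ∂(Measure.volumeIoiPow k) = ∫ r in Ioi (0 : ℝ), r ^ k * g r := by
  rw [Measure.volumeIoiPow, integral_withDensity_eq_integral_toReal_smul (by fun_prop) (by simp),
    ← integral_subtype_comap measurableSet_Ioi (fun r : ℝ => r ^ k * g r)]
  refine integral_congr_ae (Eventually.of_forall fun r => ?_)
  have hr : (0 : ℝ) ≤ (r : ℝ) ^ k := pow_nonneg (le_of_lt r.2) k
  simp [ENNReal.toReal_ofReal hr]

lemma integrable_volumeIoiPow_iff (k : ℕ) (g : ℝ → ℝ) :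
    Integrable (fun r : Ioi (0 : ℝ) => g r) (Measure.volumeIoiPow k) ↔
      IntegrableOn (fun r => r ^ k * g r) (Ioi 0) := by
  rw [Measure.volumeIoiPow, integrable_withDensity_iff_integrable_smul' (by fun_prop) (by simp),
    integrableOn_iff_comap_subtypeVal measurableSet_Ioi]
  refine integrable_congr (Eventually.of_forall fun r => ?_)
  have hr : (0 : ℝ) ≤ (r : ℝ) ^ k := pow_nonneg (le_of_lt r.2) k
  simp [ENNReal.toReal_ofReal hr]

/-- Integration in polar coordinates. -/
lemma integral_eq_integral_polar {f : E → ℝ} (hf : Integrable f μ) :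
    ∫ x, f x ∂μ = ∫ r in Ioi (0 : ℝ), r ^ (Module.finrank ℝ E - 1) *
      ∫ ω : Metric.sphere (0 : E) 1, f (r • (ω : E)) ∂μ.toSphere := by
  rw [integral_eq_integral_polar_prod, integral_prod_symm _
    ((integrable_iff_integrable_polar μ).1 hf)]
  exact integral_volumeIoiPow _ (fun r => ∫ ω : Metric.sphere (0 : E) 1, f (r • (ω : E)) ∂μ.toSphere)

lemma integrableOn_polar {f : E → ℝ} (hf : Integrable f μ) :
    IntegrableOn (fun r : ℝ => r ^ (Module.finrank ℝ E - 1) *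
      ∫ ω : Metric.sphere (0 : E) 1, f (r • (ω : E)) ∂μ.toSphere) (Ioi 0) := by
  rw [← integrable_volumeIoiPow_iff]
  exact ((integrable_iff_integrable_polar μ).1 hf).integral_prod_right

lemma integrableOn_ball_polar {c : E} {R : ℝ} {f : E → ℝ}
    (hf : IntegrableOn f (Metric.ball c R) μ) :
    IntegrableOn (fun r : ℝ => r ^ (Module.finrank ℝ E - 1) *
      ∫ ω : Metric.sphere (0 : E) 1, f (c + r • (ω : E)) ∂μ.toSphere) (Ioo 0 R) := by
  rw [← integrable_indicator_iff measurableSet_ball] at hf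
  have h := integrableOn_polar μ (hf.comp_add_left c)
  have h2 := h.mono_set (Ioo_subset_Ioi_self : Ioo (0 : ℝ) R ⊆ Ioi 0)
  refine h2.congr_fun (fun r hr => ?_) measurableSet_Ioo
  beta_reduce
  rw [sphere_integral_indicator_ball μ c f hr.1, indicator_of_mem (mem_Iio.2 hr.2)]

/-- Integration over a ball in polar coordinates. -/
lemma setIntegral_ball_eq_polar {c : E} {R : ℝ} (hR : 0 < R) {f : E → ℝ}
    (hf : IntegrableOn f (Metric.ball c R) μ) :
    ∫ x in Metric.ball c R, f x ∂μ = ∫ r in (0 : ℝ)..R, r ^ (Module.finrank ℝ E - 1) *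
      ∫ ω : Metric.sphere (0 : E) 1, f (c + r • (ω : E)) ∂μ.toSphere := by
  rw [← integrable_indicator_iff measurableSet_ball] at hf
  rw [← integral_indicator measurableSet_ball, ← integral_add_left_eq_self _ c,
    integral_eq_integral_polar μ (hf.comp_add_left c), intervalIntegral.integral_of_le hR.le,
    integral_Ioc_eq_integral_Ioo, ← Ioi_inter_Iio, ← setIntegral_indicator measurableSet_Iio]
  refine setIntegral_congr_fun measurableSet_Ioi fun r hr => ?_
  rw [sphere_integral_indicator_ball μ c f hr, indicator_mul_right]

end Polar

/-! ### The weight y^b: local integrability and finiteness of its trace on the half-sphere. -/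

section Weight

variable {n : ℕ}

lemma continuous_yCoord : Continuous (yCoord : Space n → ℝ) := by
  unfold yCoord; fun_prop

lemma isOpen_halfSpace : IsOpen (halfSpace n) :=
  isOpen_lt continuous_const continuous_yCoord

lemma yCoord_add_smul {c : Space n} (hc : yCoord c = 0) (r : ℝ) (Z : Space n) :
    yCoord (c + r • Z) = r * yCoord Z := by
  simp only [yCoord] at *
  simp [hc]

lemma add_smul_mem_halfSpace {c : Space n} (hc : yCoord c = 0) {r : ℝ} (hr : 0 < r)
    {Z : Space n} : c + r • Z ∈ halfSpace n ↔ Z ∈ halfSpace n := by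
  simp [halfSpace, yCoord_add_smul hc, hr]

lemma abs_apply_le_norm (X : Space n) (j : Fin (n + 1)) : |X j| ≤ ‖X‖ :=
  PiLp.norm_apply_le X j

lemma yCoord_le_norm (X : Space n) : yCoord X ≤ ‖X‖ :=
  (le_abs_self _).trans (abs_apply_le_norm X _)

/-- The measure with density `y^b` with respect to `μ` on the half-space. -/
def weighted (b : ℝ) (μ : Measure (Space n)) : Measure (Space n) :=
  (μ.restrict (halfSpace n)).withDensity fun X => ENNReal.ofReal (yCoord X ^ b)

lemma measurable_weight (b : ℝ) :
    Measurable fun X : Space n => ENNReal.ofReal (yCoord X ^ b) :=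
  (continuous_yCoord.measurable.pow_const b).ennreal_ofReal

lemma integral_weighted (b : ℝ) (μ : Measure (Space n)) (f : Space n → ℝ) :
    ∫ X, f X ∂(weighted b μ) = ∫ X in halfSpace n, yCoord X ^ b * f X ∂μ := by
  rw [weighted, integral_withDensity_eq_integral_toReal_smul (measurable_weight b) (by simp)]
  refine setIntegral_congr_fun isOpen_halfSpace.measurableSet fun X hX => ?_
  simp [ENNReal.toReal_ofReal (Real.rpow_nonneg (le_of_lt hX) b)]

lemma integrable_weighted_iff (b : ℝ) (μ : Measure (Space n)) (f : Space n → ℝ) :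
    Integrable f (weighted b μ) ↔ IntegrableOn (fun X => yCoord X ^ b * f X) (halfSpace n) μ := by
  rw [weighted, integrable_withDensity_iff_integrable_smul' (measurable_weight b) (by simp)]
  refine integrableOn_congr_fun (fun X hX => ?_) isOpen_halfSpace.measurableSet
  simp [ENNReal.toReal_ofReal (Real.rpow_nonneg (le_of_lt hX) b)]

lemma weighted_absolutelyContinuous (b : ℝ) (μ : Measure (Space n)) :
    weighted b μ ≪ μ.restrict (halfSpace n) :=
  withDensity_absolutelyContinuous _ _

/-- On a bounded piece of the half-space the weight coincides with a product of integrable functions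
of one coordinate each. Only the factor t^b is singular, and b > -1 handles it. -/
lemma integrableOn_weight {b : ℝ} (hb : -1 < b) (R : ℝ) :
    IntegrableOn (fun X : Space n => yCoord X ^ b) (halfSpace n ∩ Metric.closedBall 0 R) := by
  -- The absolute value covers negative R; the extra 1 keeps the open interval nonempty and lets it
  -- contain y = |R|.
  let g : Fin (n + 1) → ℝ → ℝ := fun j =>
    if j = Fin.last n then (Ioo 0 (|R| + 1)).indicator (fun t => t ^ b)
    else (Icc (-|R|) |R|).indicator (fun _ => 1)
  have hg : ∀ j, Integrable (g j) := by
    intro j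
    by_cases hj : j = Fin.last n
    · simp only [g, hj, if_true]
      rw [integrable_indicator_iff measurableSet_Ioo]
      exact (intervalIntegral.integrableOn_Ioo_rpow_iff (by positivity)).2 hb
    · simp only [g, hj, if_false]
      rw [integrable_indicator_iff measurableSet_Icc]
      exact integrableOn_const (by simp) 
  have hprod : Integrable (fun X : Space n => ∏ j, g j (X j)) := by
    have h1 := Integrable.fintype_prod hg
    exact ((PiLp.volume_preserving_toLp (Fin (n + 1))).integrable_comp_emb
      (MeasurableEquiv.toLp 2 _).measurableEmbedding (g := fun X : Space n => ∏ j, g j (X j))).1 h1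
  refine (hprod.integrableOn (s := halfSpace n ∩ Metric.closedBall 0 R)).congr_fun
    (fun X hX => ?_) (isOpen_halfSpace.measurableSet.inter measurableSet_closedBall)
  have hXR : ‖X‖ ≤ |R| := by
    exact (mem_closedBall_zero_iff.1 hX.2).trans (le_abs_self R)
  show ∏ j, g j (X j) = yCoord X ^ b
  rw [Fin.prod_univ_castSucc]
  have h1 : ∀ j : Fin n, g j.castSucc (X j.castSucc) = 1 := by
    intro j
    have hj : j.castSucc ≠ Fin.last n := (Fin.castSucc_lt_last j).ne
    simp only [g, hj, if_false]
    exact indicator_of_mem (mem_Icc.2 <| abs_le.1 <| (abs_apply_le_norm X _).trans hXR) _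
  rw [Finset.prod_eq_one fun j _ => h1 j, one_mul]
  simp only [g, if_true]
  exact indicator_of_mem (mem_Ioo.2 ⟨hX.1, ((yCoord_le_norm X).trans hXR).trans_lt (lt_add_one _)⟩) _

lemma integrableOn_weight_ball {b : ℝ} (hb : -1 < b) (c : Space n) (R : ℝ) :
    IntegrableOn (fun X : Space n => yCoord X ^ b) (halfSpace n ∩ Metric.ball c R) := by
  refine (integrableOn_weight hb (R + ‖c‖)).mono_set (inter_subset_inter_right _ fun X hX => ?_)
  rw [mem_closedBall_zero_iff]
  have : ‖X - c‖ < R := by simpa [dist_eq_norm] using hX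
  have := norm_add_le (X - c) c
  rw [sub_add_cancel] at this
  linarith

/-- The surface measure of the unit sphere, as a measure on the space. -/
def unitSphereMeasure (n : ℕ) : Measure (Space n) :=
  Measure.map (fun ω : Metric.sphere (0 : Space n) 1 => (ω : Space n))
    (volume : Measure (Space n)).toSphere

lemma sphere_measurableEmbedding :
    MeasurableEmbedding (fun ω : Metric.sphere (0 : Space n) 1 => (ω : Space n)) :=
  MeasurableEmbedding.subtype_coe Metric.isClosed_sphere.measurableSet

/-- The measure `y^b dσ` on the upper half of the unit sphere. -/
def sphereWeight (n : ℕ) (b : ℝ) : Measure (Space n) := weighted b (unitSphereMeasure n)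

/-- The measure `y^b dX` on the upper half of the unit ball. -/
def ballWeight (n : ℕ) (b : ℝ) : Measure (Space n) :=
  weighted b (volume.restrict (Metric.ball 0 1))

/-- A measure whose mass lives on the upper half of the closed unit ball. -/
def OnUnitHalfBall (ν : Measure (Space n)) : Prop := ∀ᵐ Z ∂ν, Z ∈ halfSpace n ∧ ‖Z‖ ≤ 1

lemma onUnitHalfBall_weighted (b : ℝ) {μ : Measure (Space n)} (h : ∀ᵐ Z ∂μ, ‖Z‖ ≤ 1) :
    OnUnitHalfBall (weighted b μ) := by
  refine (weighted_absolutelyContinuous b μ).ae_le ?_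
  filter_upwards [ae_restrict_mem isOpen_halfSpace.measurableSet, ae_restrict_of_ae h]
    with Z h1 h2 using ⟨h1, h2⟩

lemma onUnitHalfBall_ballWeight (b : ℝ) : OnUnitHalfBall (ballWeight n b) :=
  onUnitHalfBall_weighted b <| by
    filter_upwards [ae_restrict_mem measurableSet_ball] with Z hZ
    exact (mem_ball_zero_iff.1 hZ).le

lemma onUnitHalfBall_sphereWeight (b : ℝ) : OnUnitHalfBall (sphereWeight n b) :=
  onUnitHalfBall_weighted b <| by
    rw [unitSphereMeasure, sphere_measurableEmbedding.ae_map_iff]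
    exact Eventually.of_forall fun ω => by simp

lemma isFiniteMeasure_ballWeight {b : ℝ} (hb : -1 < b) : IsFiniteMeasure (ballWeight n b) := by
  have h : Integrable (fun _ : Space n => (1 : ℝ)) (ballWeight n b) := by
    rw [ballWeight, integrable_weighted_iff, IntegrableOn, Measure.restrict_restrict
      isOpen_halfSpace.measurableSet]
    simpa [IntegrableOn] using integrableOn_weight_ball (n := n) hb 0 1
  exact (integrable_const_iff_isFiniteMeasure one_ne_zero).1 h

/-- Fubini in polar coordinates shows that y^b is integrable over almost every half-sphere inside
the unit ball; homogeneity of the weight then carries one such half-sphere to the unit one. -/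
lemma isFiniteMeasure_sphereWeight {b : ℝ} (hb : -1 < b) :
    IsFiniteMeasure (sphereWeight n b) := by
  have h : Integrable (fun _ : Space n => (1 : ℝ)) (sphereWeight n b) := by
    rw [sphereWeight, integrable_weighted_iff, unitSphereMeasure,
      sphere_measurableEmbedding.integrableOn_map_iff]
    have h0 := (integrable_indicator_iff (isOpen_halfSpace.measurableSet.inter
      measurableSet_ball)).2 (integrableOn_weight_ball (n := n) hb 0 1)
    have h1 := ((integrable_iff_integrable_polar volume).1 h0).prod_left_ae
    -- Radii below 1 have positive measure, so a good radius exists among them; below 1 the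
    -- indicator of the ball is no obstacle.
    have h2 : (Measure.volumeIoiPow (Module.finrank ℝ (Space n) - 1))
        (Iio ⟨1, mem_Ioi.2 one_pos⟩) ≠ 0 := by
      rw [Measure.volumeIoiPow_apply_Iio]
      simp only [one_pow, ne_eq, ENNReal.ofReal_eq_zero, not_le]
      positivity
    obtain ⟨r, hr, hint⟩ := (Frequently.and_eventually (frequently_ae_mem_iff.2 h2) h1).exists
    have hr0 : (0 : ℝ) < r := r.2
    have hr1 : (r : ℝ) < 1 := hr
    have hm : MeasurableSet ((fun ω : Metric.sphere (0 : Space n) 1 => (ω : Space n)) ⁻¹'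
        halfSpace n) := isOpen_halfSpace.measurableSet.preimage sphere_measurableEmbedding.measurable
    rw [← integrable_indicator_iff hm]
    refine (hint.const_mul ((r : ℝ) ^ b)⁻¹).congr (Eventually.of_forall fun ω => ?_)
    have hω : ‖(ω : Space n)‖ = 1 := by simp
    by_cases h : (ω : Space n) ∈ halfSpace n
    · have hmem : (r : ℝ) • (ω : Space n) ∈ halfSpace n ∩ Metric.ball 0 1 := by
        refine ⟨?_, ?_⟩
        · simpa using (add_smul_mem_halfSpace (c := (0 : Space n)) (by simp [yCoord]) hr0).2 h
        · simpa [norm_smul, hω, abs_of_pos hr0] using hr1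
      have hy : yCoord ((r : ℝ) • (ω : Space n)) = r * yCoord (ω : Space n) := by
        simpa using yCoord_add_smul (c := (0 : Space n)) (by simp [yCoord]) r (ω : Space n)
      simp only []
      rw [indicator_of_mem hmem, indicator_of_mem (mem_preimage.2 h), hy,
        Real.mul_rpow hr0.le (le_of_lt h)]
      have : (r : ℝ) ^ b ≠ 0 := (Real.rpow_pos_of_pos hr0 b).ne'
      simp [this]
    · have hmem : (r : ℝ) • (ω : Space n) ∉ halfSpace n ∩ Metric.ball 0 1 := by
        intro h'
        exact h (by simpa using (add_smul_mem_halfSpace (c := (0 : Space n))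
          (by simp [yCoord]) hr0 (Z := (ω : Space n))).1 (by simpa using h'.1))
      simp only []
      rw [indicator_of_notMem hmem, mul_zero]
      exact (indicator_of_notMem (s := (fun ω : Metric.sphere (0 : Space n) 1 => (ω : Space n)) ⁻¹'
        halfSpace n) (fun h' => h h') _).symm
  exact (integrable_const_iff_isFiniteMeasure one_ne_zero).1 h

end Weight

/-! ### Integrals of dilated functions and their differentiation in the dilation parameter. -/

section DilatedIntegrals

variable {n : ℕ}

/-- The derivative of `f` along dilations with centre `c`. -/
def Dil (c : Space n) (f : Space n → ℝ) (X : Space n) : ℝ := fderiv ℝ f X (X - c)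

/-- `q` is bounded on bounded subsets of the half-space. -/
def LocBdd (q : Space n → ℝ) : Prop :=
  ∀ R : ℝ, ∃ M, ∀ X ∈ halfSpace n, ‖X‖ ≤ R → |q X| ≤ M

/-- `q` is continuous in the half-space and bounded on its bounded subsets. -/
structure Admissible (q : Space n → ℝ) : Prop where
  cont : ContinuousOn q (halfSpace n)
  bdd : LocBdd q

lemma LocBdd.mul {f g : Space n → ℝ} (hf : LocBdd f) (hg : LocBdd g) :
    LocBdd (fun X => f X * g X) := by
  intro R
  obtain ⟨M, hM⟩ := hf R
  obtain ⟨N, hN⟩ := hg R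
  refine ⟨M * N, fun X hX hR => ?_⟩
  rw [abs_mul]
  exact mul_le_mul (hM X hX hR) (hN X hX hR) (abs_nonneg _) ((abs_nonneg _).trans (hM X hX hR))

lemma LocBdd.add {f g : Space n → ℝ} (hf : LocBdd f) (hg : LocBdd g) :
    LocBdd (fun X => f X + g X) := by
  intro R
  obtain ⟨M, hM⟩ := hf R
  obtain ⟨N, hN⟩ := hg R
  exact ⟨M + N, fun X hX hR => (abs_add_le _ _).trans (add_le_add (hM X hX hR) (hN X hX hR))⟩

lemma LocBdd.congr {f g : Space n → ℝ} (hf : LocBdd f) (h : ∀ X ∈ halfSpace n, g X = f X) :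
    LocBdd g := fun R =>
  let ⟨M, hM⟩ := hf R
  ⟨M, fun X hX hR => (h X hX).symm ▸ hM X hX hR⟩

lemma locBdd_of_continuous {f : Space n → ℝ} (hf : Continuous f) : LocBdd f := by
  intro R
  obtain ⟨M, hM⟩ := (isCompact_closedBall (0 : Space n) R).exists_bound_of_continuousOn
    hf.continuousOn
  exact ⟨M, fun X _ hR => hM X (by simpa using hR)⟩

lemma locBdd_const (a : ℝ) : LocBdd (fun _ : Space n => a) :=
  locBdd_of_continuous continuous_const

lemma LocBdd.const_mul {f : Space n → ℝ} (hf : LocBdd f) (a : ℝ) : LocBdd (fun X => a * f X) :=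
  (locBdd_const a).mul hf

lemma LocBdd.neg {f : Space n → ℝ} (hf : LocBdd f) : LocBdd (fun X => - f X) :=
  (hf.const_mul (-1)).congr fun X _ => by ring

lemma LocBdd.sub {f g : Space n → ℝ} (hf : LocBdd f) (hg : LocBdd g) :
    LocBdd (fun X => f X - g X) :=
  (hf.add hg.neg).congr fun X _ => by ring

lemma locBdd_sum {ι : Type*} (s : Finset ι) {f : ι → Space n → ℝ} (hf : ∀ i ∈ s, LocBdd (f i)) :
    LocBdd (fun X => ∑ i ∈ s, f i X) := by
  classical
  induction s using Finset.induction_on with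
  | empty => simpa using locBdd_const (n := n) 0
  | insert a s ha ih =>
    simp only [Finset.sum_insert ha]
    exact (hf a (by simp)).add (ih fun i hi => hf i (by simp [hi]))

lemma locBdd_rpow {b : ℝ} (hb : 0 ≤ b) : LocBdd (fun X : Space n => yCoord X ^ b) :=
  locBdd_of_continuous (continuous_yCoord.rpow_const fun _ => Or.inr hb)

lemma Admissible.mul {f g : Space n → ℝ} (hf : Admissible f) (hg : Admissible g) :
    Admissible (fun X => f X * g X) := ⟨hf.cont.mul hg.cont, hf.bdd.mul hg.bdd⟩

lemma Admissible.add {f g : Space n → ℝ} (hf : Admissible f) (hg : Admissible g) :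
    Admissible (fun X => f X + g X) := ⟨hf.cont.add hg.cont, hf.bdd.add hg.bdd⟩

lemma Admissible.sub {f g : Space n → ℝ} (hf : Admissible f) (hg : Admissible g) :
    Admissible (fun X => f X - g X) := ⟨hf.cont.sub hg.cont, hf.bdd.sub hg.bdd⟩

lemma Admissible.congr {f g : Space n → ℝ} (hf : Admissible f)
    (h : ∀ X ∈ halfSpace n, g X = f X) : Admissible g :=
  ⟨hf.cont.congr h, hf.bdd.congr h⟩

lemma admissible_of_continuous {f : Space n → ℝ} (hf : Continuous f) : Admissible f :=
  ⟨hf.continuousOn, locBdd_of_continuous hf⟩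

lemma admissible_const (a : ℝ) : Admissible (fun _ : Space n => a) :=
  admissible_of_continuous continuous_const

lemma Admissible.const_mul {f : Space n → ℝ} (hf : Admissible f) (a : ℝ) :
    Admissible (fun X => a * f X) := (admissible_const a).mul hf

lemma admissible_sum {ι : Type*} (s : Finset ι) {f : ι → Space n → ℝ}
    (hf : ∀ i ∈ s, Admissible (f i)) : Admissible (fun X => ∑ i ∈ s, f i X) :=
  ⟨continuousOn_finsetSum _ fun i hi => (hf i hi).cont, locBdd_sum s fun i hi => (hf i hi).bdd⟩

/-- The integral of the dilated function `Z ↦ q (c + r Z)`. -/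
def dilInt (ν : Measure (Space n)) (c : Space n) (q : Space n → ℝ) (r : ℝ) : ℝ :=
  ∫ Z, q (c + r • Z) ∂ν

variable {ν : Measure (Space n)} {c : Space n}

lemma OnUnitHalfBall.restrict_eq (hν : OnUnitHalfBall ν) : ν.restrict (halfSpace n) = ν :=
  Measure.restrict_eq_self_of_ae_mem (hν.mono fun _ h => h.1)

lemma Admissible.aestronglyMeasurable_dil {q : Space n → ℝ} (hq : Admissible q)
    (hν : OnUnitHalfBall ν) (hc : yCoord c = 0) {r : ℝ} (hr : 0 < r) :
    AEStronglyMeasurable (fun Z => q (c + r • Z)) ν := by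
  have h : ContinuousOn (fun Z => q (c + r • Z)) (halfSpace n) :=
    hq.cont.comp (by fun_prop) fun Z hZ => (add_smul_mem_halfSpace hc hr).2 hZ
  rw [← hν.restrict_eq]
  exact h.aestronglyMeasurable isOpen_halfSpace.measurableSet

lemma norm_add_smul_le {r R : ℝ} (hr : 0 < r) (hrR : r ≤ R) {Z : Space n} (hZ : ‖Z‖ ≤ 1) :
    ‖c + r • Z‖ ≤ ‖c‖ + R := by
  refine (norm_add_le _ _).trans (add_le_add le_rfl ?_)
  rw [norm_smul, Real.norm_eq_abs, abs_of_pos hr]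
  nlinarith [norm_nonneg Z]

lemma Admissible.exists_bound_dil {q : Space n → ℝ} (hq : LocBdd q)
    (hν : OnUnitHalfBall ν) (hc : yCoord c = 0) (R : ℝ) :
    ∃ M, ∀ᵐ Z ∂ν, ∀ r ∈ Ioc 0 R, |q (c + r • Z)| ≤ M := by
  obtain ⟨M, hM⟩ := hq (‖c‖ + R)
  refine ⟨M, hν.mono fun Z hZ r hr => ?_⟩
  exact hM _ ((add_smul_mem_halfSpace hc hr.1).2 hZ.1) (norm_add_smul_le hr.1 hr.2 hZ.2)

lemma Admissible.integrable_dil {q : Space n → ℝ} (hq : Admissible q) [IsFiniteMeasure ν]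
    (hν : OnUnitHalfBall ν) (hc : yCoord c = 0) {r : ℝ} (hr : 0 < r) :
    Integrable (fun Z => q (c + r • Z)) ν := by
  obtain ⟨M, hM⟩ := Admissible.exists_bound_dil hq.bdd hν hc r
  exact Integrable.of_bound (hq.aestronglyMeasurable_dil hν hc hr) M
    (hM.mono fun Z hZ => hZ r ⟨hr, le_rfl⟩)

lemma Admissible.continuousAt_dilInt {q : Space n → ℝ} (hq : Admissible q) [IsFiniteMeasure ν]
    (hν : OnUnitHalfBall ν) (hc : yCoord c = 0) {r : ℝ} (hr : 0 < r) :
    ContinuousAt (dilInt ν c q) r := by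
  obtain ⟨M, hM⟩ := Admissible.exists_bound_dil hq.bdd hν hc (r + 1)
  have hnear : ∀ᶠ t in 𝓝 r, t ∈ Ioc 0 (r + 1) := Ioc_mem_nhds hr (lt_add_one r)
  refine continuousAt_of_dominated (bound := fun _ => M) ?_ ?_ (integrable_const M) ?_
  · exact hnear.mono fun t ht => hq.aestronglyMeasurable_dil hν hc ht.1
  · exact hnear.mono fun t ht => hM.mono fun Z hZ => hZ t ht
  · refine hν.mono fun Z hZ => ?_
    have h1 : ContinuousAt q (c + r • Z) :=
      hq.cont.continuousAt (isOpen_halfSpace.mem_nhds ((add_smul_mem_halfSpace hc hr).2 hZ.1))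
    exact ContinuousAt.comp (f := fun t : ℝ => c + t • Z) h1 (by fun_prop)

/-- By the chain rule the derivative of q(c + rZ) in r is ∇q·Z, and rZ is the displacement from c.
Local boundedness of the dilation derivative provides the dominating constant. -/
lemma Admissible.hasDerivAt_dilInt {q : Space n → ℝ} (hq : Admissible q)
    (hd : ∀ X ∈ halfSpace n, DifferentiableAt ℝ q X) (hq' : Admissible (Dil c q))
    [IsFiniteMeasure ν] (hν : OnUnitHalfBall ν) (hc : yCoord c = 0) {r : ℝ} (hr : 0 < r) :
    HasDerivAt (dilInt ν c q) (r⁻¹ * dilInt ν c (Dil c q) r) r := by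
  obtain ⟨M, hM⟩ := Admissible.exists_bound_dil hq'.bdd hν hc (r + 1)
  -- Staying above r/2 keeps the factor t⁻¹ bounded.
  have hnhds : Ioc (r / 2) (r + 1) ∈ 𝓝 r := Ioc_mem_nhds (half_lt_self hr) (lt_add_one r)
  have hpos : ∀ t ∈ Ioc (r / 2) (r + 1), 0 < t := fun t ht => (half_pos hr).trans ht.1
  have key := hasDerivAt_integral_of_dominated_loc_of_deriv_le (μ := ν)
    (F := fun t Z => q (c + t • Z)) (F' := fun t Z => t⁻¹ * Dil c q (c + t • Z))
    (bound := fun _ => (r / 2)⁻¹ * M) (x₀ := r) hnhds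
    (eventually_of_mem hnhds fun t ht => hq.aestronglyMeasurable_dil hν hc (hpos t ht))
    (hq.integrable_dil hν hc hr)
    ((hq'.aestronglyMeasurable_dil hν hc hr).const_mul _) ?_ (integrable_const _) ?_
  · have h2 := key.2
    rwa [integral_const_mul] at h2
  · refine hM.mono fun Z hZ t ht => ?_
    have ht0 := hpos t ht
    rw [norm_mul, Real.norm_eq_abs, Real.norm_eq_abs, abs_of_pos (inv_pos.2 ht0)]
    exact mul_le_mul (inv_anti₀ (half_pos hr) ht.1.le) (hZ t ⟨ht0, ht.2⟩) (abs_nonneg _)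
      (by positivity)
  · refine hν.mono fun Z hZ t ht => ?_
    have ht0 := hpos t ht
    have h1 := (hd _ ((add_smul_mem_halfSpace hc ht0).2 hZ.1)).hasFDerivAt
    have h2 : HasDerivAt (fun t : ℝ => c + t • Z) Z t := by
      simpa using ((hasDerivAt_id t).smul_const Z).const_add c
    have h3 := h1.comp_hasDerivAt t h2
    have h4 : t⁻¹ * Dil c q (c + t • Z) = fderiv ℝ q (c + t • Z) Z := by
      rw [Dil, add_sub_cancel_left, map_smul, smul_eq_mul, inv_mul_cancel_left₀ ht0.ne']
    rw [h4]
    exact h3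

end DilatedIntegrals

/-! ### Rescaling integrals over half-spheres and half-balls to unit size. -/

section Conversions

variable {n : ℕ}

lemma yCoord_bdry (x : EuclideanSpace ℝ (Fin n)) : yCoord (bdry x) = 0 := by
  simp [yCoord, bdry]

lemma measurableEmbedding_add_smul (c : Space n) {r : ℝ} (hr : 0 < r) :
    MeasurableEmbedding (fun Z : Space n => c + r • Z) :=
  (Homeomorph.addLeft c).measurableEmbedding.comp (measurableEmbedding_const_smul₀ hr.ne')

lemma preimage_halfSpace {c : Space n} (hc : yCoord c = 0) {r : ℝ} (hr : 0 < r) :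
    (fun Z : Space n => c + r • Z) ⁻¹' halfSpace n = halfSpace n := by
  ext Z; exact add_smul_mem_halfSpace hc hr

lemma surfaceMeasure_eq (c : Space n) {r : ℝ} (hr : 0 < r) :
    surfaceMeasure c r = ENNReal.ofReal (r ^ n) •
      (unitSphereMeasure n).map (fun Z => c + r • Z) := by
  rw [surfaceMeasure, unitSphereMeasure, Measure.map_map
    (measurableEmbedding_add_smul c hr).measurable sphere_measurableEmbedding.measurable]
  rfl

/-- The surface element contributes r^n, and the weight contributes r^b because the centre lies on y
= 0. -/
lemma halfSphereIntegral_weight_mul (x₀ : EuclideanSpace ℝ (Fin n)) {r : ℝ} (hr : 0 < r) (b : ℝ)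
    (q : Space n → ℝ) :
    halfSphereIntegral x₀ r (fun X => yCoord X ^ b * q X) =
      r ^ ((n : ℝ) + b) * dilInt (sphereWeight n b) (bdry x₀) q r := by
  rw [halfSphereIntegral, surfaceMeasure_eq _ hr, Measure.restrict_smul, integral_smul_measure,
    (measurableEmbedding_add_smul _ hr).setIntegral_map, preimage_halfSpace (yCoord_bdry x₀) hr,
    dilInt, sphereWeight, integral_weighted, ENNReal.toReal_ofReal (by positivity),
    Real.rpow_add hr, Real.rpow_natCast, mul_assoc, smul_eq_mul, ← integral_const_mul (r ^ b)]
  congr 1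
  refine setIntegral_congr_fun isOpen_halfSpace.measurableSet fun Z hZ => ?_
  beta_reduce
  rw [yCoord_add_smul (yCoord_bdry x₀), Real.mul_rpow hr.le (le_of_lt hZ), mul_assoc]

lemma Admissible.integrableOn_surfaceMeasure {b : ℝ} (hb : -1 < b) {q : Space n → ℝ}
    (hq : Admissible q) (x₀ : EuclideanSpace ℝ (Fin n)) {r : ℝ} (hr : 0 < r) :
    IntegrableOn (fun X => yCoord X ^ b * q X) (halfSpace n) (surfaceMeasure (bdry x₀) r) := by
  have := isFiniteMeasure_sphereWeight (n := n) hb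
  have h := hq.integrable_dil (onUnitHalfBall_sphereWeight b) (yCoord_bdry x₀) hr
  rw [sphereWeight, integrable_weighted_iff] at h
  rw [surfaceMeasure_eq _ hr, IntegrableOn, Measure.restrict_smul]
  refine Integrable.smul_measure ?_ ENNReal.ofReal_ne_top
  rw [← IntegrableOn, (measurableEmbedding_add_smul _ hr).integrableOn_map_iff,
    preimage_halfSpace (yCoord_bdry x₀) hr]
  refine (h.const_mul (r ^ b)).congr ?_
  filter_upwards [ae_restrict_mem isOpen_halfSpace.measurableSet] with Z hZ
  simp only [Function.comp_apply]
  rw [yCoord_add_smul (yCoord_bdry x₀), Real.mul_rpow hr.le (le_of_lt hZ), mul_assoc]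

lemma Admissible.integrableOn_ball {b : ℝ} (hb : -1 < b) {q : Space n → ℝ}
    (hq : Admissible q) (c : Space n) (R : ℝ) :
    IntegrableOn (fun X => yCoord X ^ b * q X) (halfSpace n ∩ Metric.ball c R) := by
  obtain ⟨M, hM⟩ := hq.bdd (‖c‖ + R)
  have hm : MeasurableSet (halfSpace n ∩ Metric.ball c R) :=
    isOpen_halfSpace.measurableSet.inter measurableSet_ball
  refine Integrable.mul_bdd (c := M) (integrableOn_weight_ball hb c R)
    ((hq.cont.mono inter_subset_left).aestronglyMeasurable hm) ?_
  filter_upwards [ae_restrict_mem hm] with X hX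
  refine hM X hX.1 ?_
  have h1 : ‖X - c‖ < R := by simpa [dist_eq_norm] using hX.2
  have h2 := norm_add_le (X - c) c
  rw [sub_add_cancel] at h2
  linarith

lemma setIntegral_ball_weight_mul {c : Space n} (hc : yCoord c = 0) {r : ℝ} (hr : 0 < r) (b : ℝ)
    (q : Space n → ℝ) :
    ∫ X in halfSpace n ∩ Metric.ball c r, yCoord X ^ b * q X =
      r ^ ((n : ℝ) + 1 + b) * dilInt (ballWeight n b) c q r := by
  have hm : MeasurableSet (halfSpace n ∩ Metric.ball c r) :=
    isOpen_halfSpace.measurableSet.inter measurableSet_ball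
  have h0 : ∀ Z : Space n, c + r • Z ∈ halfSpace n ∩ Metric.ball c r ↔
      Z ∈ halfSpace n ∩ Metric.ball 0 1 := by
    intro Z
    simp only [mem_inter_iff, add_smul_mem_halfSpace hc hr]
    simp [norm_smul, abs_of_pos hr, hr]
  have h1 := Measure.integral_comp_smul_of_nonneg (volume : Measure (Space n))
    (fun X => (halfSpace n ∩ Metric.ball c r).indicator
      (fun X => yCoord X ^ b * q X) (c + X)) r (hR := hr.le)
  rw [integral_add_left_eq_self
    (f := (halfSpace n ∩ Metric.ball c r).indicator (fun X => yCoord X ^ b * q X)),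
    integral_indicator hm, smul_eq_mul, finrank_euclideanSpace_fin] at h1
  have h2 : ∫ X in halfSpace n ∩ Metric.ball c r, yCoord X ^ b * q X = r ^ (n + 1) *
      ∫ Z : Space n, (halfSpace n ∩ Metric.ball c r).indicator
        (fun X => yCoord X ^ b * q X) (c + r • Z) := by
    rw [h1, ← mul_assoc, mul_inv_cancel₀ (by positivity), one_mul]
  rw [h2, dilInt, ballWeight, integral_weighted, Measure.restrict_restrict
    isOpen_halfSpace.measurableSet, Real.rpow_add hr, mul_assoc, ← integral_const_mul (r ^ b),
    ← integral_indicator (isOpen_halfSpace.measurableSet.inter measurableSet_ball)]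
  congr 1
  · rw [← Nat.cast_add_one, Real.rpow_natCast]
  · apply integral_congr_ae
    refine Eventually.of_forall fun Z => ?_
    by_cases hZ : Z ∈ halfSpace n ∩ Metric.ball 0 1
    · beta_reduce
      rw [indicator_of_mem ((h0 Z).2 hZ), indicator_of_mem hZ, yCoord_add_smul hc,
        Real.mul_rpow hr.le (le_of_lt hZ.1), mul_assoc]
    · beta_reduce
      rw [indicator_of_notMem (fun h => hZ ((h0 Z).1 h)), indicator_of_notMem hZ]

/-- Identifies the slices produced by polar coordinates with the rescaled half-sphere integrals, so
that a half-ball integral can be differentiated in its radius. -/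
lemma pow_mul_sphere_integral {c : Space n} (hc : yCoord c = 0) {r : ℝ} (hr : 0 < r) (b : ℝ)
    (q : Space n → ℝ) :
    r ^ n * ∫ ω : Metric.sphere (0 : Space n) 1, (halfSpace n).indicator
      (fun X => yCoord X ^ b * q X) (c + r • (ω : Space n)) ∂(volume : Measure (Space n)).toSphere =
      r ^ ((n : ℝ) + b) * dilInt (sphereWeight n b) c q r := by
  rw [dilInt, sphereWeight, integral_weighted, Real.rpow_add hr, Real.rpow_natCast, mul_assoc,
    ← integral_const_mul (r ^ b), ← integral_indicator isOpen_halfSpace.measurableSet,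
    unitSphereMeasure, sphere_measurableEmbedding.integral_map]
  congr 1
  apply integral_congr_ae
  refine Eventually.of_forall fun ω => ?_
  by_cases h : (ω : Space n) ∈ halfSpace n
  · beta_reduce
    rw [indicator_of_mem ((add_smul_mem_halfSpace hc hr).2 h), indicator_of_mem h,
      yCoord_add_smul hc, Real.mul_rpow hr.le (le_of_lt h), mul_assoc]
  · beta_reduce
    rw [indicator_of_notMem (fun h' => h ((add_smul_mem_halfSpace hc hr).1 h')),
      indicator_of_notMem h]

lemma Admissible.integrableOn_polar {b : ℝ} (hb : -1 < b) {q : Space n → ℝ}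
    (hq : Admissible q) {c : Space n} (hc : yCoord c = 0) (R : ℝ) :
    IntegrableOn (fun r => r ^ ((n : ℝ) + b) * dilInt (sphereWeight n b) c q r) (Ioo 0 R) := by
  have h := hq.integrableOn_ball hb c R
  rw [← integrableOn_indicator_iff isOpen_halfSpace.measurableSet] at h
  refine (integrableOn_ball_polar volume h).congr_fun (fun r hr => ?_) measurableSet_Ioo
  beta_reduce
  rw [finrank_euclideanSpace_fin, Nat.add_sub_cancel, pow_mul_sphere_integral hc hr.1]

/-- Polar coordinates on a half-ball. -/
lemma Admissible.setIntegral_ball_eq {b : ℝ} (hb : -1 < b) {q : Space n → ℝ}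
    (hq : Admissible q) {c : Space n} (hc : yCoord c = 0) {R : ℝ} (hR : 0 < R) :
    ∫ X in halfSpace n ∩ Metric.ball c R, yCoord X ^ b * q X =
      ∫ r in (0 : ℝ)..R, r ^ ((n : ℝ) + b) * dilInt (sphereWeight n b) c q r := by
  have h := hq.integrableOn_ball hb c R
  rw [← integrableOn_indicator_iff isOpen_halfSpace.measurableSet] at h
  rw [inter_comm, ← setIntegral_indicator isOpen_halfSpace.measurableSet,
    setIntegral_ball_eq_polar volume hR h]
  refine intervalIntegral.integral_congr_ae (Eventually.of_forall fun r hr => ?_)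
  rw [uIoc_of_le hR.le] at hr
  rw [finrank_euclideanSpace_fin, Nat.add_sub_cancel, pow_mul_sphere_integral hc hr.1]

end Conversions

/-! ### The divergence theorem in the half-space, and the cutoff. -/

section Divergence

variable {n : ℕ}

/-- The point `(x, t)`. -/
def liftPt (x : EuclideanSpace ℝ (Fin n)) (t : ℝ) : Space n :=
  WithLp.toLp 2 (Fin.snoc (α := fun _ => ℝ) (fun i => x i) t)

lemma liftPt_zero (x : EuclideanSpace ℝ (Fin n)) : liftPt x 0 = bdry x := rfl

@[simp] lemma liftPt_last (x : EuclideanSpace ℝ (Fin n)) (t : ℝ) :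
    liftPt x t (Fin.last n) = t := by simp [liftPt]

@[simp] lemma liftPt_castSucc (x : EuclideanSpace ℝ (Fin n)) (t : ℝ) (j : Fin n) :
    liftPt x t j.castSucc = x j := by simp [liftPt]

@[simp] lemma yCoord_liftPt (x : EuclideanSpace ℝ (Fin n)) (t : ℝ) : yCoord (liftPt x t) = t :=
  liftPt_last x t

lemma liftPt_mem_halfSpace {x : EuclideanSpace ℝ (Fin n)} {t : ℝ} (ht : 0 < t) :
    liftPt x t ∈ halfSpace n := by simpa [halfSpace] using ht

lemma norm_sq_liftPt (x : EuclideanSpace ℝ (Fin n)) (t : ℝ) :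
    ‖liftPt x t‖ ^ 2 = ‖x‖ ^ 2 + t ^ 2 := by
  simp [EuclideanSpace.real_norm_sq_eq, Fin.sum_univ_castSucc]

lemma norm_le_norm_liftPt (x : EuclideanSpace ℝ (Fin n)) (t : ℝ) : ‖x‖ ≤ ‖liftPt x t‖ := by
  refine le_of_sq_le_sq ?_ (norm_nonneg _)
  rw [norm_sq_liftPt]; nlinarith [sq_nonneg t]

lemma continuous_liftPt : Continuous fun z : EuclideanSpace ℝ (Fin n) × ℝ => liftPt z.1 z.2 := by
  refine (PiLp.continuous_toLp 2 _).comp (continuous_pi fun j => ?_)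
  refine Fin.lastCases ?_ (fun i => ?_) j
  · simpa using continuous_snd
  · simp only [Fin.snoc_castSucc]; fun_prop

lemma continuous_bdry : Continuous (bdry : EuclideanSpace ℝ (Fin n) → Space n) :=
  continuous_liftPt.comp (by fun_prop : Continuous fun x => ((x : EuclideanSpace ℝ (Fin n)), (0 : ℝ)))

/-- The `j`-th unit vector. -/
abbrev unitVec (j : Fin (n + 1)) : Space n := EuclideanSpace.single j 1

/-- The divergence of a vector field given by its components. -/
def divergence (K : Fin (n + 1) → Space n → ℝ) (X : Space n) : ℝ :=
  ∑ j, fderiv ℝ (K j) X (unitVec j)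

lemma divergence_eq_zero {K : Fin (n + 1) → Space n → ℝ} {ρ : ℝ}
    (h0 : ∀ j X, ρ ≤ ‖X‖ → K j X = 0) {X : Space n} (hX : ρ < ‖X‖) : divergence K X = 0 := by
  refine Finset.sum_eq_zero fun j _ => ?_
  have : K j =ᶠ[𝓝 X] fun _ => 0 := by
    filter_upwards [(isOpen_lt continuous_const continuous_norm).mem_nhds hX] with Y hY
    exact h0 j Y (le_of_lt hY)
  rw [this.fderiv_eq]
  simp

/-- The box divergence theorem is applied to a box with bottom face at height ε, so large that the
field vanishes on all its other faces. Staying at positive height avoids any regularity at y = 0. -/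
lemma integral_divergence_above {K : Fin (n + 1) → Space n → ℝ} {ρ : ℝ}
    (hK : ∀ j, ∀ X ∈ halfSpace n, DifferentiableAt ℝ (K j) X)
    (h0 : ∀ j X, ρ ≤ ‖X‖ → K j X = 0) (hint : IntegrableOn (divergence K) (halfSpace n))
    {ε : ℝ} (hε : 0 < ε) :
    ∫ X in {X | ε ≤ yCoord X}, divergence K X =
      - ∫ x : EuclideanSpace ℝ (Fin n), K (Fin.last n) (liftPt x ε) := by
  -- Large enough to exceed both the radius of the support and the height ε.
  set L : ℝ := |ρ| + ε + 1 with hL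
  have hρL : ρ < L := by have := le_abs_self ρ; linarith
  have hL0 : 0 < L := by have := abs_nonneg ρ; linarith
  have hεL : ε ≤ L := by have := abs_nonneg ρ; linarith
  set a : Fin (n + 1) → ℝ := Fin.snoc (α := fun _ => ℝ) (fun _ => -L) ε with ha
  set b : Fin (n + 1) → ℝ := fun _ => L with hb
  have ha_last : a (Fin.last n) = ε := by simp [ha]
  have ha_cast : ∀ i : Fin n, a i.castSucc = -L := fun i => by simp [ha]
  have hab : a ≤ b := fun j => by
    refine Fin.lastCases ?_ (fun i => ?_) j
    · rw [ha_last]; exact hεL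
    · rw [ha_cast]; show -L ≤ L; linarith
  have hpos : ∀ x : Fin (n + 1) → ℝ, x ∈ Icc a b → WithLp.toLp 2 x ∈ halfSpace n := by
    intro x hx
    have := hx.1 (Fin.last n)
    rw [ha_last] at this
    exact hε.trans_le this
  have hmeas : MeasurableSet {X : Space n | ε ≤ yCoord X} :=
    (isClosed_le continuous_const continuous_yCoord).measurableSet
  have hsub : {X : Space n | ε ≤ yCoord X} ⊆ halfSpace n := fun X hX => hε.trans_le hX
  have hemb := (MeasurableEquiv.toLp 2 (Fin (n + 1) → ℝ)).measurableEmbedding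
  have hvol := PiLp.volume_preserving_toLp (Fin (n + 1))
  have hdiff : ∀ x ∈ Icc a b, ∀ j, HasFDerivAt (fun x => K j (WithLp.toLp 2 x))
      ((fderiv ℝ (K j) (WithLp.toLp 2 x)).comp
        (PiLp.continuousLinearEquiv 2 ℝ (fun _ : Fin (n + 1) => ℝ)).symm.toContinuousLinearMap) x := by
    intro x hx j
    exact (hK j _ (hpos x hx)).hasFDerivAt.comp x (PiLp.hasFDerivAt_toLp 2 x)
  have hdivx : ∀ x, (∑ j, ((fderiv ℝ (K j) (WithLp.toLp 2 x)).comp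
        (PiLp.continuousLinearEquiv 2 ℝ (fun _ : Fin (n + 1) => ℝ)).symm.toContinuousLinearMap)
          (Pi.single j 1)) = divergence K (WithLp.toLp 2 x) := by
    intro x
    rfl
  have hInt : IntegrableOn (fun x => divergence K (WithLp.toLp 2 x)) (Icc a b) := by
    have h1 := (hvol.integrableOn_comp_preimage hemb (f := divergence K) (s := halfSpace n)).2 hint
    exact h1.mono_set fun x hx => hpos x hx
  have key := integral_divergence_of_hasFDerivAt_off_countable' a b hab
    (fun j x => K j (WithLp.toLp 2 x)) _ ∅ countable_empty
    (fun j x hx => (hdiff x hx j).continuousAt.continuousWithinAt)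
    (fun x hx j => hdiff x ⟨fun i => (hx.1 i trivial).1.le, fun i => (hx.1 i trivial).2.le⟩ j)
    (by simpa only [hdivx] using hInt)
  simp only [hdivx] at key
  -- A coordinate of size L forces the norm past ρ, where the field is zero.
  have hbig : ∀ (j : Fin (n + 1)) (t : ℝ) (x : Fin n → ℝ), |t| = L →
      K j (WithLp.toLp 2 (j.insertNth (α := fun _ => ℝ) t x)) = 0 := by
    intro j t x ht
    refine h0 j _ (hρL.le.trans ?_)
    have := abs_apply_le_norm (WithLp.toLp 2 (j.insertNth (α := fun _ => ℝ) t x) : Space n) j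
    simpa [ht] using this
  rw [Fin.sum_univ_castSucc, Finset.sum_eq_zero, zero_add] at key
  · have htop : ∀ x : Fin n → ℝ, K (Fin.last n) (WithLp.toLp 2
        ((Fin.last n).insertNth (α := fun _ => ℝ) (b (Fin.last n)) x)) = 0 :=
      fun x => hbig _ _ x (abs_of_pos hL0)
    simp only [htop, integral_zero, zero_sub, ha_last] at key
    have hleft : ∫ x in Icc a b, divergence K (WithLp.toLp 2 x) =
        ∫ X in {X | ε ≤ yCoord X}, divergence K X := by
      rw [← hvol.setIntegral_preimage_emb hemb]
      symm
      refine setIntegral_eq_of_subset_of_forall_sdiff_eq_zero (hmeas.preimage hvol.measurable)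
        (fun x hx => ?_) fun x hx => ?_
      · have := hx.1 (Fin.last n)
        rw [ha_last] at this
        exact this
      -- A point of norm at most ρ with y ≥ ε lies in the box, so a point outside the box is beyond
      -- the support.
      · refine divergence_eq_zero h0 ?_
        by_contra hle
        rw [not_lt] at hle
        refine hx.2 ⟨fun j => ?_, fun j => ?_⟩
        · refine Fin.lastCases ?_ (fun i => ?_) j
          · rw [ha_last]; exact hx.1
          · rw [ha_cast]
            have := (abs_le.1 (abs_apply_le_norm (WithLp.toLp 2 x : Space n) i.castSucc)).1
            simp only at this
            linarith
        · have := (abs_le.1 (abs_apply_le_norm (WithLp.toLp 2 x : Space n) j)).2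
          simp only at this
          show x j ≤ L
          linarith
    rw [← hleft, key]
    congr 1
    rw [← (PiLp.volume_preserving_toLp (Fin n)).integral_comp
      (MeasurableEquiv.toLp 2 (Fin n → ℝ)).measurableEmbedding]
    have hpt : ∀ x : Fin n → ℝ, (WithLp.toLp 2 ((Fin.last n).insertNth (α := fun _ => ℝ) ε x) : Space n)
        = liftPt (WithLp.toLp 2 x) ε := by
      intro x
      rw [Fin.insertNth_last]
      rfl
    simp only [hpt]
    refine setIntegral_eq_integral_of_forall_compl_eq_zero fun x hx => h0 _ _ ?_
    by_contra hle
    rw [not_le] at hle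
    refine hx ⟨fun i => ?_, fun i => ?_⟩
    · have := (abs_le.1 (abs_apply_le_norm (liftPt (WithLp.toLp 2 x) ε) i.castSucc)).1
      simp only [liftPt_castSucc] at this
      simp only [Function.comp_apply, Fin.succAbove_last, ha_cast]
      linarith
    · have := (abs_le.1 (abs_apply_le_norm (liftPt (WithLp.toLp 2 x) ε) i.castSucc)).2
      simp only [liftPt_castSucc] at this
      show x i ≤ L
      linarith
  · intro i _
    have h1 : ∀ x : Fin n → ℝ, K i.castSucc (WithLp.toLp 2
        (i.castSucc.insertNth (α := fun _ => ℝ) (b i.castSucc) x)) = 0 :=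
      fun x => hbig _ _ x (abs_of_pos hL0)
    have h2 : ∀ x : Fin n → ℝ, K i.castSucc (WithLp.toLp 2
        (i.castSucc.insertNth (α := fun _ => ℝ) (a i.castSucc) x)) = 0 :=
      fun x => hbig _ _ x (by rw [ha_cast, abs_neg, abs_of_pos hL0])
    simp only [h1, h2, integral_zero, sub_zero]

/-- The divergence theorem in the half-space for fields that vanish outside a ball. -/
lemma integral_divergence_halfSpace {K : Fin (n + 1) → Space n → ℝ} {ρ M : ℝ}
    {k : EuclideanSpace ℝ (Fin n) → ℝ}
    (hK : ∀ j, ∀ X ∈ halfSpace n, DifferentiableAt ℝ (K j) X)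
    (h0 : ∀ j X, ρ ≤ ‖X‖ → K j X = 0) (hint : IntegrableOn (divergence K) (halfSpace n))
    (hM : ∀ X ∈ halfSpace n, |K (Fin.last n) X| ≤ M)
    (hk : ∀ x, Tendsto (fun t => K (Fin.last n) (liftPt x t)) (𝓝[>] 0) (𝓝 (k x))) :
    ∫ X in halfSpace n, divergence K X = - ∫ x, k x := by
  -- The half-space is exhausted by slabs y ≥ u i with u i → 0. The bottom fluxes converge by
  -- dominated convergence, M on a ball being the dominating function.
  let u : ℕ → ℝ := fun i => 1 / ((i : ℝ) + 1)
  have hu0 : ∀ i, 0 < u i := fun i => Nat.one_div_pos_of_nat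
  have hu : Tendsto u atTop (𝓝[>] 0) :=
    tendsto_nhdsWithin_iff.2 ⟨tendsto_one_div_add_atTop_nhds_zero_nat,
      Eventually.of_forall fun i => hu0 i⟩
  have hunion : (⋃ i, {X : Space n | u i ≤ yCoord X}) = halfSpace n := by
    ext X
    simp only [mem_iUnion, mem_ofPred_eq, halfSpace]
    constructor
    · rintro ⟨i, hi⟩; exact (hu0 i).trans_le hi
    · intro hX
      obtain ⟨i, hi⟩ := exists_nat_one_div_lt hX
      exact ⟨i, hi.le⟩
  have h1 : Tendsto (fun i => ∫ X in {X : Space n | u i ≤ yCoord X}, divergence K X) atTop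
      (𝓝 (∫ X in halfSpace n, divergence K X)) := by
    rw [← hunion]
    refine tendsto_setIntegral_of_monotone (fun i =>
      (isClosed_le continuous_const continuous_yCoord).measurableSet) ?_ (by rwa [hunion])
    intro i j hij X hX
    have hX' : u i ≤ yCoord X := hX
    exact (Nat.one_div_le_one_div hij).trans hX'
  have h2 : Tendsto (fun i => - ∫ x : EuclideanSpace ℝ (Fin n), K (Fin.last n) (liftPt x (u i)))
      atTop (𝓝 (- ∫ x, k x)) := by
    refine (tendsto_integral_of_dominated_convergence
      (fun x => (Metric.closedBall (0 : EuclideanSpace ℝ (Fin n)) ρ).indicator (fun _ => M) x)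
      (fun i => ?_) ?_ (fun i => ?_) ?_).neg
    · refine Continuous.aestronglyMeasurable (continuous_iff_continuousAt.2 fun x => ?_)
      have hx : ContinuousAt (K (Fin.last n)) (liftPt x (u i)) :=
        (hK _ _ (liftPt_mem_halfSpace (hu0 i))).continuousAt
      exact ContinuousAt.comp (f := fun x => liftPt x (u i)) hx
        (continuous_liftPt.comp (by fun_prop : Continuous fun x => (x, u i))).continuousAt
    · rw [integrable_indicator_iff measurableSet_closedBall]
      exact integrableOn_const (by simp [measure_closedBall_lt_top.ne])
    · refine Eventually.of_forall fun x => ?_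
      by_cases hx : x ∈ Metric.closedBall (0 : EuclideanSpace ℝ (Fin n)) ρ
      · rw [indicator_of_mem hx]
        exact hM _ (liftPt_mem_halfSpace (hu0 i))
      · rw [indicator_of_notMem hx, h0 _ _ ?_, norm_zero]
        rw [mem_closedBall_zero_iff, not_le] at hx
        exact hx.le.trans (norm_le_norm_liftPt x _)
    · exact Eventually.of_forall fun x => (hk x).comp hu
  refine tendsto_nhds_unique h1 (h2.congr fun i => ?_)
  exact (integral_divergence_above hK h0 hint (hu0 i)).symm

/-- The positive part has a corner at 0 but its square does not; this is why the cutoff enters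
squared. -/
lemma hasDerivAt_max_zero_sq (t : ℝ) : HasDerivAt (fun t : ℝ => max t 0 ^ 2) (2 * max t 0) t := by
  rcases lt_trichotomy t 0 with h | h | h
  · have h1 : (fun t : ℝ => max t 0 ^ 2) =ᶠ[𝓝 t] fun _ => 0 := by
      filter_upwards [Iio_mem_nhds h] with s hs
      rw [max_eq_right (le_of_lt hs)]; simp
    rw [max_eq_right h.le, mul_zero]
    exact (hasDerivAt_const t (0 : ℝ)).congr_of_eventuallyEq h1
  · subst h
    rw [max_self, mul_zero, hasDerivAt_iff_isLittleO]
    refine Asymptotics.IsBigO.trans_isLittleO (g := fun t : ℝ => t ^ 2) ?_ ?_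
    · refine Asymptotics.isBigO_of_le _ fun s => ?_
      simp only [max_self, sub_zero, smul_zero, ne_eq, OfNat.ofNat_ne_zero, not_false_eq_true,
        zero_pow]
      rw [norm_pow, norm_pow]
      refine pow_le_pow_left₀ (norm_nonneg _) ?_ 2
      rw [Real.norm_eq_abs, Real.norm_eq_abs, abs_of_nonneg (le_max_right s 0)]
      exact max_le (le_abs_self s) (abs_nonneg s)
    · simpa using Asymptotics.isLittleO_pow_id (𝕜 := ℝ) (n := 2) (by norm_num)
  · have h1 : (fun t : ℝ => max t 0 ^ 2) =ᶠ[𝓝 t] fun t => t ^ 2 := by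
      filter_upwards [Ioi_mem_nhds h] with s hs
      rw [max_eq_left (le_of_lt hs)]
    rw [max_eq_left h.le]
    simpa using (hasDerivAt_pow 2 t).congr_of_eventuallyEq h1

/-- The cutoff `(R² - |X - c|²)₊`. -/
def bump (c : Space n) (R : ℝ) (X : Space n) : ℝ := max (R ^ 2 - ‖X - c‖ ^ 2) 0

lemma continuous_bump (c : Space n) (R : ℝ) : Continuous (bump c R) := by
  unfold bump; fun_prop

lemma bump_eq_zero {c X : Space n} {R : ℝ} (hR : 0 < R) (h : R ≤ ‖X - c‖) : bump c R X = 0 :=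
  max_eq_right (by nlinarith)

lemma hasFDerivAt_bump_sq (c : Space n) (R : ℝ) (X : Space n) :
    HasFDerivAt (fun X => bump c R X ^ 2) ((-4 * bump c R X) • innerSL ℝ (X - c)) X := by
  have h1 : HasFDerivAt (fun X : Space n => R ^ 2 - ‖X - c‖ ^ 2) (-(2 • innerSL ℝ (X - c))) X := by
    have := ((hasFDerivAt_id X).sub_const c).norm_sq.const_sub (R ^ 2)
    simpa using this
  have h2 := (hasDerivAt_max_zero_sq (R ^ 2 - ‖X - c‖ ^ 2)).comp_hasFDerivAt X h1
  refine h2.congr_fderiv ?_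
  ext Y
  simp [bump]
  ring

lemma fderiv_bump_sq_unitVec (c : Space n) (R : ℝ) (X : Space n) (j : Fin (n + 1)) :
    fderiv ℝ (fun X => bump c R X ^ 2) X (unitVec j) = -4 * bump c R X * (X j - c j) := by
  rw [(hasFDerivAt_bump_sq c R X).fderiv]
  simp [unitVec, EuclideanSpace.inner_single_right]

end Divergence

/-! ### From cutoff identities to the divergence theorem on half-balls and half-spheres. -/

section RadialIdentity

lemma hasDerivAt_integral_pow_mul {k : ℝ → ℝ} (hk : ContinuousOn k (Ioi 0))
    (hint : ∀ R, IntegrableOn k (Ioo 0 R)) (j : ℕ) {R : ℝ} (hR : 0 < R) :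
    HasDerivAt (fun R => ∫ r in (0 : ℝ)..R, r ^ j * k r) (R ^ j * k R) R := by
  have hc : ContinuousOn (fun r => r ^ j * k r) (Ioi 0) := by fun_prop
  refine intervalIntegral.integral_hasDerivAt_right ?_
    (hc.stronglyMeasurableAtFilter isOpen_Ioi R hR) (hc.continuousAt (Ioi_mem_nhds hR))
  have h1 : IntervalIntegrable k volume 0 R := by
    rw [intervalIntegrable_iff_integrableOn_Ioo_of_le hR.le]; exact hint R
  exact h1.continuousOn_mul (by fun_prop)

/-- If all the moments `∫ (R² - r²)² k` and `4 ∫ (R² - r²) e` agree, then `R ∫ k = e`. -/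
lemma mul_integral_eq_of_moments {k e : ℝ → ℝ} (hk : ContinuousOn k (Ioi 0))
    (hkint : ∀ R, IntegrableOn k (Ioo 0 R)) (he : ContinuousOn e (Ioi 0))
    (heint : ∀ R, IntegrableOn e (Ioo 0 R))
    (h : ∀ R, 0 < R → ∫ r in (0 : ℝ)..R, ((R ^ 2 - r ^ 2) ^ 2 * k r - 4 * (R ^ 2 - r ^ 2) * e r) = 0)
    {R : ℝ} (hR : 0 < R) : R * ∫ r in (0 : ℝ)..R, k r = e R := by
  let I : (ℝ → ℝ) → ℕ → ℝ → ℝ := fun f j R => ∫ r in (0 : ℝ)..R, r ^ j * f r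
  have hint : ∀ f : ℝ → ℝ, (∀ R, IntegrableOn f (Ioo 0 R)) → ∀ (j : ℕ) (R : ℝ), 0 < R →
      IntervalIntegrable (fun r => r ^ j * f r) volume 0 R := by
    intro f hf j R hR
    have h1 : IntervalIntegrable f volume 0 R := by
      rw [intervalIntegrable_iff_integrableOn_Ioo_of_le hR.le]; exact hf R
    exact h1.continuousOn_mul (by fun_prop)
  have dk : ∀ (j : ℕ) (R : ℝ), 0 < R → HasDerivAt (I k j) (R ^ j * k R) R :=
    fun j R hR => hasDerivAt_integral_pow_mul hk hkint j hR
  have de : ∀ (j : ℕ) (R : ℝ), 0 < R → HasDerivAt (I e j) (R ^ j * e R) R :=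
    fun j R hR => hasDerivAt_integral_pow_mul he heint j hR
  -- Expanding in powers of R leaves integrals whose integrands no longer contain R, so each can be
  -- differentiated by the fundamental theorem of calculus.
  have h0 : ∀ R, 0 < R →
      R ^ 4 * I k 0 R - 2 * R ^ 2 * I k 2 R + I k 4 R - 4 * R ^ 2 * I e 0 R + 4 * I e 2 R = 0 := by
    intro R hR
    rw [← h R hR]
    simp only [I]
    simp only [← intervalIntegral.integral_const_mul]
    rw [← intervalIntegral.integral_sub, ← intervalIntegral.integral_add,
      ← intervalIntegral.integral_sub, ← intervalIntegral.integral_add]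
    · congr 1; ext r; ring
    · exact (((((hint k hkint 0 R hR).const_mul _).sub ((hint k hkint 2 R hR).const_mul _)).add
        (hint k hkint 4 R hR)).sub ((hint e heint 0 R hR).const_mul _))
    · exact (hint e heint 2 R hR).const_mul _
    · exact ((((hint k hkint 0 R hR).const_mul _).sub ((hint k hkint 2 R hR).const_mul _)).add
        (hint k hkint 4 R hR))
    · exact (hint e heint 0 R hR).const_mul _
    · exact (((hint k hkint 0 R hR).const_mul _).sub ((hint k hkint 2 R hR).const_mul _))
    · exact hint k hkint 4 R hR
    · exact (hint k hkint 0 R hR).const_mul _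
    · exact (hint k hkint 2 R hR).const_mul _
  have hzero : ∀ (f : ℝ → ℝ) (f' R : ℝ), 0 < R → (∀ R, 0 < R → f R = 0) → HasDerivAt f f' R →
      f' = 0 := by
    intro f f' R hR hf hd
    have : f =ᶠ[𝓝 R] fun _ => 0 := by
      filter_upwards [Ioi_mem_nhds hR] with t ht using hf t ht
    exact hd.unique ((hasDerivAt_const R (0 : ℝ)).congr_of_eventuallyEq this)
  -- One derivative in R. The endpoint contributions cancel because both weights vanish at r = R,
  -- and a common factor 4R is divided out.
  have h1 : ∀ R, 0 < R → R ^ 2 * I k 0 R - I k 2 R - 2 * I e 0 R = 0 := by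
    intro R hR
    have hd := (((((hasDerivAt_pow 4 R).mul (dk 0 R hR)).sub
      (((hasDerivAt_pow 2 R).const_mul 2).mul (dk 2 R hR))).add (dk 4 R hR)).sub
      (((hasDerivAt_pow 2 R).const_mul 4).mul (de 0 R hR))).add ((de 2 R hR).const_mul 4)
    have := hzero _ _ R hR (fun R hR => h0 R hR) hd
    have h4 : 4 * R * (R ^ 2 * I k 0 R - I k 2 R - 2 * I e 0 R) = 0 := by
      rw [← this]; norm_num; ring
    exact (mul_eq_zero.1 h4).resolve_left (by positivity)
  -- A second derivative. The endpoint terms in k cancel again, but the weight of e is now constant,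
  -- so its endpoint value remains.
  have hd := ((((hasDerivAt_pow 2 R).mul (dk 0 R hR)).sub (dk 2 R hR)).sub
    ((de 0 R hR).const_mul 2))
  have h2 := hzero _ _ R hR (fun R hR => h1 R hR) hd
  norm_num [I] at h2
  linarith

lemma ae_sphereWeight_norm (n : ℕ) (b : ℝ) : ∀ᵐ Z ∂(sphereWeight n b), ‖Z‖ = 1 := by
  refine (weighted_absolutelyContinuous b _).ae_le (ae_restrict_of_ae ?_)
  rw [unitSphereMeasure, sphere_measurableEmbedding.ae_map_iff]
  exact Eventually.of_forall fun ω => by simp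

/-- Since the measure lives on the unit sphere, |X - c| may be replaced by the radius r inside such
integrals. -/
lemma dilInt_sphereWeight_congr {n : ℕ} {b : ℝ} {c : Space n} (hc : yCoord c = 0) {r : ℝ}
    (hr : 0 < r) {q₁ q₂ : Space n → ℝ} (h : ∀ X ∈ halfSpace n, ‖X - c‖ = r → q₁ X = q₂ X) :
    dilInt (sphereWeight n b) c q₁ r = dilInt (sphereWeight n b) c q₂ r := by
  apply integral_congr_ae
  filter_upwards [ae_sphereWeight_norm n b, onUnitHalfBall_sphereWeight b] with Z h1 h2
  refine h _ ((add_smul_mem_halfSpace hc hr).2 h2.1) ?_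
  rw [add_sub_cancel_left, norm_smul, h1, mul_one, Real.norm_eq_abs, abs_of_pos hr]

lemma dilInt_const_mul {n : ℕ} (ν : Measure (Space n)) (c : Space n) (a : ℝ) (q : Space n → ℝ)
    (r : ℝ) : dilInt ν c (fun X => a * q X) r = a * dilInt ν c q r := integral_const_mul _ _

lemma Admissible.dilInt_add {n : ℕ} {ν : Measure (Space n)} [IsFiniteMeasure ν] {c : Space n}
    (hν : OnUnitHalfBall ν) (hc : yCoord c = 0) {r : ℝ} (hr : 0 < r) {q₁ q₂ : Space n → ℝ}
    (h₁ : Admissible q₁) (h₂ : Admissible q₂) :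
    dilInt ν c (fun X => q₁ X + q₂ X) r = dilInt ν c q₁ r + dilInt ν c q₂ r :=
  integral_add (h₁.integrable_dil hν hc hr) (h₂.integrable_dil hν hc hr)

lemma Admissible.dilInt_sub {n : ℕ} {ν : Measure (Space n)} [IsFiniteMeasure ν] {c : Space n}
    (hν : OnUnitHalfBall ν) (hc : yCoord c = 0) {r : ℝ} (hr : 0 < r) {q₁ q₂ : Space n → ℝ}
    (h₁ : Admissible q₁) (h₂ : Admissible q₂) :
    dilInt ν c (fun X => q₁ X - q₂ X) r = dilInt ν c q₁ r - dilInt ν c q₂ r :=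
  integral_sub (h₁.integrable_dil hν hc hr) (h₂.integrable_dil hν hc hr)

variable {n : ℕ} {b : ℝ} {x₀ : EuclideanSpace ℝ (Fin n)}

lemma continuous_sphere_integral {g : EuclideanSpace ℝ (Fin n) → ℝ} (hg : Continuous g)
    (x₀ : EuclideanSpace ℝ (Fin n)) :
    Continuous fun r : ℝ => ∫ ω : Metric.sphere (0 : EuclideanSpace ℝ (Fin n)) 1,
      g (x₀ + r • (ω : EuclideanSpace ℝ (Fin n)))
        ∂(volume : Measure (EuclideanSpace ℝ (Fin n))).toSphere := by
  simp_rw [← setIntegral_univ (μ := (volume : Measure (EuclideanSpace ℝ (Fin n))).toSphere)]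
  refine continuous_parametric_integral_of_continuous ?_ isCompact_univ
  fun_prop

lemma bdry_sub_bdry_norm (x x₀ : EuclideanSpace ℝ (Fin n)) : ‖bdry x - bdry x₀‖ = ‖x - x₀‖ := by
  have h : bdry x - bdry x₀ = liftPt (x - x₀) 0 := by
    ext j
    refine Fin.lastCases ?_ (fun i => ?_) j
    · simp [← liftPt_zero]
    · simp [← liftPt_zero]
  have h2 := norm_sq_liftPt (x - x₀) 0
  rw [h]
  rw [← abs_of_nonneg (norm_nonneg (liftPt (x - x₀) 0)), ← abs_of_nonneg (norm_nonneg (x - x₀)),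
    ← sq_eq_sq_iff_abs_eq_abs]
  simpa using h2

/-- The divergence theorem is applied to ψ²F with ψ = (R²-|X-c|²)₊. The gradient of ψ² is -4ψ(X-c),
so F enters only through its divergence and its radial component. Since ψ depends on |X-c| alone,
polar coordinates reduce everything to integrals in r. -/
lemma moment_identity (hb : -1 < b) (hn : 0 < n)
    {F : Fin (n + 1) → Space n → ℝ} {d e : Space n → ℝ} {g : EuclideanSpace ℝ (Fin n) → ℝ}
    (hF : ∀ j, ∀ X ∈ halfSpace n, DifferentiableAt ℝ (F j) X)
    (hd : Admissible d) (he : Admissible e)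
    (hdiv : ∀ X ∈ halfSpace n, divergence F X = yCoord X ^ b * d X)
    (hrad : ∀ X ∈ halfSpace n, ∑ j, F j X * (X j - bdry x₀ j) = yCoord X ^ b * e X)
    (hbd : LocBdd (F (Fin.last n))) (hg : Continuous g)
    (hlim : ∀ x, Tendsto (fun t => F (Fin.last n) (liftPt x t)) (𝓝[>] 0) (𝓝 (g x)))
    {R : ℝ} (hR : 0 < R) :
    ∫ r in (0 : ℝ)..R, ((R ^ 2 - r ^ 2) ^ 2 *
        (r ^ ((n : ℝ) + b) * dilInt (sphereWeight n b) (bdry x₀) d r +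
          r ^ (n - 1) * ∫ ω : Metric.sphere (0 : EuclideanSpace ℝ (Fin n)) 1,
            g (x₀ + r • (ω : EuclideanSpace ℝ (Fin n)))
              ∂(volume : Measure (EuclideanSpace ℝ (Fin n))).toSphere) -
        4 * (R ^ 2 - r ^ 2) *
          (r ^ ((n : ℝ) + b) * dilInt (sphereWeight n b) (bdry x₀) e r)) = 0 := by
  -- Polar coordinates on the flat boundary ℝⁿ need a nontrivial space; n > 0 also makes the
  -- exponent n - 1 a genuine difference.
  have : Nonempty (Fin n) := ⟨⟨0, hn⟩⟩
  have := isFiniteMeasure_sphereWeight (n := n) hb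
  set c : Space n := bdry x₀ with hc_def
  have hc : yCoord c = 0 := yCoord_bdry x₀
  let ψ : Space n → ℝ := bump c R
  have hψ : Admissible ψ := admissible_of_continuous (continuous_bump c R)
  let K : Fin (n + 1) → Space n → ℝ := fun j X => ψ X ^ 2 * F j X
  let q : Space n → ℝ := fun X => ψ X * ψ X * d X - 4 * (ψ X * e X)
  have hq : Admissible q := ((hψ.mul hψ).mul hd).sub ((hψ.mul he).const_mul 4)
  have hdivK : ∀ X ∈ halfSpace n, divergence K X = yCoord X ^ b * q X := by
    intro X hX
    have h1 : ∀ j, fderiv ℝ (K j) X (unitVec j) =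
        ψ X ^ 2 * fderiv ℝ (F j) X (unitVec j) - 4 * ψ X * (F j X * (X j - c j)) := by
      intro j
      have h2 := (hasFDerivAt_bump_sq c R X).differentiableAt.hasFDerivAt.mul (hF j X hX).hasFDerivAt
      have h3 : fderiv ℝ (K j) X = _ := h2.fderiv
      rw [h3]
      simp only [add_apply, smul_apply, smul_eq_mul,
        fderiv_bump_sq_unitVec]
      simp only [ψ]
      ring
    rw [divergence, Finset.sum_congr rfl fun j _ => h1 j, Finset.sum_sub_distrib,
      ← Finset.mul_sum, ← Finset.mul_sum, hrad X hX]
    have h4 := hdiv X hX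
    rw [divergence] at h4
    rw [h4]
    simp only [q]
    ring
  have hzero : ∀ j X, R + ‖c‖ ≤ ‖X‖ → K j X = 0 := by
    intro j X hX
    have h1 : R ≤ ‖X - c‖ := by
      have := norm_add_le (X - c) c
      rw [sub_add_cancel] at this
      linarith
    have h2 : ψ X = 0 := bump_eq_zero hR h1
    simp [K, h2]
  have hmΩ := (isOpen_halfSpace (n := n)).measurableSet
  have hqout : ∀ X, X ∉ Metric.ball c R → q X = 0 := by
    intro X hX
    have h2 : ψ X = 0 := bump_eq_zero hR (by simpa [dist_eq_norm] using hX)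
    simp [q, h2]
  have hint : IntegrableOn (divergence K) (halfSpace n) := by
    have h1 : IntegrableOn (fun X => yCoord X ^ b * q X) (halfSpace n) := by
      have h2 := hq.integrableOn_ball hb c R
      rw [← integrable_indicator_iff (hmΩ.inter measurableSet_ball)] at h2
      refine h2.integrableOn.congr_fun (fun X hX => ?_) hmΩ
      by_cases hXR : X ∈ Metric.ball c R
      · exact indicator_of_mem (s := halfSpace n ∩ Metric.ball c R) ⟨hX, hXR⟩ _
      · rw [indicator_of_notMem (s := halfSpace n ∩ Metric.ball c R) (fun h => hXR h.2)]
        simp [hqout X hXR]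
    exact h1.congr_fun (fun X hX => (hdivK X hX).symm) hmΩ
  -- The local bound becomes global because the cut-off field vanishes outside a ball; the maximum
  -- with 0 covers that region.
  obtain ⟨M, hM⟩ := ((hψ.bdd.mul hψ.bdd).mul hbd) (R + ‖c‖)
  have hKbd : ∀ X ∈ halfSpace n, |K (Fin.last n) X| ≤ max M 0 := by
    intro X hX
    rcases le_total (R + ‖c‖) ‖X‖ with h | h
    · rw [hzero _ _ h, abs_zero]; exact le_max_right _ _
    · refine le_trans ?_ ((hM X hX h).trans (le_max_left _ _))
      simp only [K]; rw [sq]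
  have hk : ∀ x, Tendsto (fun t => K (Fin.last n) (liftPt x t)) (𝓝[>] 0)
      (𝓝 (ψ (bdry x) ^ 2 * g x)) := by
    intro x
    refine Tendsto.mul ?_ (hlim x)
    have h1 : Continuous fun t : ℝ => ψ (liftPt x t) ^ 2 := by
      have h2 : Continuous fun t : ℝ => liftPt x t :=
        continuous_liftPt.comp (by fun_prop : Continuous fun t : ℝ => (x, t))
      exact ((continuous_bump c R).comp h2).pow 2
    exact (h1.tendsto 0).mono_left nhdsWithin_le_nhds
  have hKd : ∀ j, ∀ X ∈ halfSpace n, DifferentiableAt ℝ (K j) X := fun j X hX =>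
    (hasFDerivAt_bump_sq c R X).differentiableAt.mul (hF j X hX)
  have key := integral_divergence_halfSpace hKd hzero hint hKbd hk
  have hleft : ∫ X in halfSpace n, divergence K X =
      ∫ r in (0 : ℝ)..R, ((R ^ 2 - r ^ 2) ^ 2 *
        (r ^ ((n : ℝ) + b) * dilInt (sphereWeight n b) c d r) - 4 * (R ^ 2 - r ^ 2) *
          (r ^ ((n : ℝ) + b) * dilInt (sphereWeight n b) c e r)) := by
    rw [setIntegral_congr_fun hmΩ hdivK]
    have h1 : ∫ X in halfSpace n, yCoord X ^ b * q X =
        ∫ X in halfSpace n ∩ Metric.ball c R, yCoord X ^ b * q X := by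
      refine setIntegral_eq_of_subset_of_forall_sdiff_eq_zero hmΩ inter_subset_left fun X hX => ?_
      rw [hqout X fun h => hX.2 ⟨hX.1, h⟩, mul_zero]
    rw [h1, hq.setIntegral_ball_eq hb hc hR]
    refine intervalIntegral.integral_congr_ae (Eventually.of_forall fun r hr => ?_)
    rw [uIoc_of_le hR.le] at hr
    have h2 : dilInt (sphereWeight n b) c q r = (R ^ 2 - r ^ 2) ^ 2 * dilInt (sphereWeight n b) c d r
        - 4 * (R ^ 2 - r ^ 2) * dilInt (sphereWeight n b) c e r := by
      rw [← dilInt_const_mul, ← dilInt_const_mul, ← Admissible.dilInt_sub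
        (onUnitHalfBall_sphereWeight b) hc hr.1 (hd.const_mul _) (he.const_mul _)]
      refine dilInt_sphereWeight_congr hc hr.1 fun X _ hX => ?_
      have h3 : ψ X = R ^ 2 - r ^ 2 := by
        simp only [ψ, bump, hX]
        exact max_eq_left (by nlinarith [hr.1, hr.2])
      simp only [q, h3]
      ring
    rw [h2]; ring
  have hcont : Continuous fun x => ψ (bdry x) ^ 2 * g x :=
    (((continuous_bump c R).comp continuous_bdry).pow 2).mul hg
  have hright : ∫ x, ψ (bdry x) ^ 2 * g x = ∫ r in (0 : ℝ)..R, (R ^ 2 - r ^ 2) ^ 2 *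
      (r ^ (n - 1) * ∫ ω : Metric.sphere (0 : EuclideanSpace ℝ (Fin n)) 1,
            g (x₀ + r • (ω : EuclideanSpace ℝ (Fin n)))
              ∂(volume : Measure (EuclideanSpace ℝ (Fin n))).toSphere) := by
    have h1 : ∫ x, ψ (bdry x) ^ 2 * g x =
        ∫ x in Metric.ball x₀ R, ψ (bdry x) ^ 2 * g x := by
      symm
      refine setIntegral_eq_integral_of_forall_compl_eq_zero fun x hx => ?_
      have h2 : ψ (bdry x) = 0 := bump_eq_zero hR (by
        rw [hc_def, bdry_sub_bdry_norm]; simpa [dist_eq_norm] using hx)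
      simp [h2]
    have h2 : IntegrableOn (fun x => ψ (bdry x) ^ 2 * g x) (Metric.ball x₀ R) :=
      (hcont.continuousOn.integrableOn_compact (isCompact_closedBall x₀ R)).mono_set
        Metric.ball_subset_closedBall
    rw [h1, setIntegral_ball_eq_polar volume hR h2]
    refine intervalIntegral.integral_congr_ae (Eventually.of_forall fun r hr => ?_)
    rw [uIoc_of_le hR.le] at hr
    have h3 : ∀ ω : Metric.sphere (0 : EuclideanSpace ℝ (Fin n)) 1,
        ψ (bdry (x₀ + r • (ω : EuclideanSpace ℝ (Fin n)))) = R ^ 2 - r ^ 2 := by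
      intro ω
      have h4 : ‖(ω : EuclideanSpace ℝ (Fin n))‖ = 1 := by simp
      simp only [ψ, bump]
      rw [hc_def, bdry_sub_bdry_norm, add_sub_cancel_left, norm_smul, h4, mul_one,
        Real.norm_eq_abs, sq_abs]
      exact max_eq_left (by nlinarith [hr.1, hr.2])
    simp only [h3, integral_const_mul, finrank_euclideanSpace_fin]
    ring
  rw [hleft, hright] at key
  have hd1 := hd.integrableOn_polar hb hc R
  have he1 := he.integrableOn_polar hb hc R
  have hg1 : IntervalIntegrable (fun r => r ^ (n - 1) *
      ∫ ω : Metric.sphere (0 : EuclideanSpace ℝ (Fin n)) 1,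
            g (x₀ + r • (ω : EuclideanSpace ℝ (Fin n)))
              ∂(volume : Measure (EuclideanSpace ℝ (Fin n))).toSphere) volume 0 R :=
    ((continuous_id.pow (n - 1)).mul (continuous_sphere_integral hg x₀)).intervalIntegrable _ _
  rw [← intervalIntegrable_iff_integrableOn_Ioo_of_le hR.le] at hd1 he1
  have hd2 := hd1.continuousOn_mul (g := fun r => (R ^ 2 - r ^ 2) ^ 2) (by fun_prop)
  have he2 := he1.continuousOn_mul (g := fun r => 4 * (R ^ 2 - r ^ 2)) (by fun_prop)
  have hg2 := hg1.continuousOn_mul (g := fun r => (R ^ 2 - r ^ 2) ^ 2) (by fun_prop)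
  rw [eq_neg_iff_add_eq_zero, ← intervalIntegral.integral_add (hd2.sub he2) hg2] at key
  rw [← key]
  congr 1
  ext r
  ring

/-- The divergence theorem on a half-ball, for a field `F` with `div F = y^b d` and
`F · (X - c) = y^b e`. -/
theorem half_ball_divergence (hb : -1 < b) (hn : 0 < n)
    {F : Fin (n + 1) → Space n → ℝ} {d e : Space n → ℝ} {g : EuclideanSpace ℝ (Fin n) → ℝ}
    (hF : ∀ j, ∀ X ∈ halfSpace n, DifferentiableAt ℝ (F j) X)
    (hd : Admissible d) (he : Admissible e)
    (hdiv : ∀ X ∈ halfSpace n, divergence F X = yCoord X ^ b * d X)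
    (hrad : ∀ X ∈ halfSpace n, ∑ j, F j X * (X j - bdry x₀ j) = yCoord X ^ b * e X)
    (hbd : LocBdd (F (Fin.last n))) (hg : Continuous g)
    (hlim : ∀ x, Tendsto (fun t => F (Fin.last n) (liftPt x t)) (𝓝[>] 0) (𝓝 (g x)))
    {R : ℝ} (hR : 0 < R) :
    R * ((∫ X in halfSpace n ∩ Metric.ball (bdry x₀) R, yCoord X ^ b * d X) +
        ∫ x in Metric.ball x₀ R, g x) =
      R ^ ((n : ℝ) + b) * dilInt (sphereWeight n b) (bdry x₀) e R := by
  have : Nonempty (Fin n) := ⟨⟨0, hn⟩⟩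
  have := isFiniteMeasure_sphereWeight (n := n) hb
  have hc : yCoord (bdry x₀) = 0 := yCoord_bdry x₀
  have hg1 : Continuous fun r : ℝ => r ^ (n - 1) *
      ∫ ω : Metric.sphere (0 : EuclideanSpace ℝ (Fin n)) 1,
            g (x₀ + r • (ω : EuclideanSpace ℝ (Fin n)))
              ∂(volume : Measure (EuclideanSpace ℝ (Fin n))).toSphere :=
    (continuous_id.pow (n - 1)).mul (continuous_sphere_integral hg x₀)
  have hgint : ∀ R : ℝ, IntegrableOn (fun r : ℝ => r ^ (n - 1) *
      ∫ ω : Metric.sphere (0 : EuclideanSpace ℝ (Fin n)) 1,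
            g (x₀ + r • (ω : EuclideanSpace ℝ (Fin n)))
              ∂(volume : Measure (EuclideanSpace ℝ (Fin n))).toSphere) (Ioo 0 R) := fun R =>
    (hg1.continuousOn.integrableOn_compact (isCompact_Icc (a := 0) (b := R))).mono_set
      Ioo_subset_Icc_self
  have hcont : ∀ q : Space n → ℝ, Admissible q → ContinuousOn
      (fun r => r ^ ((n : ℝ) + b) * dilInt (sphereWeight n b) (bdry x₀) q r) (Ioi 0) := by
    intro q hq r hr
    have h1 : ContinuousAt (fun r : ℝ => r ^ ((n : ℝ) + b)) r :=
      Real.continuousAt_rpow_const _ _ (Or.inl (ne_of_gt hr))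
    exact (h1.mul (hq.continuousAt_dilInt (onUnitHalfBall_sphereWeight b) hc hr)).continuousWithinAt
  have hgball : IntegrableOn g (Metric.ball x₀ R) :=
    (hg.continuousOn.integrableOn_compact (isCompact_closedBall x₀ R)).mono_set
      Metric.ball_subset_closedBall
  -- The cutoff identity is available for every radius, so its second derivative in the radius gives
  -- the sharp half-ball balance.
  have key := mul_integral_eq_of_moments ((hcont d hd).add hg1.continuousOn)
    (fun R => (hd.integrableOn_polar hb hc R).add (hgint R)) (hcont e he)
    (fun R => he.integrableOn_polar hb hc R)
    (fun R hR => moment_identity hb hn hF hd he hdiv hrad hbd hg hlim hR) hR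
  rw [← key, hd.setIntegral_ball_eq hb hc hR, setIntegral_ball_eq_polar volume hR hgball,
    finrank_euclideanSpace_fin]
  congr 1
  symm
  refine intervalIntegral.integral_add ?_ (hg1.intervalIntegrable _ _)
  rw [intervalIntegrable_iff_integrableOn_Ioo_of_le hR.le]
  exact hd.integrableOn_polar hb hc R

/-- The divergence theorem on the half-sphere, for a field tangent to the spheres. -/
theorem half_sphere_divergence (hb : -1 < b) (hn : 0 < n)
    {F : Fin (n + 1) → Space n → ℝ} {d : Space n → ℝ}
    (hF : ∀ j, ∀ X ∈ halfSpace n, DifferentiableAt ℝ (F j) X)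
    (hd : Admissible d)
    (hdiv : ∀ X ∈ halfSpace n, divergence F X = yCoord X ^ b * d X)
    (hrad : ∀ X ∈ halfSpace n, ∑ j, F j X * (X j - bdry x₀ j) = 0)
    (hbd : LocBdd (F (Fin.last n)))
    (hlim : ∀ x, Tendsto (fun t => F (Fin.last n) (liftPt x t)) (𝓝[>] 0) (𝓝 0))
    {R : ℝ} (hR : 0 < R) :
    dilInt (sphereWeight n b) (bdry x₀) d R = 0 := by
  have := isFiniteMeasure_sphereWeight (n := n) hb
  have hc : yCoord (bdry x₀) = 0 := yCoord_bdry x₀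
  let k : ℝ → ℝ := fun r => r ^ ((n : ℝ) + b) * dilInt (sphereWeight n b) (bdry x₀) d r
  have hk : ContinuousOn k (Ioi 0) := by
    intro r hr
    have h1 : ContinuousAt (fun r : ℝ => r ^ ((n : ℝ) + b)) r :=
      Real.continuousAt_rpow_const _ _ (Or.inl (ne_of_gt hr))
    exact (h1.mul (hd.continuousAt_dilInt (onUnitHalfBall_sphereWeight b) hc hr)).continuousWithinAt
  -- A tangential field has no flux through any half-sphere, so the integral of its divergence
  -- vanishes over every half-ball. Differentiating in the radius localises this to one half-sphere.
  have h0 : ∀ R, 0 < R → ∫ r in (0 : ℝ)..R, r ^ 0 * k r = 0 := by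
    intro R hR
    have h1 := half_ball_divergence (x₀ := x₀) hb hn hF hd (admissible_const 0) hdiv
      (fun X hX => by rw [hrad X hX, mul_zero]) hbd continuous_const hlim hR
    rw [hd.setIntegral_ball_eq hb hc hR] at h1
    simp only [dilInt, integral_zero, add_zero, mul_zero, mul_eq_zero, hR.ne', false_or] at h1
    simpa [k, dilInt] using h1
  have hder := hasDerivAt_integral_pow_mul hk (fun R => hd.integrableOn_polar hb hc R) 0 hR
  have h1 : (fun R => ∫ r in (0 : ℝ)..R, r ^ 0 * k r) =ᶠ[𝓝 R] fun _ => 0 := by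
    filter_upwards [Ioi_mem_nhds hR] with t ht using h0 t ht
  have h2 := hder.unique ((hasDerivAt_const R (0 : ℝ)).congr_of_eventuallyEq h1)
  rw [pow_zero, one_mul] at h2
  exact (mul_eq_zero.1 h2).resolve_left (Real.rpow_pos_of_pos hR _).ne'

end RadialIdentity

/-! ### Partial derivatives, dilations and the weighted Laplacian in the open half-space. -/

section Calculus

variable {n : ℕ} {b : ℝ} {c : Space n} {f g : Space n → ℝ} {X : Space n}

lemma pderiv_eq_fderiv (h : DifferentiableAt ℝ f X) (j : Fin (n + 1)) :
    pderiv j f X = fderiv ℝ f X (unitVec j) := h.lineDeriv_eq_fderiv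

lemma pderiv_congr (h : ∀ X ∈ halfSpace n, f X = g X) (j : Fin (n + 1)) :
    ∀ X ∈ halfSpace n, pderiv j f X = pderiv j g X := fun _ hX =>
  Filter.EventuallyEq.lineDeriv_eq (eventually_of_mem (isOpen_halfSpace.mem_nhds hX) h)

lemma dil_congr (h : ∀ X ∈ halfSpace n, f X = g X) :
    ∀ X ∈ halfSpace n, Dil c f X = Dil c g X := fun X hX => by
  rw [Dil, Dil, Filter.EventuallyEq.fderiv_eq
    (eventually_of_mem (isOpen_halfSpace.mem_nhds hX) h)]

lemma differentiableAt_of_contDiffOn {k : WithTop ℕ∞} (hf : ContDiffOn ℝ k f (halfSpace n))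
    (hk : k ≠ 0) (hX : X ∈ halfSpace n) : DifferentiableAt ℝ f X :=
  (hf.contDiffAt (isOpen_halfSpace.mem_nhds hX)).differentiableAt hk

lemma contDiffOn_pderiv {k m : WithTop ℕ∞} (hf : ContDiffOn ℝ k f (halfSpace n)) (hm : m + 1 ≤ k)
    (j : Fin (n + 1)) : ContDiffOn ℝ m (pderiv j f) (halfSpace n) := by
  have h1 := (hf.fderiv_of_isOpen isOpen_halfSpace hm).clm_apply
    (contDiffOn_const (c := (unitVec j : Space n)))
  have hk : k ≠ 0 := by
    rintro rfl
    have : (1 : WithTop ℕ∞) ≤ 0 := le_trans le_add_self hm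
    exact absurd this (by decide)
  exact h1.congr fun X hX => pderiv_eq_fderiv (differentiableAt_of_contDiffOn hf hk hX) j

lemma contDiffOn_dil {k m : WithTop ℕ∞} (hf : ContDiffOn ℝ k f (halfSpace n)) (hm : m + 1 ≤ k) :
    ContDiffOn ℝ m (Dil c f) (halfSpace n) :=
  (hf.fderiv_of_isOpen isOpen_halfSpace hm).clm_apply (by fun_prop)

lemma dil_eq_sum (h : DifferentiableAt ℝ f X) :
    Dil c f X = ∑ j, (X j - c j) * pderiv j f X := by
  have h1 : X - c = ∑ j, (X j - c j) • (unitVec j : Space n) := by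
    ext i
    simp [unitVec, Finset.sum_apply, Pi.single_apply]
  rw [Dil]
  conv_lhs => rw [h1]
  rw [map_sum]
  exact Finset.sum_congr rfl fun j _ => by rw [map_smul, smul_eq_mul, pderiv_eq_fderiv h]

lemma pderiv_add (hf : DifferentiableAt ℝ f X) (hg : DifferentiableAt ℝ g X) (j : Fin (n + 1)) :
    pderiv j (fun X => f X + g X) X = pderiv j f X + pderiv j g X := by
  rw [pderiv_eq_fderiv (hf.fun_add hg), pderiv_eq_fderiv hf, pderiv_eq_fderiv hg, fderiv_fun_add hf hg]
  rfl

lemma pderiv_sub (hf : DifferentiableAt ℝ f X) (hg : DifferentiableAt ℝ g X) (j : Fin (n + 1)) :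
    pderiv j (fun X => f X - g X) X = pderiv j f X - pderiv j g X := by
  rw [pderiv_eq_fderiv (hf.fun_sub hg), pderiv_eq_fderiv hf, pderiv_eq_fderiv hg, fderiv_fun_sub hf hg]
  rfl

lemma pderiv_mul (hf : DifferentiableAt ℝ f X) (hg : DifferentiableAt ℝ g X) (j : Fin (n + 1)) :
    pderiv j (fun X => f X * g X) X = f X * pderiv j g X + pderiv j f X * g X := by
  rw [pderiv_eq_fderiv (hf.fun_mul hg), pderiv_eq_fderiv hf, pderiv_eq_fderiv hg, fderiv_fun_mul hf hg]
  simp [mul_comm]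

lemma pderiv_const_mul (hf : DifferentiableAt ℝ f X) (a : ℝ) (j : Fin (n + 1)) :
    pderiv j (fun X => a * f X) X = a * pderiv j f X := by
  rw [pderiv_eq_fderiv (hf.const_mul a), pderiv_eq_fderiv hf, fderiv_const_mul hf]
  rfl

lemma pderiv_sum {ι : Type*} (s : Finset ι) {f : ι → Space n → ℝ}
    (hf : ∀ i ∈ s, DifferentiableAt ℝ (f i) X) (j : Fin (n + 1)) :
    pderiv j (fun X => ∑ i ∈ s, f i X) X = ∑ i ∈ s, pderiv j (f i) X := by
  rw [pderiv_eq_fderiv (DifferentiableAt.fun_sum hf), fderiv_fun_sum hf]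
  simp only [sum_apply]
  exact Finset.sum_congr rfl fun i hi => (pderiv_eq_fderiv (hf i hi) j).symm

lemma dil_add (hf : DifferentiableAt ℝ f X) (hg : DifferentiableAt ℝ g X) :
    Dil c (fun X => f X + g X) X = Dil c f X + Dil c g X := by
  rw [Dil, fderiv_fun_add hf hg]; rfl

lemma dil_sub (hf : DifferentiableAt ℝ f X) (hg : DifferentiableAt ℝ g X) :
    Dil c (fun X => f X - g X) X = Dil c f X - Dil c g X := by
  rw [Dil, fderiv_fun_sub hf hg]; rfl

lemma dil_mul (hf : DifferentiableAt ℝ f X) (hg : DifferentiableAt ℝ g X) :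
    Dil c (fun X => f X * g X) X = f X * Dil c g X + Dil c f X * g X := by
  rw [Dil, fderiv_fun_mul hf hg]
  simp [Dil, mul_comm]

lemma dil_const_mul (hf : DifferentiableAt ℝ f X) (a : ℝ) :
    Dil c (fun X => a * f X) X = a * Dil c f X := by
  rw [Dil, fderiv_const_mul hf]; rfl

lemma dil_sum {ι : Type*} (s : Finset ι) {f : ι → Space n → ℝ}
    (hf : ∀ i ∈ s, DifferentiableAt ℝ (f i) X) :
    Dil c (fun X => ∑ i ∈ s, f i X) X = ∑ i ∈ s, Dil c (f i) X := by
  rw [Dil, fderiv_fun_sum hf, sum_apply]; rfl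

lemma differentiableAt_coord (j : Fin (n + 1)) (X : Space n) :
    DifferentiableAt ℝ (fun X : Space n => X j) X := by fun_prop

lemma pderiv_coord_sub (i j : Fin (n + 1)) (X : Space n) :
    pderiv i (fun X : Space n => X j - c j) X = if i = j then 1 else 0 := by
  rw [pderiv_eq_fderiv (by fun_prop), fderiv_sub_const]
  have h : HasFDerivAt (fun X : Space n => X j)
      (EuclideanSpace.proj j : Space n →L[ℝ] ℝ) X :=
    (EuclideanSpace.proj j : Space n →L[ℝ] ℝ).hasFDerivAt
  rw [h.fderiv]
  simp [unitVec, eq_comm]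

lemma pderiv_comm (hf : ContDiffOn ℝ 2 f (halfSpace n)) (hX : X ∈ halfSpace n)
    (i j : Fin (n + 1)) : pderiv i (pderiv j f) X = pderiv j (pderiv i f) X := by
  have hmem := isOpen_halfSpace.mem_nhds hX
  have h2 : ∀ j : Fin (n + 1), ∀ X ∈ halfSpace n, pderiv j f X = fderiv ℝ f X (unitVec j) :=
    fun j X hX => pderiv_eq_fderiv (differentiableAt_of_contDiffOn hf (by norm_num) hX) j
  have hd : DifferentiableAt ℝ (fderiv ℝ f) X :=
    ((hf.fderiv_of_isOpen isOpen_halfSpace (m := 1) (by norm_num)).contDiffAt hmem).differentiableAt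
      (by norm_num)
  have h3 : ∀ i j : Fin (n + 1), pderiv i (pderiv j f) X =
      fderiv ℝ (fderiv ℝ f) X (unitVec i) (unitVec j) := by
    intro i j
    rw [pderiv_congr (h2 j) i X hX, pderiv_eq_fderiv (hd.clm_apply (differentiableAt_const _)),
      fderiv_clm_apply hd (differentiableAt_const _)]
    simp
  rw [h3, h3]
  exact ((hf.contDiffAt hmem).isSymmSndFDerivAt (by simp)).eq _ _

/-- The commutator of ∂_j with D is ∂_j: one copy comes from differentiating the coefficient X_j -
c_j, the rest from symmetry of second derivatives. -/
lemma pderiv_dil (hf : ContDiffOn ℝ 2 f (halfSpace n)) (hX : X ∈ halfSpace n)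
    (j : Fin (n + 1)) : pderiv j (Dil c f) X = Dil c (pderiv j f) X + pderiv j f X := by
  have h1 : ∀ X ∈ halfSpace n, Dil c f X = ∑ k, (X k - c k) * pderiv k f X := fun X hX =>
    dil_eq_sum (differentiableAt_of_contDiffOn hf (by norm_num) hX)
  have hd : ∀ k, DifferentiableAt ℝ (pderiv k f) X := fun k =>
    differentiableAt_of_contDiffOn (contDiffOn_pderiv hf (m := 1) (by norm_num) k) (by norm_num) hX
  rw [pderiv_congr h1 j X hX, pderiv_sum _ fun k _ => by
    exact ((differentiableAt_coord k X).sub_const _).mul (hd k), dil_eq_sum (hd j)]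
  have h2 : ∀ k, pderiv j (fun X : Space n => (X k - c k) * pderiv k f X) X =
      (X k - c k) * pderiv k (pderiv j f) X + if j = k then pderiv k f X else 0 := by
    intro k
    rw [pderiv_mul ((differentiableAt_coord k X).sub_const _) (hd k), pderiv_coord_sub,
      pderiv_comm hf hX]
    split_ifs <;> simp
  rw [Finset.sum_congr rfl fun k _ => h2 k, Finset.sum_add_distrib]
  simp

lemma yCoord_hasFDerivAt (X : Space n) :
    HasFDerivAt yCoord (EuclideanSpace.proj (Fin.last n) : Space n →L[ℝ] ℝ) X :=
  (EuclideanSpace.proj (Fin.last n) : Space n →L[ℝ] ℝ).hasFDerivAt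

lemma hasFDerivAt_weight (b : ℝ) (hX : X ∈ halfSpace n) :
    HasFDerivAt (fun X : Space n => yCoord X ^ b) ((b * yCoord X ^ (b - 1)) •
      (EuclideanSpace.proj (Fin.last n) : Space n →L[ℝ] ℝ)) X :=
  (yCoord_hasFDerivAt X).rpow_const (Or.inl (ne_of_gt hX))

lemma pderiv_weight (b : ℝ) (hX : X ∈ halfSpace n) (j : Fin (n + 1)) :
    pderiv j (fun X : Space n => yCoord X ^ b) X =
      if j = Fin.last n then b * yCoord X ^ (b - 1) else 0 := by
  rw [pderiv_eq_fderiv (hasFDerivAt_weight b hX).differentiableAt, (hasFDerivAt_weight b hX).fderiv]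
  simp [unitVec, eq_comm]

lemma weight_mul_weightedLaplacian (b : ℝ) (f : Space n → ℝ) (hX : X ∈ halfSpace n) :
    yCoord X ^ b * weightedLaplacian b f X =
      ∑ j, pderiv j (fun Z => yCoord Z ^ b * pderiv j f Z) X := by
  rw [weightedLaplacian, ← mul_assoc, ← Real.rpow_add hX, add_neg_cancel, Real.rpow_zero, one_mul]

/-- The nondivergence form Δf + (b/y)∂_y f suits commutators and isolates the only term singular at
the boundary. -/
lemma weightedLaplacian_eq (hf : ContDiffOn ℝ 2 f (halfSpace n)) (hX : X ∈ halfSpace n) :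
    weightedLaplacian b f X = (∑ j, pderiv j (pderiv j f) X) +
      b * (pderiv (Fin.last n) f X * yCoord X ^ (-1 : ℝ)) := by
  have hy : 0 < yCoord X := hX
  have hd : ∀ k, DifferentiableAt ℝ (pderiv k f) X := fun k =>
    differentiableAt_of_contDiffOn (contDiffOn_pderiv hf (m := 1) (by norm_num) k) (by norm_num) hX
  rw [weightedLaplacian]
  have h1 : ∀ j, pderiv j (fun Z => yCoord Z ^ b * pderiv j f Z) X =
      yCoord X ^ b * pderiv j (pderiv j f) X +
        if j = Fin.last n then b * yCoord X ^ (b - 1) * pderiv j f X else 0 := by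
    intro j
    rw [pderiv_mul (hasFDerivAt_weight b hX).differentiableAt (hd j), pderiv_weight b hX]
    split_ifs <;> simp
  rw [Finset.sum_congr rfl fun j _ => h1 j, Finset.sum_add_distrib, ← Finset.mul_sum]
  simp only [Finset.sum_ite_eq', Finset.mem_univ, if_true]
  rw [mul_add, ← mul_assoc, ← Real.rpow_add hy, neg_add_cancel, Real.rpow_zero, one_mul]
  congr 1
  have : yCoord X ^ (-b) * yCoord X ^ (b - 1) = yCoord X ^ (-1 : ℝ) := by
    rw [← Real.rpow_add hy]; congr 1; ring
  rw [← this]; ring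

lemma contDiffOn_weight (b : ℝ) (k : WithTop ℕ∞) :
    ContDiffOn ℝ k (fun X : Space n => yCoord X ^ b) (halfSpace n) := by
  have h : ContDiff ℝ k (yCoord : Space n → ℝ) :=
    (EuclideanSpace.proj (𝕜 := ℝ) (Fin.last n)).contDiff
  exact h.contDiffOn.rpow_const_of_ne fun X hX => ne_of_gt hX

lemma contDiffOn_weightedLaplacian {k m : WithTop ℕ∞} (hf : ContDiffOn ℝ k f (halfSpace n))
    (hm : m + 1 + 1 ≤ k) : ContDiffOn ℝ m (weightedLaplacian b f) (halfSpace n) := by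
  refine (contDiffOn_weight (-b) m).mul (ContDiffOn.sum fun j _ => ?_)
  refine contDiffOn_pderiv (k := m + 1) ?_ le_rfl j
  exact (contDiffOn_weight b _).mul (contDiffOn_pderiv hf hm j)

lemma dil_weight (hc : yCoord c = 0) (b : ℝ) (hX : X ∈ halfSpace n) :
    Dil c (fun X : Space n => yCoord X ^ b) X = b * yCoord X ^ b := by
  have hy : 0 < yCoord X := hX
  rw [Dil, (hasFDerivAt_weight b hX).fderiv]
  have h1 : (EuclideanSpace.proj (Fin.last n) : Space n →L[ℝ] ℝ) (X - c) = yCoord X := by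
    simp only [yCoord] at hc ⊢
    simp [hc]
  rw [smul_apply, h1, smul_eq_mul, mul_assoc, ← Real.rpow_add_one hy.ne']
  simp

/-- This expresses homogeneity of degree -2. It needs the centre on y = 0, since otherwise the
coefficient b/y is not homogeneous about c. -/
lemma weightedLaplacian_dil (hc : yCoord c = 0) (hf : ContDiffOn ℝ 3 f (halfSpace n))
    (hX : X ∈ halfSpace n) :
    weightedLaplacian b (Dil c f) X =
      Dil c (weightedLaplacian b f) X + 2 * weightedLaplacian b f X := by
  have hf2 : ContDiffOn ℝ 2 f (halfSpace n) := hf.of_le (by norm_num)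
  have hp2 : ∀ j, ContDiffOn ℝ 2 (pderiv j f) (halfSpace n) := fun j =>
    contDiffOn_pderiv hf (by norm_num) j
  have hD2 : ContDiffOn ℝ 2 (Dil c f) (halfSpace n) := contDiffOn_dil hf (by norm_num)
  have hd1 : ∀ j, DifferentiableAt ℝ (pderiv j f) X := fun j =>
    differentiableAt_of_contDiffOn (hp2 j) (by norm_num) hX
  have hd2 : ∀ i j, DifferentiableAt ℝ (pderiv i (pderiv j f)) X := fun i j =>
    differentiableAt_of_contDiffOn (contDiffOn_pderiv (hp2 j) (m := 1) (by norm_num) i)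
      (by norm_num) hX
  have hdd : ∀ j, DifferentiableAt ℝ (Dil c (pderiv j f)) X := fun j =>
    differentiableAt_of_contDiffOn (contDiffOn_dil (hp2 j) (m := 1) (by norm_num)) (by norm_num) hX
  have hw := (hasFDerivAt_weight (-1 : ℝ) hX).differentiableAt
  have h1 : ∀ j, pderiv j (pderiv j (Dil c f)) X =
      Dil c (pderiv j (pderiv j f)) X + 2 * pderiv j (pderiv j f) X := by
    intro j
    rw [pderiv_congr (fun X hX => pderiv_dil hf2 hX j) j X hX, pderiv_add (hdd j) (hd1 j),
      pderiv_dil (hp2 j) hX]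
    ring
  rw [weightedLaplacian_eq hD2 hX, Finset.sum_congr rfl fun j _ => h1 j, pderiv_dil hf2 hX,
    dil_congr (fun X hX => weightedLaplacian_eq (b := b) hf2 hX) X hX, dil_add
      (DifferentiableAt.fun_sum fun j _ => hd2 j j) (((hd1 _).fun_mul hw).const_mul b),
    dil_sum _ fun j _ => hd2 j j, dil_const_mul ((hd1 _).fun_mul hw), dil_mul (hd1 _) hw,
    dil_weight hc _ hX, weightedLaplacian_eq hf2 hX, Finset.sum_add_distrib, ← Finset.mul_sum]
  ring

lemma weightedLaplacian_add (hf : ContDiffOn ℝ 2 f (halfSpace n))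
    (hg : ContDiffOn ℝ 2 g (halfSpace n)) (hX : X ∈ halfSpace n) :
    weightedLaplacian b (fun X => f X + g X) X =
      weightedLaplacian b f X + weightedLaplacian b g X := by
  have h1 : ∀ (f : Space n → ℝ), ContDiffOn ℝ 2 f (halfSpace n) → ∀ j, ∀ X ∈ halfSpace n,
      DifferentiableAt ℝ f X ∧ DifferentiableAt ℝ (pderiv j f) X := fun f hf j X hX =>
    ⟨differentiableAt_of_contDiffOn hf (by norm_num) hX,
      differentiableAt_of_contDiffOn (contDiffOn_pderiv hf (m := 1) (by norm_num) j)
        (by norm_num) hX⟩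
  have h2 : ∀ j, ∀ X ∈ halfSpace n, pderiv j (fun X => f X + g X) X = pderiv j f X + pderiv j g X :=
    fun j X hX => pderiv_add (h1 f hf j X hX).1 (h1 g hg j X hX).1 j
  rw [weightedLaplacian_eq (hf.add hg) hX, weightedLaplacian_eq hf hX, weightedLaplacian_eq hg hX,
    h2 _ X hX]
  have h3 : ∀ j, pderiv j (pderiv j (fun X => f X + g X)) X =
      pderiv j (pderiv j f) X + pderiv j (pderiv j g) X := fun j => by
    rw [pderiv_congr (h2 j) j X hX, pderiv_add (h1 f hf j X hX).2 (h1 g hg j X hX).2]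
  rw [Finset.sum_congr rfl fun j _ => h3 j, Finset.sum_add_distrib]
  ring

lemma weightedLaplacian_const_mul (hf : ContDiffOn ℝ 2 f (halfSpace n)) (a : ℝ)
    (hX : X ∈ halfSpace n) :
    weightedLaplacian b (fun X => a * f X) X = a * weightedLaplacian b f X := by
  have h1 : ∀ j, ∀ X ∈ halfSpace n,
      DifferentiableAt ℝ f X ∧ DifferentiableAt ℝ (pderiv j f) X := fun j X hX =>
    ⟨differentiableAt_of_contDiffOn hf (by norm_num) hX,
      differentiableAt_of_contDiffOn (contDiffOn_pderiv hf (m := 1) (by norm_num) j)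
        (by norm_num) hX⟩
  have h2 : ∀ j, ∀ X ∈ halfSpace n, pderiv j (fun X => a * f X) X = a * pderiv j f X :=
    fun j X hX => pderiv_const_mul (h1 j X hX).1 a j
  have h3 : ∀ j, pderiv j (pderiv j (fun X => a * f X)) X = a * pderiv j (pderiv j f) X :=
    fun j => by rw [pderiv_congr (h2 j) j X hX, pderiv_const_mul (h1 j X hX).2]
  rw [weightedLaplacian_eq (contDiffOn_const.mul hf) hX, weightedLaplacian_eq hf hX, h2 _ X hX,
    Finset.sum_congr rfl fun j _ => h3 j, ← Finset.mul_sum]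
  ring

lemma pderiv_weightedLaplacian (hf : ContDiffOn ℝ 3 f (halfSpace n)) (hX : X ∈ halfSpace n)
    (i : Fin (n + 1)) :
    pderiv i (weightedLaplacian b f) X = (∑ j, pderiv i (pderiv j (pderiv j f)) X) +
      b * (pderiv (Fin.last n) f X * (if i = Fin.last n then -1 * yCoord X ^ (-2 : ℝ) else 0) +
        pderiv i (pderiv (Fin.last n) f) X * yCoord X ^ (-1 : ℝ)) := by
  have hf2 : ContDiffOn ℝ 2 f (halfSpace n) := hf.of_le (by norm_num)
  have hp2 : ∀ j, ContDiffOn ℝ 2 (pderiv j f) (halfSpace n) := fun j =>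
    contDiffOn_pderiv hf (by norm_num) j
  have hd1 : ∀ j, DifferentiableAt ℝ (pderiv j f) X := fun j =>
    differentiableAt_of_contDiffOn (hp2 j) (by norm_num) hX
  have hd2 : ∀ i j, DifferentiableAt ℝ (pderiv i (pderiv j f)) X := fun i j =>
    differentiableAt_of_contDiffOn (contDiffOn_pderiv (hp2 j) (m := 1) (by norm_num) i)
      (by norm_num) hX
  have hw := (hasFDerivAt_weight (-1 : ℝ) hX).differentiableAt
  rw [pderiv_congr (fun X hX => weightedLaplacian_eq (b := b) hf2 hX) i X hX, pderiv_add
      (DifferentiableAt.fun_sum fun j _ => hd2 j j) (((hd1 _).fun_mul hw).const_mul b),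
    pderiv_sum _ fun j _ => hd2 j j, pderiv_const_mul ((hd1 _).fun_mul hw), pderiv_mul (hd1 _) hw,
    pderiv_weight _ hX]
  norm_num

end Calculus

/-! ### The Green field and the tangential field. -/

section Fields

variable {n : ℕ} {b : ℝ} {c : Space n} {f h : Space n → ℝ} {X : Space n}

/-- `y^b (w ∇u - u ∇w)`. -/
def greenField (b : ℝ) (w u : Space n → ℝ) (j : Fin (n + 1)) (X : Space n) : ℝ :=
  w X * (yCoord X ^ b * pderiv j u X) - u X * (yCoord X ^ b * pderiv j w X)

lemma differentiableAt_weight_pderiv (hf : ContDiffOn ℝ 2 f (halfSpace n)) (hX : X ∈ halfSpace n)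
    (j : Fin (n + 1)) : DifferentiableAt ℝ (fun X => yCoord X ^ b * pderiv j f X) X :=
  (hasFDerivAt_weight b hX).differentiableAt.fun_mul (differentiableAt_of_contDiffOn
    (contDiffOn_pderiv hf (m := 1) (by norm_num) j) (by norm_num) hX)

lemma differentiableAt_greenField (hf : ContDiffOn ℝ 2 f (halfSpace n))
    (hh : ContDiffOn ℝ 2 h (halfSpace n)) (j : Fin (n + 1)) (hX : X ∈ halfSpace n) :
    DifferentiableAt ℝ (greenField b f h j) X :=
  ((differentiableAt_of_contDiffOn hf (by norm_num) hX).mul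
    (differentiableAt_weight_pderiv hh hX j)).sub
    ((differentiableAt_of_contDiffOn hh (by norm_num) hX).mul
      (differentiableAt_weight_pderiv hf hX j))

/-- The two gradient products cancel by symmetry, leaving only the weighted Laplacians. -/
lemma divergence_greenField (hf : ContDiffOn ℝ 2 f (halfSpace n))
    (hh : ContDiffOn ℝ 2 h (halfSpace n)) (hX : X ∈ halfSpace n) :
    divergence (greenField b f h) X =
      yCoord X ^ b * (f X * weightedLaplacian b h X - h X * weightedLaplacian b f X) := by
  have hdf := differentiableAt_of_contDiffOn hf (by norm_num) hX
  have hdh := differentiableAt_of_contDiffOn hh (by norm_num) hX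
  have h1 : ∀ j, fderiv ℝ (greenField b f h j) X (unitVec j) =
      f X * pderiv j (fun Z => yCoord Z ^ b * pderiv j h Z) X -
        h X * pderiv j (fun Z => yCoord Z ^ b * pderiv j f Z) X := by
    intro j
    rw [← pderiv_eq_fderiv (differentiableAt_greenField hf hh j hX)]
    unfold greenField
    rw [pderiv_sub (hdf.fun_mul (differentiableAt_weight_pderiv hh hX j))
      (hdh.fun_mul (differentiableAt_weight_pderiv hf hX j)),
      pderiv_mul hdf (differentiableAt_weight_pderiv hh hX j),
      pderiv_mul hdh (differentiableAt_weight_pderiv hf hX j)]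
    ring
  rw [divergence, Finset.sum_congr rfl fun j _ => h1 j, Finset.sum_sub_distrib, ← Finset.mul_sum,
    ← Finset.mul_sum, ← weight_mul_weightedLaplacian b h hX, ← weight_mul_weightedLaplacian b f hX]
  ring

lemma greenField_radial (hf : DifferentiableAt ℝ f X) (hh : DifferentiableAt ℝ h X) :
    ∑ j, greenField b f h j X * (X j - c j) =
      yCoord X ^ b * (f X * Dil c h X - h X * Dil c f X) := by
  rw [dil_eq_sum hf, dil_eq_sum hh, Finset.mul_sum, Finset.mul_sum, ← Finset.sum_sub_distrib,
    Finset.mul_sum]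
  exact Finset.sum_congr rfl fun j _ => by unfold greenField; ring

/-- The polarised density `r² ∇f · ∇h - Df Dh` of the tangential energy. -/
def tangForm (c : Space n) (f h : Space n → ℝ) (X : Space n) : ℝ :=
  ‖X - c‖ ^ 2 * (∑ j, pderiv j f X * pderiv j h X) - Dil c f X * Dil c h X

lemma tangForm_comm (c : Space n) (f h : Space n → ℝ) (X : Space n) :
    tangForm c f h X = tangForm c h f X := by
  simp only [tangForm, mul_comm]

/-- The weighted Laplacian along the spheres centred at `c`. -/
def sphLap (b : ℝ) (c : Space n) (f : Space n → ℝ) (X : Space n) : ℝ :=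
  ‖X - c‖ ^ 2 * weightedLaplacian b f X - Dil c (Dil c f) X - (n + b - 1) * Dil c f X

/-- `y^b h (r² ∇f - (Df) (X - c))`, a field tangent to the spheres centred at `c`. -/
def tangField (b : ℝ) (c : Space n) (f h : Space n → ℝ) (j : Fin (n + 1)) (X : Space n) : ℝ :=
  h X * ‖X - c‖ ^ 2 * (yCoord X ^ b * pderiv j f X) -
    h X * Dil c f X * (yCoord X ^ b * (X j - c j))

lemma norm_sub_sq_eq (c X : Space n) : ‖X - c‖ ^ 2 = ∑ j, (X j - c j) ^ 2 := by
  rw [EuclideanSpace.real_norm_sq_eq]; rfl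

lemma tangField_radial (hf : DifferentiableAt ℝ f X) :
    ∑ j, tangField b c f h j X * (X j - c j) = 0 := by
  have h1 : ∀ j, tangField b c f h j X * (X j - c j) =
      h X * yCoord X ^ b * ‖X - c‖ ^ 2 * ((X j - c j) * pderiv j f X) -
        h X * yCoord X ^ b * Dil c f X * (X j - c j) ^ 2 := fun j => by
    unfold tangField; ring
  rw [Finset.sum_congr rfl fun j _ => h1 j, Finset.sum_sub_distrib, ← Finset.mul_sum,
    ← Finset.mul_sum, ← dil_eq_sum hf, ← norm_sub_sq_eq]
  ring

lemma pderiv_norm_sub_sq (c X : Space n) (j : Fin (n + 1)) :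
    pderiv j (fun X => ‖X - c‖ ^ 2) X = 2 * (X j - c j) := by
  have h1 : HasFDerivAt (fun X : Space n => ‖X - c‖ ^ 2) (2 • innerSL ℝ (X - c)) X := by
    simpa using ((hasFDerivAt_id X).sub_const c).norm_sq
  rw [pderiv_eq_fderiv h1.differentiableAt, h1.fderiv]
  simp [unitVec, EuclideanSpace.inner_single_right]

lemma differentiableAt_norm_sub_sq (c X : Space n) :
    DifferentiableAt ℝ (fun X => ‖X - c‖ ^ 2) X :=
  (differentiableAt_id.sub_const c).norm_sq ℝ

lemma differentiableAt_tangField (hf : ContDiffOn ℝ 2 f (halfSpace n))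
    (hh : DifferentiableAt ℝ h X) (j : Fin (n + 1)) (hX : X ∈ halfSpace n) :
    DifferentiableAt ℝ (tangField b c f h j) X :=
  ((hh.fun_mul (differentiableAt_norm_sub_sq c X)).mul (differentiableAt_weight_pderiv hf hX j)).sub
    ((hh.fun_mul (differentiableAt_of_contDiffOn (contDiffOn_dil hf (m := 1) (by norm_num))
      (by norm_num) hX)).mul ((hasFDerivAt_weight b hX).differentiableAt.mul
        ((differentiableAt_coord j X).sub_const _)))

/-- The product rule gives the gradient pairing plus h times second-order terms. The coefficient n +
b - 1 of the first-order term is n + 1 from div(X - c), plus b from dilating the weight, minus 2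
from the gradient of |X - c|². -/
lemma divergence_tangField (hc : yCoord c = 0) (hf : ContDiffOn ℝ 2 f (halfSpace n))
    (hh : DifferentiableAt ℝ h X) (hX : X ∈ halfSpace n) :
    divergence (tangField b c f h) X =
      yCoord X ^ b * (tangForm c f h X + h X * sphLap b c f X) := by
  have hy : 0 < yCoord X := hX
  have hN := differentiableAt_norm_sub_sq c X
  have hdf := differentiableAt_of_contDiffOn hf (by norm_num) hX
  have hD : DifferentiableAt ℝ (Dil c f) X := differentiableAt_of_contDiffOn
    (contDiffOn_dil hf (m := 1) (by norm_num)) (by norm_num) hX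
  have hW := (hasFDerivAt_weight b hX).differentiableAt
  have hx : ∀ j, DifferentiableAt ℝ (fun X : Space n => X j - c j) X := fun j =>
    (differentiableAt_coord j X).sub_const _
  have h1 : ∀ j, fderiv ℝ (tangField b c f h j) X (unitVec j) =
      h X * ‖X - c‖ ^ 2 * pderiv j (fun Z => yCoord Z ^ b * pderiv j f Z) X +
      yCoord X ^ b * ‖X - c‖ ^ 2 * (pderiv j f X * pderiv j h X) +
      2 * (h X * yCoord X ^ b) * ((X j - c j) * pderiv j f X) -
      h X * yCoord X ^ b * ((X j - c j) * pderiv j (Dil c f) X) -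
      yCoord X ^ b * Dil c f X * ((X j - c j) * pderiv j h X) -
      h X * Dil c f X * yCoord X ^ b -
      h X * Dil c f X * ((X j - c j) * pderiv j (fun Z : Space n => yCoord Z ^ b) X) := by
    intro j
    rw [← pderiv_eq_fderiv (differentiableAt_tangField hf hh j hX)]
    unfold tangField
    have hP := differentiableAt_weight_pderiv (b := b) hf hX j
    rw [pderiv_sub ((hh.fun_mul hN).fun_mul hP) ((hh.fun_mul hD).fun_mul (hW.fun_mul (hx j))),
      pderiv_mul (hh.fun_mul hN) hP, pderiv_mul hh hN, pderiv_norm_sub_sq,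
      pderiv_mul (hh.fun_mul hD) (hW.fun_mul (hx j)), pderiv_mul hh hD, pderiv_mul hW (hx j),
      pderiv_coord_sub]
    simp only [if_true]
    ring
  rw [divergence, Finset.sum_congr rfl fun j _ => h1 j]
  simp only [Finset.sum_add_distrib, Finset.sum_sub_distrib, ← Finset.mul_sum]
  rw [← weight_mul_weightedLaplacian b f hX, ← dil_eq_sum hdf, ← dil_eq_sum hD, ← dil_eq_sum hh,
    ← dil_eq_sum hW, dil_weight hc b hX]
  simp only [Finset.sum_const, Finset.card_univ, Fintype.card_fin, nsmul_eq_mul, tangForm, sphLap]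
  push_cast
  ring

end Fields

/-! ### Regularity of a solution up to the boundary. -/

section Boundary

variable {n : ℕ} {b : ℝ} {c : Space n} {f : Space n → ℝ}

lemma isClosed_closedHalfSpace : IsClosed (closedHalfSpace n) :=
  isClosed_le continuous_const continuous_yCoord

lemma halfSpace_subset_closedHalfSpace : halfSpace n ⊆ closedHalfSpace n := fun X hX =>
  le_of_lt (show 0 < yCoord X from hX)

lemma closedHalfSpace_mem_nhds {X : Space n} (hX : X ∈ halfSpace n) : closedHalfSpace n ∈ 𝓝 X :=
  mem_of_superset (isOpen_halfSpace.mem_nhds hX) halfSpace_subset_closedHalfSpace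

lemma uniqueDiffOn_closedHalfSpace : UniqueDiffOn ℝ (closedHalfSpace n) := by
  refine uniqueDiffOn_convex ?_ ⟨liftPt 0 1, ?_⟩
  · intro X hX Y hY s t hs ht _
    have h1 : 0 ≤ X (Fin.last n) := hX
    have h2 : 0 ≤ Y (Fin.last n) := hY
    show 0 ≤ (s • X + t • Y) (Fin.last n)
    simp only [PiLp.add_apply, PiLp.smul_apply, smul_eq_mul]
    positivity
  · rw [mem_interior_iff_mem_nhds]
    exact closedHalfSpace_mem_nhds (liftPt_mem_halfSpace one_pos)

lemma eq_liftPt (X : Space n) :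
    X = liftPt (WithLp.toLp 2 fun i => X i.castSucc) (yCoord X) := by
  ext j
  refine Fin.lastCases ?_ (fun i => ?_) j <;> simp [yCoord]

lemma tendsto_liftPt (x : EuclideanSpace ℝ (Fin n)) :
    Tendsto (fun t => liftPt x t) (𝓝[>] 0) (𝓝[halfSpace n] (bdry x)) := by
  refine tendsto_nhdsWithin_iff.2 ⟨?_, ?_⟩
  · have h : Continuous fun t : ℝ => liftPt x t :=
      continuous_liftPt.comp (by fun_prop : Continuous fun t : ℝ => (x, t))
    exact (h.tendsto 0).mono_left nhdsWithin_le_nhds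
  · filter_upwards [self_mem_nhdsWithin] with t ht using liftPt_mem_halfSpace ht

lemma closedHalfSpace_subset_closure : closedHalfSpace n ⊆ closure (halfSpace n) := by
  intro X hX
  rcases eq_or_lt_of_le (show 0 ≤ yCoord X from hX) with h | h
  · rw [eq_liftPt X, ← h, liftPt_zero]
    exact mem_closure_of_tendsto ((tendsto_liftPt _).mono_right nhdsWithin_le_nhds)
      (by filter_upwards [self_mem_nhdsWithin] with t ht using liftPt_mem_halfSpace ht)
  · exact subset_closure h

lemma bdry_mem_closedHalfSpace (x : EuclideanSpace ℝ (Fin n)) : bdry x ∈ closedHalfSpace n := by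
  show 0 ≤ yCoord (bdry x)
  rw [yCoord_bdry]

lemma nhdsWithin_bdry_neBot (x : EuclideanSpace ℝ (Fin n)) :
    (𝓝[halfSpace n] (bdry x)).NeBot :=
  mem_closure_iff_nhdsWithin_neBot.1 (closedHalfSpace_subset_closure (bdry_mem_closedHalfSpace x))

lemma locBdd_of_continuousOn (hf : ContinuousOn f (closedHalfSpace n)) : LocBdd f := by
  intro R
  obtain ⟨M, hM⟩ := ((isCompact_closedBall (0 : Space n) R).inter_left
    isClosed_closedHalfSpace).exists_bound_of_continuousOn (hf.mono inter_subset_left)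
  exact ⟨M, fun X hX hR => hM X ⟨halfSpace_subset_closedHalfSpace hX, by simpa using hR⟩⟩

/-- Limits at all boundary points yield a continuous extension to the closed half-space, which is
bounded on compact sets. -/
lemma locBdd_of_tendsto (hf : ContinuousOn f (halfSpace n))
    (hl : ∀ x, ∃ l, Tendsto f (𝓝[halfSpace n] (bdry x)) (𝓝 l)) : LocBdd f := by
  have h1 : ContinuousOn (extendFrom (halfSpace n) f) (closedHalfSpace n) := by
    refine continuousOn_extendFrom closedHalfSpace_subset_closure fun X hX => ?_
    rcases eq_or_lt_of_le (show 0 ≤ yCoord X from hX) with h | h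
    · rw [eq_liftPt X, ← h, liftPt_zero]
      exact hl _
    · exact ⟨f X, hf X h⟩
  refine (locBdd_of_continuousOn h1).congr fun X hX => ?_
  exact (extendFrom_eq (subset_closure hX) (hf X hX)).symm

lemma LocBdd.tendsto_rpow_mul (hf : LocBdd f) {a : ℝ} (ha : 0 < a)
    (x : EuclideanSpace ℝ (Fin n)) :
    Tendsto (fun X => yCoord X ^ a * f X) (𝓝[halfSpace n] (bdry x)) (𝓝 0) := by
  obtain ⟨M, hM⟩ := hf (‖bdry x‖ + 1)
  have h1 : Tendsto (fun X : Space n => yCoord X ^ a) (𝓝[halfSpace n] (bdry x)) (𝓝 0) := by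
    have h : Continuous fun X : Space n => yCoord X ^ a :=
      continuous_yCoord.rpow_const fun _ => Or.inr ha.le
    have h2 := (h.tendsto (bdry x)).mono_left (nhdsWithin_le_nhds (s := halfSpace n))
    rwa [yCoord_bdry, Real.zero_rpow ha.ne'] at h2
  refine h1.zero_mul_isBoundedUnder_le ⟨M, ?_⟩
  rw [eventually_map]
  have h2 : ∀ᶠ X in 𝓝 (bdry x), ‖X‖ < ‖bdry x‖ + 1 :=
    continuous_norm.continuousAt.eventually_lt continuousAt_const (lt_add_one _)
  filter_upwards [self_mem_nhdsWithin, nhdsWithin_le_nhds h2] with X hX hlt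
  exact hM X hX hlt.le

/-- The extension of `∂_j f` to the closed half-space. -/
def closedPderiv (j : Fin (n + 1)) (f : Space n → ℝ) (X : Space n) : ℝ :=
  fderivWithin ℝ f (closedHalfSpace n) X (unitVec j)

lemma pderiv_eq_closedPderiv {k : WithTop ℕ∞} (hf : ContDiffOn ℝ k f (closedHalfSpace n))
    (hk : k ≠ 0) (j : Fin (n + 1)) {X : Space n} (hX : X ∈ halfSpace n) :
    pderiv j f X = closedPderiv j f X := by
  rw [pderiv_eq_fderiv ((hf.contDiffAt (closedHalfSpace_mem_nhds hX)).differentiableAt hk),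
    closedPderiv, fderivWithin_of_mem_nhds (closedHalfSpace_mem_nhds hX)]

lemma contDiffOn_closedPderiv {k m : WithTop ℕ∞} (hf : ContDiffOn ℝ k f (closedHalfSpace n))
    (hm : m + 1 ≤ k) (j : Fin (n + 1)) : ContDiffOn ℝ m (closedPderiv j f) (closedHalfSpace n) :=
  (hf.fderivWithin uniqueDiffOn_closedHalfSpace hm).clm_apply contDiffOn_const

lemma locBdd_pderiv (hf : ContDiffOn ℝ 1 f (closedHalfSpace n)) (j : Fin (n + 1)) :
    LocBdd (pderiv j f) :=
  (locBdd_of_continuousOn (contDiffOn_closedPderiv hf (m := 0) (by norm_num) j).continuousOn).congr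
    fun _ hX => pderiv_eq_closedPderiv hf (by norm_num) j hX

lemma locBdd_pderiv_pderiv (hf : ContDiffOn ℝ 2 f (closedHalfSpace n)) (i j : Fin (n + 1)) :
    LocBdd (pderiv i (pderiv j f)) :=
  (locBdd_pderiv (contDiffOn_closedPderiv hf (m := 1) (by norm_num) j) i).congr fun X hX =>
    pderiv_congr (fun _ hY => pderiv_eq_closedPderiv hf (by norm_num) j hY) i X hX

lemma hasDerivAt_liftPt (x : EuclideanSpace ℝ (Fin n)) (t : ℝ) :
    HasDerivAt (fun t => liftPt x t) (unitVec (Fin.last n)) t := by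
  have h : (fun t => liftPt x t) = fun t : ℝ => liftPt x 0 + t • (unitVec (Fin.last n) : Space n) := by
    ext t j
    refine Fin.lastCases ?_ (fun i => ?_) j <;> simp [unitVec]
  rw [h]
  simpa using ((hasDerivAt_id t).smul_const (unitVec (Fin.last n) : Space n)).const_add (liftPt x 0)

/-- A function with bounded normal derivative that vanishes on the boundary is `O(y)`. -/
lemma locBdd_div_yCoord (hf : ∀ X ∈ halfSpace n, DifferentiableAt ℝ f X)
    (hd : LocBdd (pderiv (Fin.last n) f))
    (h0 : ∀ x, Tendsto (fun t => f (liftPt x t)) (𝓝[>] 0) (𝓝 0)) :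
    LocBdd (fun X => f X * yCoord X ^ (-1 : ℝ)) := by
  intro R
  obtain ⟨M, hM⟩ := hd R
  refine ⟨M, fun X hX hR => ?_⟩
  have hy : 0 < yCoord X := hX
  set x : EuclideanSpace ℝ (Fin n) := WithLp.toLp 2 fun i => X i.castSucc with hx
  have hXx : X = liftPt x (yCoord X) := eq_liftPt X
  have hM0 : 0 ≤ M := (abs_nonneg _).trans (hM X hX hR)
  -- The mean value inequality is used on a vertical segment starting at height ε, since only the
  -- limit of f at the boundary is given; afterwards ε tends to 0.
  have hle : ∀ ε ∈ Ioo 0 (yCoord X), |f X - f (liftPt x ε)| ≤ M * yCoord X := by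
    intro ε hε
    have h1 : ∀ t ∈ Icc ε (yCoord X), HasDerivWithinAt (fun t => f (liftPt x t))
        (pderiv (Fin.last n) f (liftPt x t)) (Icc ε (yCoord X)) t := by
      intro t ht
      have hmem : liftPt x t ∈ halfSpace n := liftPt_mem_halfSpace (hε.1.trans_le ht.1)
      rw [pderiv_eq_fderiv (hf _ hmem)]
      exact ((hf _ hmem).hasFDerivAt.comp_hasDerivAt t (hasDerivAt_liftPt x t)).hasDerivWithinAt
    have h2 : ∀ t ∈ Ico ε (yCoord X), ‖pderiv (Fin.last n) f (liftPt x t)‖ ≤ M := by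
      intro t ht
      have ht0 : 0 < t := hε.1.trans_le ht.1
      refine hM _ (liftPt_mem_halfSpace ht0) (le_trans ?_ hR)
      refine le_of_sq_le_sq ?_ (norm_nonneg _)
      rw [hXx, norm_sq_liftPt, norm_sq_liftPt]
      nlinarith [ht.2]
    have h3 := norm_image_sub_le_of_norm_deriv_le_segment' h1 h2 (yCoord X) ⟨hε.2.le, le_rfl⟩
    rw [← hXx] at h3
    refine h3.trans (mul_le_mul_of_nonneg_left ?_ hM0)
    linarith [hε.1]
  have hlim : Tendsto (fun ε => |f X - f (liftPt x ε)|) (𝓝[>] 0) (𝓝 |f X - 0|) :=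
    (tendsto_const_nhds.sub (h0 x)).abs
  have h4 : |f X| ≤ M * yCoord X := by
    rw [sub_zero] at hlim
    refine le_of_tendsto hlim ?_
    filter_upwards [Ioo_mem_nhdsGT hy] with ε hε using hle ε hε
  rw [abs_mul, abs_of_pos (Real.rpow_pos_of_pos hy _), Real.rpow_neg_one, ← div_eq_mul_inv,
    div_le_iff₀ hy]
  exact h4

lemma bdry_add_smul_single (x : EuclideanSpace ℝ (Fin n)) (k : Fin n) (t : ℝ) :
    bdry x + t • (unitVec k.castSucc : Space n) = bdry (x + t • EuclideanSpace.single k 1) := by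
  rw [← liftPt_zero, ← liftPt_zero]
  ext j
  refine Fin.lastCases ?_ (fun i => ?_) j
  · simp [unitVec, (Fin.castSucc_lt_last k).ne]
  · simp [unitVec]

/-- If `∂_y f` vanishes on the boundary, so do its tangential derivatives. -/
lemma tendsto_pderiv_pderiv_last (hf : ContDiffOn ℝ 2 f (closedHalfSpace n))
    (h0 : ∀ x, Tendsto (pderiv (Fin.last n) f) (𝓝[halfSpace n] (bdry x)) (𝓝 0)) (k : Fin n)
    (x : EuclideanSpace ℝ (Fin n)) :
    Tendsto (pderiv k.castSucc (pderiv (Fin.last n) f)) (𝓝[halfSpace n] (bdry x)) (𝓝 0) := by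
  set h := closedPderiv (Fin.last n) f with hh
  have h1 : ContDiffOn ℝ 1 h (closedHalfSpace n) :=
    contDiffOn_closedPderiv hf (by norm_num) _
  have h2 : ∀ X ∈ halfSpace n, pderiv (Fin.last n) f X = h X := fun X hX =>
    pderiv_eq_closedPderiv hf (by norm_num) _ hX
  have hcont : ∀ (q : Space n → ℝ), ContinuousOn q (closedHalfSpace n) → ∀ x,
      Tendsto q (𝓝[halfSpace n] (bdry x)) (𝓝 (q (bdry x))) := fun q hq x =>
    (hq _ (bdry_mem_closedHalfSpace x)).mono_left
      (nhdsWithin_mono _ halfSpace_subset_closedHalfSpace)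
  have hzero : ∀ x, h (bdry x) = 0 := by
    intro x
    have := nhdsWithin_bdry_neBot x
    refine tendsto_nhds_unique (hcont h h1.continuousOn x) ((h0 x).congr' ?_)
    filter_upwards [self_mem_nhdsWithin] with X hX using h2 X hX
  have h3 := contDiffOn_closedPderiv h1 (m := 0) (by norm_num) k.castSucc
  -- The extension h of ∂_y f vanishes along the boundary line in direction k, so its one-sided
  -- differential vanishes in that direction.
  have h4 : closedPderiv k.castSucc h (bdry x) = 0 := by
    have hd : HasFDerivWithinAt h (fderivWithin ℝ h (closedHalfSpace n) (bdry x))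
        (closedHalfSpace n) (bdry x + (0 : ℝ) • (unitVec k.castSucc : Space n)) := by
      rw [zero_smul, add_zero]
      exact ((h1.differentiableOn (by norm_num)) _ (bdry_mem_closedHalfSpace x)).hasFDerivWithinAt
    have hl : HasDerivAt (fun t : ℝ => bdry x + t • (unitVec k.castSucc : Space n))
        (unitVec k.castSucc) 0 := by
      simpa using ((hasDerivAt_id (0 : ℝ)).smul_const (unitVec k.castSucc : Space n)).const_add
        (bdry x)
    have h5 := hd.comp_hasDerivAt (0 : ℝ) hl (Eventually.of_forall fun t => by
      rw [bdry_add_smul_single]; exact bdry_mem_closedHalfSpace _)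
    have h6 : (h ∘ fun t : ℝ => bdry x + t • (unitVec k.castSucc : Space n)) = fun _ => 0 := by
      ext t
      rw [Function.comp_apply, bdry_add_smul_single]
      exact hzero _
    rw [h6] at h5
    exact h5.unique (hasDerivAt_const _ _)
  rw [← h4]
  refine (hcont _ h3.continuousOn x).congr' ?_
  filter_upwards [self_mem_nhdsWithin] with X hX
  rw [pderiv_congr h2 k.castSucc X hX, pderiv_eq_closedPderiv h1 (by norm_num) _ hX]

/-- A single component of a classical solution, with flux `G`. -/
structure ExtensionSolution (b : ℝ) (v : Space n → ℝ) (G : EuclideanSpace ℝ (Fin n) → ℝ) :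
    Prop where
  smooth : ContDiffOn ℝ 4 v (halfSpace n)
  regular : ContDiffOn ℝ 2 v (closedHalfSpace n)
  regular_tangential : ∀ j : Fin n, ContDiffOn ℝ 2 (pderiv j.castSucc v) (closedHalfSpace n)
  regular_laplacian : ∀ x, ∃ l : ℝ,
    Tendsto (weightedLaplacian b v) (𝓝[halfSpace n] (bdry x)) (𝓝 l)
  equation : ∀ X ∈ halfSpace n, weightedLaplacian b (weightedLaplacian b v) X = 0
  neumann : ∀ x, Tendsto (fun X => yCoord X ^ b * pderiv (Fin.last n) v X)
    (𝓝[halfSpace n] (bdry x)) (𝓝 0)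
  flux : ∀ x, Tendsto (fun X => yCoord X ^ b *
    pderiv (Fin.last n) (weightedLaplacian b v) X) (𝓝[halfSpace n] (bdry x)) (𝓝 (G x))

namespace ExtensionSolution

variable {v : Space n → ℝ} {G : EuclideanSpace ℝ (Fin n) → ℝ}

lemma smooth_pderiv (hv : ExtensionSolution b v G) (j : Fin (n + 1)) :
    ContDiffOn ℝ 3 (pderiv j v) (halfSpace n) := contDiffOn_pderiv hv.smooth (by norm_num) j

lemma smooth_pderiv_pderiv (hv : ExtensionSolution b v G) (i j : Fin (n + 1)) :
    ContDiffOn ℝ 2 (pderiv i (pderiv j v)) (halfSpace n) :=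
  contDiffOn_pderiv (hv.smooth_pderiv j) (by norm_num) i

lemma smooth_lap (hv : ExtensionSolution b v G) :
    ContDiffOn ℝ 2 (weightedLaplacian b v) (halfSpace n) :=
  contDiffOn_weightedLaplacian hv.smooth (by norm_num)

lemma lap_eq (hv : ExtensionSolution b v G) {X : Space n} (hX : X ∈ halfSpace n) :
    weightedLaplacian b v X = (∑ j, pderiv j (pderiv j v) X) +
      b * (pderiv (Fin.last n) v X * yCoord X ^ (-1 : ℝ)) :=
  weightedLaplacian_eq (hv.smooth.of_le (by norm_num)) hX

lemma locBdd_lap (hv : ExtensionSolution b v G) : LocBdd (weightedLaplacian b v) :=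
  locBdd_of_tendsto hv.smooth_lap.continuousOn hv.regular_laplacian

lemma locBdd_pderiv (hv : ExtensionSolution b v G) (j : Fin (n + 1)) : LocBdd (pderiv j v) :=
  YangExtension.locBdd_pderiv (hv.regular.of_le (by norm_num)) j

lemma locBdd_pderiv_pderiv (hv : ExtensionSolution b v G) (i j : Fin (n + 1)) :
    LocBdd (pderiv i (pderiv j v)) :=
  YangExtension.locBdd_pderiv_pderiv hv.regular i j

/-- For b = 0 this is the Neumann condition. Otherwise (b/y)∂_y v = Δ_b v - Δv is locally bounded,
whence ∂_y v = O(y); the weighted condition alone would not suffice when b > 0. -/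
lemma tendsto_pderiv_last (hv : ExtensionSolution b v G) (x : EuclideanSpace ℝ (Fin n)) :
    Tendsto (pderiv (Fin.last n) v) (𝓝[halfSpace n] (bdry x)) (𝓝 0) := by
  by_cases hb : b = 0
  · simpa [hb] using hv.neumann x
  · have h1 : LocBdd fun X => b⁻¹ * (weightedLaplacian b v X - ∑ j, pderiv j (pderiv j v) X) :=
      (hv.locBdd_lap.sub (locBdd_sum _ fun j _ => hv.locBdd_pderiv_pderiv j j)).const_mul _
    refine (h1.tendsto_rpow_mul one_pos x).congr' ?_
    filter_upwards [self_mem_nhdsWithin] with X hX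
    have hy : yCoord X ≠ 0 := ne_of_gt hX
    rw [hv.lap_eq hX, Real.rpow_one, Real.rpow_neg_one]
    field_simp
    ring

lemma locBdd_pderiv_last_div (hv : ExtensionSolution b v G) :
    LocBdd (fun X => pderiv (Fin.last n) v X * yCoord X ^ (-1 : ℝ)) :=
  locBdd_div_yCoord (fun _ hX => differentiableAt_of_contDiffOn (hv.smooth_pderiv _)
    (by norm_num) hX) (hv.locBdd_pderiv_pderiv _ _)
    fun x => (hv.tendsto_pderiv_last x).comp (tendsto_liftPt x)

/-- Third derivatives with at least one tangential index are bounded. -/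
lemma locBdd_pderiv3_tangential (hv : ExtensionSolution b v G) (i j : Fin (n + 1)) (k : Fin n) :
    LocBdd (pderiv i (pderiv j (pderiv k.castSucc v))) :=
  YangExtension.locBdd_pderiv_pderiv (hv.regular_tangential k) i j

lemma pderiv_comm (hv : ExtensionSolution b v G) (i j : Fin (n + 1)) :
    ∀ X ∈ halfSpace n, pderiv i (pderiv j v) X = pderiv j (pderiv i v) X := fun _ hX =>
  YangExtension.pderiv_comm (hv.smooth.of_le (by norm_num)) hX i j

lemma pderiv3_comm (hv : ExtensionSolution b v G) (i j k : Fin (n + 1)) :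
    ∀ X ∈ halfSpace n, pderiv i (pderiv j (pderiv k v)) X = pderiv j (pderiv i (pderiv k v)) X :=
  fun _ hX => YangExtension.pderiv_comm ((hv.smooth_pderiv k).of_le (by norm_num)) hX i j

lemma locBdd_pderiv3_middle (hv : ExtensionSolution b v G) (i k : Fin (n + 1)) (j : Fin n) :
    LocBdd (pderiv i (pderiv j.castSucc (pderiv k v))) :=
  (hv.locBdd_pderiv3_tangential i k j).congr fun X hX =>
    pderiv_congr (hv.pderiv_comm _ _) i X hX

lemma locBdd_pderiv3_left (hv : ExtensionSolution b v G) (j k : Fin (n + 1)) (i : Fin n) :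
    LocBdd (pderiv i.castSucc (pderiv j (pderiv k v))) :=
  (hv.locBdd_pderiv3_middle j k i).congr fun X hX => hv.pderiv3_comm _ _ _ X hX

/-- The mixed derivative inherits vanishing on the boundary from ∂_y v, and its own normal
derivative is bounded by the tangential regularity. -/
lemma locBdd_pderiv_tangential_last_div (hv : ExtensionSolution b v G) (k : Fin n) :
    LocBdd (fun X => pderiv k.castSucc (pderiv (Fin.last n) v) X * yCoord X ^ (-1 : ℝ)) :=
  locBdd_div_yCoord (fun _ hX => differentiableAt_of_contDiffOn (hv.smooth_pderiv_pderiv _ _)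
    (by norm_num) hX) (hv.locBdd_pderiv3_middle _ _ _) fun x =>
      (tendsto_pderiv_pderiv_last hv.regular hv.tendsto_pderiv_last k x).comp (tendsto_liftPt x)

lemma locBdd_flux (hv : ExtensionSolution b v G) :
    LocBdd (fun X => yCoord X ^ b * pderiv (Fin.last n) (weightedLaplacian b v) X) := by
  refine locBdd_of_tendsto ?_ fun x => ⟨G x, hv.flux x⟩
  exact ((contDiffOn_weight b 0).mul
    (contDiffOn_pderiv hv.smooth_lap (m := 0) (by norm_num) _)).continuousOn

/-- A tangential derivative does not touch the coefficient b/y, so the singular term is (b/y)∂_k∂_y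
v, which is bounded. -/
lemma locBdd_pderiv_lap (hv : ExtensionSolution b v G) (k : Fin n) :
    LocBdd (pderiv k.castSucc (weightedLaplacian b v)) := by
  refine ((locBdd_sum Finset.univ fun j _ => hv.locBdd_pderiv3_left j j k).add
    ((hv.locBdd_pderiv_tangential_last_div k).const_mul b)).congr fun X hX => ?_
  rw [pderiv_weightedLaplacian (hv.smooth.of_le (by norm_num)) hX]
  simp [(Fin.castSucc_lt_last k).ne]

/-- The factor y splits as y^{1-b} · y^b: the second part turns ∂_y Δ_b v into the bounded flux, and
b < 1 makes the first harmless. -/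
lemma locBdd_yCoord_mul_pderiv_lap (hv : ExtensionSolution b v G) (hb : b < 1) :
    LocBdd (fun X => yCoord X * pderiv (Fin.last n) (weightedLaplacian b v) X) := by
  refine ((locBdd_rpow (n := n) (b := 1 - b) (by linarith)).mul hv.locBdd_flux).congr
    fun X hX => ?_
  have hy : 0 < yCoord X := hX
  rw [← mul_assoc, ← Real.rpow_add hy, sub_add_cancel, Real.rpow_one]

lemma locBdd_yCoord : LocBdd (yCoord : Space n → ℝ) := locBdd_of_continuous continuous_yCoord

/-- The purely normal third derivative is the one not covered by the assumed regularity. It is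
solved for in the formula for ∂_y Δ_b v, after multiplication by y. -/
lemma locBdd_yCoord_mul_pderiv3 (hv : ExtensionSolution b v G) (hb : b < 1) :
    LocBdd (fun X => yCoord X *
      pderiv (Fin.last n) (pderiv (Fin.last n) (pderiv (Fin.last n) v)) X) := by
  have h1 := (hv.locBdd_yCoord_mul_pderiv_lap hb).sub ((locBdd_yCoord.mul
    (locBdd_sum Finset.univ fun (j : Fin n) _ => hv.locBdd_pderiv3_middle (Fin.last n)
      j.castSucc j)).add (((hv.locBdd_pderiv_pderiv (Fin.last n) (Fin.last n)).sub
        hv.locBdd_pderiv_last_div).const_mul b))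
  refine h1.congr fun X hX => ?_
  have hy : 0 < yCoord X := hX
  rw [pderiv_weightedLaplacian (hv.smooth.of_le (by norm_num)) hX, Fin.sum_univ_castSucc, if_pos rfl]
  have h2 : yCoord X ^ (-2 : ℝ) = (yCoord X ^ 2)⁻¹ := by
    rw [Real.rpow_neg hy.le]; norm_cast
  rw [h2, Real.rpow_neg_one]
  field_simp
  ring

lemma locBdd_coord_sub (c : Space n) (j : Fin (n + 1)) : LocBdd (fun X : Space n => X j - c j) :=
  locBdd_of_continuous (by fun_prop)

lemma coord_last_sub (hc : yCoord c = 0) (X : Space n) :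
    X (Fin.last n) - c (Fin.last n) = yCoord X := by
  have h : c (Fin.last n) = 0 := hc
  rw [h, sub_zero]; rfl

/-- If some index is tangential the derivative itself is bounded. If all three are normal, the
coordinate factors are powers of y and one of them pays for the singularity. -/
lemma locBdd_coord_mul_pderiv3 (hv : ExtensionSolution b v G) (hb : b < 1) (hc : yCoord c = 0)
    (i j k : Fin (n + 1)) : LocBdd (fun X => (X i - c i) * ((X j - c j) *
      ((X k - c k) * pderiv k (pderiv j (pderiv i v)) X))) := by
  have hx := fun j => locBdd_coord_sub c j
  refine Fin.lastCases (motive := fun i => LocBdd (fun X => (X i - c i) * ((X j - c j) *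
    ((X k - c k) * pderiv k (pderiv j (pderiv i v)) X)))) ?_
    (fun i => (hx _).mul ((hx _).mul ((hx _).mul (hv.locBdd_pderiv3_tangential k j i)))) i
  refine Fin.lastCases (motive := fun j => LocBdd (fun X => (X (Fin.last n) - c (Fin.last n)) *
    ((X j - c j) * ((X k - c k) * pderiv k (pderiv j (pderiv (Fin.last n) v)) X)))) ?_
    (fun j => (hx _).mul ((hx _).mul ((hx _).mul (hv.locBdd_pderiv3_middle k _ j)))) j
  refine Fin.lastCases (motive := fun k => LocBdd (fun X => (X (Fin.last n) - c (Fin.last n)) *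
    ((X (Fin.last n) - c (Fin.last n)) * ((X k - c k) *
      pderiv k (pderiv (Fin.last n) (pderiv (Fin.last n) v)) X)))) ?_
    (fun k => (hx _).mul ((hx _).mul ((hx _).mul (hv.locBdd_pderiv3_left _ _ k)))) k
  refine (hx _).mul ((hx _).mul ((hv.locBdd_yCoord_mul_pderiv3 hb).congr fun X _ => ?_))
  rw [coord_last_sub hc]

lemma locBdd_dil (hf : ∀ X ∈ halfSpace n, DifferentiableAt ℝ f X)
    (h : ∀ j, LocBdd (fun X => (X j - c j) * pderiv j f X)) : LocBdd (Dil c f) :=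
  (locBdd_sum Finset.univ fun j _ => h j).congr fun X hX => dil_eq_sum (hf X hX)

lemma differentiableAt_v (hv : ExtensionSolution b v G) :
    ∀ X ∈ halfSpace n, DifferentiableAt ℝ v X := fun _ hX =>
  differentiableAt_of_contDiffOn hv.smooth (by norm_num) hX

lemma differentiableAt_pderiv (hv : ExtensionSolution b v G) (j : Fin (n + 1)) :
    ∀ X ∈ halfSpace n, DifferentiableAt ℝ (pderiv j v) X := fun _ hX =>
  differentiableAt_of_contDiffOn (hv.smooth_pderiv j) (by norm_num) hX

lemma locBdd_dil_v (hv : ExtensionSolution b v G) : LocBdd (Dil c v) :=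
  locBdd_dil hv.differentiableAt_v fun j => (locBdd_coord_sub c j).mul (hv.locBdd_pderiv j)

lemma locBdd_dil_pderiv (hv : ExtensionSolution b v G) (j : Fin (n + 1)) :
    LocBdd (Dil c (pderiv j v)) :=
  locBdd_dil (hv.differentiableAt_pderiv j) fun k =>
    (locBdd_coord_sub c k).mul (hv.locBdd_pderiv_pderiv k j)

lemma pderiv_dil_v (hv : ExtensionSolution b v G) (j : Fin (n + 1)) : ∀ X ∈ halfSpace n,
    pderiv j (Dil c v) X = Dil c (pderiv j v) X + pderiv j v X := fun _ hX =>
  pderiv_dil (hv.smooth.of_le (by norm_num)) hX j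

lemma locBdd_pderiv_dil (hv : ExtensionSolution b v G) (j : Fin (n + 1)) :
    LocBdd (pderiv j (Dil c v)) :=
  ((hv.locBdd_dil_pderiv j).add (hv.locBdd_pderiv j)).congr (hv.pderiv_dil_v j)

lemma smooth_dil (hv : ExtensionSolution b v G) : ContDiffOn ℝ 3 (Dil c v) (halfSpace n) :=
  contDiffOn_dil hv.smooth (by norm_num)

lemma smooth_dil_dil (hv : ExtensionSolution b v G) :
    ContDiffOn ℝ 2 (Dil c (Dil c v)) (halfSpace n) := contDiffOn_dil hv.smooth_dil (by norm_num)

lemma smooth_dil_pderiv (hv : ExtensionSolution b v G) (j : Fin (n + 1)) :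
    ContDiffOn ℝ 2 (Dil c (pderiv j v)) (halfSpace n) :=
  contDiffOn_dil (hv.smooth_pderiv j) (by norm_num)

lemma locBdd_dil_dil (hv : ExtensionSolution b v G) : LocBdd (Dil c (Dil c v)) :=
  locBdd_dil (fun _ hX => differentiableAt_of_contDiffOn hv.smooth_dil (by norm_num) hX)
    fun j => (locBdd_coord_sub c j).mul (hv.locBdd_pderiv_dil j)

lemma locBdd_coord_mul_dil_dil_pderiv (hv : ExtensionSolution b v G) (hb : b < 1)
    (hc : yCoord c = 0) (j : Fin (n + 1)) :
    LocBdd (fun X => (X j - c j) * Dil c (Dil c (pderiv j v)) X) := by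
  have h1 : LocBdd (fun X => ∑ k, ((∑ i, (X j - c j) * ((X k - c k) *
      ((X i - c i) * pderiv i (pderiv k (pderiv j v)) X))) +
        (X j - c j) * ((X k - c k) * pderiv k (pderiv j v) X))) :=
    locBdd_sum _ fun k _ => (locBdd_sum _ fun i _ => hv.locBdd_coord_mul_pderiv3 hb hc j k i).add
      ((locBdd_coord_sub c j).mul ((locBdd_coord_sub c k).mul (hv.locBdd_pderiv_pderiv k j)))
  refine h1.congr fun X hX => ?_
  rw [dil_eq_sum (differentiableAt_of_contDiffOn (hv.smooth_dil_pderiv j) (by norm_num) hX),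
    Finset.mul_sum]
  refine Finset.sum_congr rfl fun k _ => ?_
  rw [pderiv_dil ((hv.smooth_pderiv j).of_le (by norm_num)) hX, dil_eq_sum
    (differentiableAt_of_contDiffOn (hv.smooth_pderiv_pderiv k j) (by norm_num) hX),
    mul_add, mul_add, Finset.mul_sum, Finset.mul_sum]

lemma locBdd_dil_dil_dil (hv : ExtensionSolution b v G) (hb : b < 1) (hc : yCoord c = 0) :
    LocBdd (Dil c (Dil c (Dil c v))) := by
  refine locBdd_dil (fun _ hX => differentiableAt_of_contDiffOn hv.smooth_dil_dil (by norm_num) hX)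
    fun j => ?_
  refine ((hv.locBdd_coord_mul_dil_dil_pderiv hb hc j).add ((locBdd_coord_sub c j).mul
    (((hv.locBdd_dil_pderiv (c := c) j).const_mul 2).add (hv.locBdd_pderiv j)))).congr fun X hX => ?_
  have hd1 := differentiableAt_of_contDiffOn (hv.smooth_dil_pderiv (c := c) j) (by norm_num) hX
  rw [pderiv_dil (hv.smooth_dil.of_le (by norm_num)) hX, dil_congr (hv.pderiv_dil_v j) X hX,
    dil_add hd1 (hv.differentiableAt_pderiv j X hX), hv.pderiv_dil_v j X hX]
  ring

lemma locBdd_dil_lap (hv : ExtensionSolution b v G) (hb : b < 1) (hc : yCoord c = 0) :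
    LocBdd (Dil c (weightedLaplacian b v)) := by
  refine locBdd_dil (fun _ hX => differentiableAt_of_contDiffOn hv.smooth_lap (by norm_num) hX)
    fun j => ?_
  refine Fin.lastCases (motive := fun j => LocBdd (fun X => (X j - c j) *
    pderiv j (weightedLaplacian b v) X)) ?_
    (fun k => (locBdd_coord_sub c _).mul (hv.locBdd_pderiv_lap k)) j
  exact (hv.locBdd_yCoord_mul_pderiv_lap hb).congr fun X _ => by rw [coord_last_sub hc]

/-- After commuting ∂_y with D, tangential terms are quotients already bounded, and in the normal
term the factor y from D cancels y⁻¹. -/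
lemma locBdd_pderiv_last_dil_div (hv : ExtensionSolution b v G) (hc : yCoord c = 0) :
    LocBdd (fun X => pderiv (Fin.last n) (Dil c v) X * yCoord X ^ (-1 : ℝ)) := by
  have h1 := ((locBdd_sum Finset.univ fun (k : Fin n) _ => (locBdd_coord_sub c k.castSucc).mul
    (hv.locBdd_pderiv_tangential_last_div k)).add
      (hv.locBdd_pderiv_pderiv (Fin.last n) (Fin.last n))).add hv.locBdd_pderiv_last_div
  refine h1.congr fun X hX => ?_
  have hy : yCoord X ≠ 0 := ne_of_gt hX
  rw [hv.pderiv_dil_v _ X hX, dil_eq_sum (hv.differentiableAt_pderiv _ X hX),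
    Fin.sum_univ_castSucc, coord_last_sub hc, add_mul, add_mul, Finset.sum_mul,
    Real.rpow_neg_one]
  simp only [mul_assoc]
  congr 2
  field_simp

end ExtensionSolution

end Boundary

/-! ### The scaling generator and integration by parts on half-spheres. -/

section Flow

variable {n : ℕ} {b α : ℝ} {c : Space n} {f g : Space n → ℝ} {ν : Measure (Space n)}

lemma dilInt_congr (hν : OnUnitHalfBall ν) (hc : yCoord c = 0) {r : ℝ} (hr : 0 < r)
    (h : ∀ X ∈ halfSpace n, f X = g X) : dilInt ν c f r = dilInt ν c g r :=
  integral_congr_ae (hν.mono fun _ hZ => h _ ((add_smul_mem_halfSpace hc hr).2 hZ.1))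

/-- `f` and its derivative along dilations are admissible. -/
structure Flowable (c : Space n) (f : Space n → ℝ) : Prop where
  adm : Admissible f
  diff : ∀ X ∈ halfSpace n, DifferentiableAt ℝ f X
  dil : Admissible (Dil c f)

lemma Flowable.mul (hf : Flowable c f) (hg : Flowable c g) : Flowable c (fun X => f X * g X) :=
  ⟨hf.adm.mul hg.adm, fun X hX => (hf.diff X hX).fun_mul (hg.diff X hX),
    ((hf.adm.mul hg.dil).add (hf.dil.mul hg.adm)).congr fun X hX =>
      dil_mul (hf.diff X hX) (hg.diff X hX)⟩

lemma Flowable.add (hf : Flowable c f) (hg : Flowable c g) : Flowable c (fun X => f X + g X) :=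
  ⟨hf.adm.add hg.adm, fun X hX => (hf.diff X hX).fun_add (hg.diff X hX),
    (hf.dil.add hg.dil).congr fun X hX => dil_add (hf.diff X hX) (hg.diff X hX)⟩

lemma Flowable.const_mul (hf : Flowable c f) (a : ℝ) : Flowable c (fun X => a * f X) :=
  ⟨hf.adm.const_mul a, fun X hX => (hf.diff X hX).const_mul a,
    (hf.dil.const_mul a).congr fun X hX => dil_const_mul (hf.diff X hX) a⟩

lemma Flowable.sub (hf : Flowable c f) (hg : Flowable c g) : Flowable c (fun X => f X - g X) :=
  ⟨hf.adm.sub hg.adm, fun X hX => (hf.diff X hX).fun_sub (hg.diff X hX),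
    (hf.dil.sub hg.dil).congr fun X hX => dil_sub (hf.diff X hX) (hg.diff X hX)⟩

lemma Flowable.congr (hf : Flowable c f) (h : ∀ X ∈ halfSpace n, g X = f X) : Flowable c g :=
  ⟨hf.adm.congr h, fun X hX => (hf.diff X hX).congr_of_eventuallyEq
    (eventually_of_mem (isOpen_halfSpace.mem_nhds hX) h), hf.dil.congr (dil_congr h)⟩

lemma dil_norm_sub_sq (c X : Space n) : Dil c (fun X => ‖X - c‖ ^ 2) X = 2 * ‖X - c‖ ^ 2 := by
  rw [dil_eq_sum (differentiableAt_norm_sub_sq c X), norm_sub_sq_eq, Finset.mul_sum]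
  exact Finset.sum_congr rfl fun j _ => by rw [pderiv_norm_sub_sq]; ring

lemma flowable_norm_sub_sq (c : Space n) : Flowable c (fun X => ‖X - c‖ ^ 2) := by
  have h : Admissible fun X : Space n => ‖X - c‖ ^ 2 := admissible_of_continuous (by fun_prop)
  exact ⟨h, fun X _ => differentiableAt_norm_sub_sq c X,
    (h.const_mul 2).congr fun X _ => dil_norm_sub_sq c X⟩

/-- The infinitesimal generator `D + α` of the scaling `r^α f(c + r ·)`. -/
def twist (α : ℝ) (c : Space n) (f : Space n → ℝ) (X : Space n) : ℝ := Dil c f X + α * f X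

lemma Flowable.twist_adm (hf : Flowable c f) (α : ℝ) : Admissible (twist α c f) :=
  hf.dil.add (hf.adm.const_mul α)

lemma Flowable.hasDerivAt (hf : Flowable c f) [IsFiniteMeasure ν] (hν : OnUnitHalfBall ν)
    (hc : yCoord c = 0) (a : ℝ) {r : ℝ} (hr : 0 < r) :
    HasDerivAt (fun r => r ^ a * dilInt ν c f r) (r ^ (a - 1) * dilInt ν c (twist a c f) r) r := by
  have h1 := (Real.hasDerivAt_rpow_const (p := a) (Or.inl hr.ne')).mul
    (hf.adm.hasDerivAt_dilInt hf.diff hf.dil hν hc hr)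
  refine h1.congr_deriv ?_
  unfold twist
  rw [Admissible.dilInt_add hν hc hr hf.dil (hf.adm.const_mul a), dilInt_const_mul]
  have : r ^ a = r ^ (a - 1) * r := by rw [← Real.rpow_add_one hr.ne', sub_add_cancel]
  rw [this]
  field_simp
  ring

lemma twist_mul {X : Space n} (hf : DifferentiableAt ℝ f X) (hg : DifferentiableAt ℝ g X) :
    twist (2 * α) c (fun X => f X * g X) X =
      twist α c f X * g X + f X * twist α c g X := by
  rw [twist, dil_mul hf hg, twist, twist]; ring

/-- The exponent 2α is shared equally between the two factors, so the product rule lets D + α act on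
each of them separately. -/
lemma Flowable.hasDerivAt_mul (hf : Flowable c f) (hg : Flowable c g) [IsFiniteMeasure ν]
    (hν : OnUnitHalfBall ν) (hc : yCoord c = 0) (α : ℝ) {r : ℝ} (hr : 0 < r) :
    HasDerivAt (fun r => r ^ (2 * α) * dilInt ν c (fun X => f X * g X) r)
      (r ^ (2 * α - 1) * dilInt ν c (fun X => twist α c f X * g X + f X * twist α c g X) r) r := by
  have h := (hf.mul hg).hasDerivAt hν hc (2 * α) hr
  rwa [dilInt_congr hν hc hr fun X hX => twist_mul (hf.diff X hX) (hg.diff X hX)] at h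

/-- The properties of `f` that allow integration by parts over the half-spheres. -/
structure SphereRegular (b : ℝ) (c : Space n) (f : Space n → ℝ) : Prop where
  smooth : ContDiffOn ℝ 2 f (halfSpace n)
  bdd : LocBdd f
  bdd_pderiv : ∀ j, LocBdd (pderiv j f)
  bdd_last : LocBdd (fun X => pderiv (Fin.last n) f X * yCoord X ^ (-1 : ℝ))
  bdd_sphLap : LocBdd (sphLap b c f)

namespace SphereRegular

lemma diff (hf : SphereRegular b c f) : ∀ X ∈ halfSpace n, DifferentiableAt ℝ f X := fun _ hX =>
  differentiableAt_of_contDiffOn hf.smooth (by norm_num) hX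

lemma adm (hf : SphereRegular b c f) : Admissible f := ⟨hf.smooth.continuousOn, hf.bdd⟩

lemma adm_dil (hf : SphereRegular b c f) : Admissible (Dil c f) :=
  ⟨(contDiffOn_dil hf.smooth (m := 0) (by norm_num)).continuousOn,
    ExtensionSolution.locBdd_dil hf.diff fun j =>
      (ExtensionSolution.locBdd_coord_sub c j).mul (hf.bdd_pderiv j)⟩

lemma adm_pderiv (hf : SphereRegular b c f) (j : Fin (n + 1)) : Admissible (pderiv j f) :=
  ⟨(contDiffOn_pderiv hf.smooth (m := 0) (by norm_num) j).continuousOn, hf.bdd_pderiv j⟩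

lemma adm_sphLap (hf : SphereRegular b c f) : Admissible (sphLap b c f) := by
  refine ⟨?_, hf.bdd_sphLap⟩
  have h1 := (contDiffOn_weightedLaplacian (b := b) hf.smooth (m := 0) (by norm_num)).continuousOn
  have h2 := (contDiffOn_dil (c := c) (contDiffOn_dil (c := c) hf.smooth (m := 1) (by norm_num))
    (m := 0) (by norm_num)).continuousOn
  exact (((Continuous.continuousOn (by fun_prop)).mul h1).sub h2).sub
    (hf.adm_dil.cont.const_mul _)

lemma adm_tangForm (hf : SphereRegular b c f) (hg : SphereRegular b c g) :
    Admissible (tangForm c f g) :=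
  ((flowable_norm_sub_sq c).adm.mul (admissible_sum _ fun j _ =>
    (hf.adm_pderiv j).mul (hg.adm_pderiv j))).sub (hf.adm_dil.mul hg.adm_dil)

/-- Integration by parts over the half-spheres. -/
lemma dilInt_mul_sphLap {x₀ : EuclideanSpace ℝ (Fin n)} (hb : -1 < b) (hn : 0 < n)
    (hf : SphereRegular b (bdry x₀) f) (hg : SphereRegular b (bdry x₀) g) {r : ℝ} (hr : 0 < r) :
    dilInt (sphereWeight n b) (bdry x₀) (fun X => g X * sphLap b (bdry x₀) f X) r =
      - dilInt (sphereWeight n b) (bdry x₀) (tangForm (bdry x₀) f g) r := by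
  have hc : yCoord (bdry x₀) = 0 := yCoord_bdry x₀
  have := isFiniteMeasure_sphereWeight (n := n) hb
  -- The normal component is y^{b+1} times a bounded function, so b > -1 leaves no flux through the
  -- flat boundary.
  have hlast : ∀ X ∈ halfSpace n, tangField b (bdry x₀) f g (Fin.last n) X =
      yCoord X ^ (b + 1) * (g X * (‖X - bdry x₀‖ ^ 2 *
        (pderiv (Fin.last n) f X * yCoord X ^ (-1 : ℝ))) - g X * Dil (bdry x₀) f X) := by
    intro X hX
    have hy : yCoord X ≠ 0 := ne_of_gt hX
    rw [tangField, ExtensionSolution.coord_last_sub hc, Real.rpow_add_one hy, Real.rpow_neg_one]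
    field_simp
  have hbd : LocBdd (fun X => g X * (‖X - bdry x₀‖ ^ 2 *
        (pderiv (Fin.last n) f X * yCoord X ^ (-1 : ℝ))) - g X * Dil (bdry x₀) f X) :=
    (hg.bdd.mul ((flowable_norm_sub_sq _).adm.bdd.mul hf.bdd_last)).sub (hg.bdd.mul hf.adm_dil.bdd)
  have hadm1 := hf.adm_tangForm hg
  have hadm2 := hg.adm.mul hf.adm_sphLap
  have key := half_sphere_divergence (x₀ := x₀) hb hn
    (fun j X hX => differentiableAt_tangField hf.smooth (hg.diff X hX) j hX)
    (hadm1.add hadm2)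
    (fun X hX => divergence_tangField hc hf.smooth (hg.diff X hX) hX)
    (fun X hX => tangField_radial (hf.diff X hX))
    (((locBdd_rpow (by linarith)).mul hbd).congr hlast)
    (fun x => by
      refine ((hbd.tendsto_rpow_mul (a := b + 1) (by linarith) x).comp
        (tendsto_liftPt x)).congr' ?_
      filter_upwards [self_mem_nhdsWithin] with t ht
      exact (hlast _ (liftPt_mem_halfSpace ht)).symm) hr
  rw [Admissible.dilInt_add (onUnitHalfBall_sphereWeight b) hc hr hadm1 hadm2] at key
  linarith

end SphereRegular

/-- Cauchy–Schwarz: the derivative along X - c is at most |X - c||∇f|. -/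
lemma tangForm_self_nonneg (c : Space n) {X : Space n} (hf : DifferentiableAt ℝ f X) :
    0 ≤ tangForm c f f X := by
  rw [tangForm, dil_eq_sum hf, norm_sub_sq_eq, sub_nonneg, ← sq]
  refine (Finset.sum_mul_sq_le_sq_mul_sq _ _ _).trans_eq ?_
  congr 1
  exact Finset.sum_congr rfl fun j _ => sq _

end Flow

/-! ### Twists of a solution, their regularity, and Green's identity. -/

namespace ExtensionSolution

variable {n : ℕ} {b α : ℝ} {c : Space n} {v : Space n → ℝ} {G : EuclideanSpace ℝ (Fin n) → ℝ}

lemma locBdd_v (hv : ExtensionSolution b v G) : LocBdd v :=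
  locBdd_of_continuousOn hv.regular.continuousOn

lemma adm_v (hv : ExtensionSolution b v G) : Admissible v := ⟨hv.smooth.continuousOn, hv.locBdd_v⟩

lemma adm_dil (hv : ExtensionSolution b v G) : Admissible (Dil c v) :=
  ⟨hv.smooth_dil.continuousOn, hv.locBdd_dil_v⟩

lemma adm_dil_dil (hv : ExtensionSolution b v G) : Admissible (Dil c (Dil c v)) :=
  ⟨hv.smooth_dil_dil.continuousOn, hv.locBdd_dil_dil⟩

lemma adm_lap (hv : ExtensionSolution b v G) : Admissible (weightedLaplacian b v) :=
  ⟨hv.smooth_lap.continuousOn, hv.locBdd_lap⟩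

lemma flowable_v (hv : ExtensionSolution b v G) : Flowable c v :=
  ⟨hv.adm_v, hv.differentiableAt_v, hv.adm_dil⟩

lemma flowable_dil (hv : ExtensionSolution b v G) : Flowable c (Dil c v) :=
  ⟨hv.adm_dil, fun _ hX => differentiableAt_of_contDiffOn hv.smooth_dil (by norm_num) hX,
    hv.adm_dil_dil⟩

lemma flowable_dil_dil (hv : ExtensionSolution b v G) (hb : b < 1) (hc : yCoord c = 0) :
    Flowable c (Dil c (Dil c v)) :=
  ⟨hv.adm_dil_dil, fun _ hX => differentiableAt_of_contDiffOn hv.smooth_dil_dil (by norm_num) hX,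
    (contDiffOn_dil hv.smooth_dil_dil (m := 0) (by norm_num)).continuousOn,
    hv.locBdd_dil_dil_dil hb hc⟩

lemma flowable_lap (hv : ExtensionSolution b v G) (hb : b < 1) (hc : yCoord c = 0) :
    Flowable c (weightedLaplacian b v) :=
  ⟨hv.adm_lap, fun _ hX => differentiableAt_of_contDiffOn hv.smooth_lap (by norm_num) hX,
    (contDiffOn_dil hv.smooth_lap (m := 0) (by norm_num)).continuousOn, hv.locBdd_dil_lap hb hc⟩

lemma flowable_twist (hv : ExtensionSolution b v G) (α : ℝ) : Flowable c (twist α c v) :=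
  hv.flowable_dil.add (hv.flowable_v.const_mul α)

lemma dil_twist (hv : ExtensionSolution b v G) (α : ℝ) : ∀ X ∈ halfSpace n,
    Dil c (twist α c v) X = Dil c (Dil c v) X + α * Dil c v X := fun X hX => by
  have h := hv.differentiableAt_v X hX
  have h2 : DifferentiableAt ℝ (Dil c v) X := hv.flowable_dil.diff X hX
  unfold twist
  rw [dil_add h2 (h.const_mul α), dil_const_mul h]

lemma twist_twist (hv : ExtensionSolution b v G) (α : ℝ) : ∀ X ∈ halfSpace n,
    twist α c (twist α c v) X = Dil c (Dil c v) X + 2 * α * Dil c v X + α * α * v X :=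
  fun X hX => by
    rw [twist, hv.dil_twist α X hX, twist]; ring

lemma flowable_twist_twist (hv : ExtensionSolution b v G) (hb : b < 1) (hc : yCoord c = 0)
    (α : ℝ) : Flowable c (twist α c (twist α c v)) :=
  (((hv.flowable_dil_dil hb hc).add (hv.flowable_dil.const_mul (2 * α))).add
    (hv.flowable_v.const_mul (α * α))).congr (hv.twist_twist α)

/-- The spherical part of `Δ_b v`, in terms of the generator of the scaling. -/
lemma sphLap_v (hv : ExtensionSolution b v G) (α : ℝ) : ∀ X ∈ halfSpace n,
    sphLap b c v X = ‖X - c‖ ^ 2 * weightedLaplacian b v X - twist α c (twist α c v) X -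
      (n + b - 1 - 2 * α) * twist α c v X + α * (n + b - 1 - α) * v X := fun X hX => by
  rw [hv.twist_twist α X hX, sphLap, twist]; ring

lemma smooth_twist (hv : ExtensionSolution b v G) : ContDiffOn ℝ 3 (twist α c v) (halfSpace n) :=
  hv.smooth_dil.add (contDiffOn_const.mul (hv.smooth.of_le (by norm_num)))

lemma lap_twist (hv : ExtensionSolution b v G) (hc : yCoord c = 0) : ∀ X ∈ halfSpace n,
    weightedLaplacian b (twist α c v) X =
      Dil c (weightedLaplacian b v) X + (α + 2) * weightedLaplacian b v X := fun X hX => by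
  have h2 : ContDiffOn ℝ 2 v (halfSpace n) := hv.smooth.of_le (by norm_num)
  unfold twist
  rw [weightedLaplacian_add (hv.smooth_dil.of_le (by norm_num)) (contDiffOn_const.mul h2) hX,
    weightedLaplacian_const_mul h2 _ hX,
    weightedLaplacian_dil hc (hv.smooth.of_le (by norm_num)) hX]
  ring

lemma dil_twist_twist (hv : ExtensionSolution b v G) (hb : b < 1) (hc : yCoord c = 0) :
    ∀ X ∈ halfSpace n, Dil c (Dil c (twist α c v)) X =
      Dil c (Dil c (Dil c v)) X + α * Dil c (Dil c v) X := fun X hX => by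
  rw [dil_congr (hv.dil_twist α) X hX, dil_add ((hv.flowable_dil_dil hb hc).diff X hX)
    ((hv.flowable_dil.diff X hX).const_mul α), dil_const_mul (hv.flowable_dil.diff X hX)]

/-- The spherical operator is homogeneous of degree 0, so it commutes with dilations: the 2 from the
commutator of Δ_b with D is offset by the 2 from differentiating |X - c|². -/
lemma twist_sphLap (hv : ExtensionSolution b v G) (hb : b < 1) (hc : yCoord c = 0) (α : ℝ) :
    ∀ X ∈ halfSpace n, twist α c (sphLap b c v) X = sphLap b c (twist α c v) X := fun X hX => by
  have h1 := (hv.flowable_lap hb hc).diff X hX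
  have h2 := (hv.flowable_dil_dil hb hc).diff X hX
  have h3 : DifferentiableAt ℝ (Dil c v) X := hv.flowable_dil.diff X hX
  have hN := differentiableAt_norm_sub_sq c X
  have h4 : Dil c (sphLap b c v) X = ‖X - c‖ ^ 2 * Dil c (weightedLaplacian b v) X +
      2 * ‖X - c‖ ^ 2 * weightedLaplacian b v X - Dil c (Dil c (Dil c v)) X -
        (n + b - 1) * Dil c (Dil c v) X := by
    unfold sphLap
    rw [dil_sub ((hN.fun_mul h1).fun_sub h2) (h3.const_mul _), dil_sub (hN.fun_mul h1) h2,
      dil_mul hN h1, dil_const_mul h3, dil_norm_sub_sq]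
  rw [twist, h4, sphLap, sphLap, hv.lap_twist hc X hX, hv.dil_twist_twist hb hc X hX,
    hv.dil_twist α X hX]
  ring

/-- The spherical part of `Δ_b (D + α) v`. -/
lemma sphLap_twist (hv : ExtensionSolution b v G) (hc : yCoord c = 0) (α : ℝ) :
    ∀ X ∈ halfSpace n, sphLap b c (twist α c v) X =
      ‖X - c‖ ^ 2 * (Dil c (weightedLaplacian b v) X + (α + 2) * weightedLaplacian b v X) -
        twist α c (twist α c (twist α c v)) X -
      (n + b - 1 - 2 * α) * twist α c (twist α c v) X +
        α * (n + b - 1 - α) * twist α c v X := fun X hX => by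
  have h1 := (hv.flowable_twist (c := c) α).diff X hX
  have h2 : DifferentiableAt ℝ (Dil c (twist α c v)) X :=
    differentiableAt_of_contDiffOn (contDiffOn_dil hv.smooth_twist (m := 2) (by norm_num))
      (by norm_num) hX
  have h3 : twist α c (twist α c (twist α c v)) X = Dil c (Dil c (twist α c v)) X +
      2 * α * Dil c (twist α c v) X + α * α * twist α c v X := by
    have h4 : Dil c (twist α c (twist α c v)) X =
        Dil c (Dil c (twist α c v)) X + α * Dil c (twist α c v) X := by
      rw [show twist α c (twist α c v) = fun X => Dil c (twist α c v) X + α * twist α c v X from rfl,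
        dil_add h2 (h1.const_mul α), dil_const_mul h1]
    rw [twist, h4, twist]; ring
  have h5 : twist α c (twist α c v) X = Dil c (twist α c v) X + α * twist α c v X := rfl
  rw [h3, h5, sphLap, hv.lap_twist hc X hX]; ring

lemma flowable_sphLap (hv : ExtensionSolution b v G) (hb : b < 1) (hc : yCoord c = 0) :
    Flowable c (sphLap b c v) :=
  (((flowable_norm_sub_sq c).mul (hv.flowable_lap hb hc)).sub (hv.flowable_dil_dil hb hc)).sub
    (hv.flowable_dil.const_mul _)

lemma sphereRegular_v (hv : ExtensionSolution b v G) (hb : b < 1) (hc : yCoord c = 0) :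
    SphereRegular b c v :=
  ⟨hv.smooth.of_le (by norm_num), hv.locBdd_v, hv.locBdd_pderiv, hv.locBdd_pderiv_last_div,
    (hv.flowable_sphLap hb hc).adm.bdd⟩

lemma pderiv_twist (hv : ExtensionSolution b v G) (j : Fin (n + 1)) : ∀ X ∈ halfSpace n,
    pderiv j (twist α c v) X = pderiv j (Dil c v) X + α * pderiv j v X := fun X hX => by
  have h := hv.differentiableAt_v X hX
  have h2 : DifferentiableAt ℝ (Dil c v) X := hv.flowable_dil.diff X hX
  unfold twist
  rw [pderiv_add h2 (h.const_mul α), pderiv_const_mul h]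

/-- The bound on the spherical Laplacian of the twist comes from commuting the two operators; it
then follows from the flow bounds on the spherical Laplacian of v. -/
lemma sphereRegular_twist (hv : ExtensionSolution b v G) (hb : b < 1) (hc : yCoord c = 0) (α : ℝ) :
    SphereRegular b c (twist α c v) := by
  refine ⟨hv.smooth_twist.of_le (by norm_num), (hv.flowable_twist α).adm.bdd, fun j =>
    ((hv.locBdd_pderiv_dil j).add ((hv.locBdd_pderiv j).const_mul α)).congr (hv.pderiv_twist j),
    ?_, ((hv.flowable_sphLap hb hc).twist_adm α).bdd.congr
      fun X hX => (hv.twist_sphLap hb hc α X hX).symm⟩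
  refine ((hv.locBdd_pderiv_last_dil_div hc).add
    (hv.locBdd_pderiv_last_div.const_mul α)).congr fun X hX => ?_
  rw [hv.pderiv_twist _ X hX]; ring

/-- The boundary values of `(D + α) v`. -/
def bdryTwist (α : ℝ) (x₀ : EuclideanSpace ℝ (Fin n)) (v : Space n → ℝ)
    (x : EuclideanSpace ℝ (Fin n)) : ℝ :=
  fderivWithin ℝ v (closedHalfSpace n) (bdry x) (bdry x - bdry x₀) + α * v (bdry x)

lemma continuousOn_closedTwist (hv : ExtensionSolution b v G) (α : ℝ) (c : Space n) :
    ContinuousOn (fun X => fderivWithin ℝ v (closedHalfSpace n) X (X - c) + α * v X)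
      (closedHalfSpace n) :=
  ((hv.regular.continuousOn_fderivWithin uniqueDiffOn_closedHalfSpace (by norm_num)).clm_apply
    (by fun_prop)).add (continuousOn_const.mul hv.regular.continuousOn)

lemma continuous_bdryTwist (hv : ExtensionSolution b v G) (α : ℝ)
    (x₀ : EuclideanSpace ℝ (Fin n)) : Continuous (bdryTwist α x₀ v) :=
  (hv.continuousOn_closedTwist α (bdry x₀)).comp_continuous continuous_bdry
    bdry_mem_closedHalfSpace

lemma tendsto_twist (hv : ExtensionSolution b v G) (α : ℝ) (x₀ x : EuclideanSpace ℝ (Fin n)) :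
    Tendsto (twist α (bdry x₀) v) (𝓝[halfSpace n] (bdry x)) (𝓝 (bdryTwist α x₀ v x)) := by
  have h := (hv.continuousOn_closedTwist α (bdry x₀) _ (bdry_mem_closedHalfSpace x)).mono_left
      (nhdsWithin_mono _ halfSpace_subset_closedHalfSpace)
  refine h.congr' ?_
  filter_upwards [self_mem_nhdsWithin] with X hX
  rw [twist, Dil, fderivWithin_of_mem_nhds (closedHalfSpace_mem_nhds hX)]

/-- Green's identity on a half-ball for `Δ_b v` and `(D + α) v`. -/
lemma green_identity (hv : ExtensionSolution b v G) (hb₀ : -1 < b) (hb : b < 1) (hn : 0 < n)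
    (hG : Continuous G) (α : ℝ) (x₀ : EuclideanSpace ℝ (Fin n)) {r : ℝ} (hr : 0 < r) :
    r * (r ^ ((n : ℝ) + 1 + b) * dilInt (ballWeight n b) (bdry x₀)
        (fun X => weightedLaplacian b v X *
          (Dil (bdry x₀) (weightedLaplacian b v) X + (α + 2) * weightedLaplacian b v X)) r -
      ∫ x in Metric.ball x₀ r, bdryTwist α x₀ v x * G x) =
    r ^ ((n : ℝ) + b) * dilInt (sphereWeight n b) (bdry x₀)
      (fun X => weightedLaplacian b v X * Dil (bdry x₀) (twist α (bdry x₀) v) X -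
        twist α (bdry x₀) v X * Dil (bdry x₀) (weightedLaplacian b v) X) r := by
  have hc : yCoord (bdry x₀) = 0 := yCoord_bdry x₀
  set c := bdry x₀
  set w := weightedLaplacian b v with hw
  have hu := hv.sphereRegular_twist hb hc α
  have hwf : Flowable c w := hv.flowable_lap hb hc
  -- Of the two parts of the normal component, the first carries y^{b+1} and dies at the boundary;
  -- the second tends to the boundary twist times the flux G.
  have hlast : ∀ X ∈ halfSpace n, greenField b w (twist α c v) (Fin.last n) X =
      yCoord X ^ (b + 1) * (w X * (pderiv (Fin.last n) (twist α c v) X * yCoord X ^ (-1 : ℝ))) -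
        twist α c v X * (yCoord X ^ b * pderiv (Fin.last n) w X) := by
    intro X hX
    have hy : yCoord X ≠ 0 := ne_of_gt hX
    rw [greenField, Real.rpow_add_one hy, Real.rpow_neg_one]
    field_simp
  have hbd : LocBdd (fun X => w X *
      (pderiv (Fin.last n) (twist α c v) X * yCoord X ^ (-1 : ℝ))) :=
    hv.locBdd_lap.mul hu.bdd_last
  have key := half_ball_divergence (x₀ := x₀) (b := b) (F := greenField b w (twist α c v))
    (d := fun X => w X * (Dil c w X + (α + 2) * w X))
    (e := fun X => w X * Dil c (twist α c v) X - twist α c v X * Dil c w X)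
    (g := fun x => - (bdryTwist α x₀ v x * G x)) hb₀ hn
    (fun j X hX => differentiableAt_greenField hv.smooth_lap hu.smooth j hX)
    (hwf.adm.mul (hwf.dil.add (hwf.adm.const_mul _)))
    ((hwf.adm.mul hu.adm_dil).sub (hu.adm.mul hwf.dil))
    -- Here the equation enters: Δ_b w = 0 removes one half of Green's formula, and commuting Δ_b
    -- with the twist rewrites the other.
    (fun X hX => by
      rw [divergence_greenField hv.smooth_lap hu.smooth hX, hv.lap_twist hc X hX, hw,
        hv.equation X hX, mul_zero, sub_zero])
    (fun X hX => greenField_radial (hwf.diff X hX) (hu.diff X hX))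
    ((((locBdd_rpow (by linarith)).mul hbd).sub (hu.bdd.mul hv.locBdd_flux)).congr hlast)
    ((hv.continuous_bdryTwist α x₀).mul hG).neg
    (fun x => by
      have h1 := (hbd.tendsto_rpow_mul (a := b + 1) (by linarith) x).sub
        ((hv.tendsto_twist α x₀ x).mul (hv.flux x))
      rw [zero_sub] at h1
      refine (h1.comp (tendsto_liftPt x)).congr' ?_
      filter_upwards [self_mem_nhdsWithin] with t ht
      exact (hlast _ (liftPt_mem_halfSpace ht)).symm) hr
  rw [setIntegral_ball_weight_mul hc hr, integral_neg] at key
  exact key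

end ExtensionSolution

/-! ### The energy of one component and its derivative. -/

section ComponentEnergy

variable {n : ℕ} {b α : ℝ} {v : Space n → ℝ} {G : EuclideanSpace ℝ (Fin n) → ℝ}

/-- The scaled pairing `r^{2α} ∫ y^b f g` over the half-sphere of radius `r`, seen on the unit
sphere. -/
def pairing (b α : ℝ) (c : Space n) (f g : Space n → ℝ) (r : ℝ) : ℝ :=
  r ^ (2 * α) * dilInt (sphereWeight n b) c (fun X => f X * g X) r

/-- The contribution of a single component to the energy, without the boundary term. -/
def componentEnergy (b α : ℝ) (c : Space n) (v : Space n → ℝ) (r : ℝ) : ℝ :=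
  1 / 2 * (r ^ (2 * (α + 2)) * dilInt (ballWeight n b) c
      (fun X => weightedLaplacian b v X * weightedLaplacian b v X) r) +
    pairing b α c (twist α c v) (twist α c (twist α c v)) r -
    pairing b α c (twist α c v) (twist α c v) r +
    α * (n + b - 1 - α) * pairing b α c v (twist α c v) r +
    α * (n + b - 1 - α) * pairing b α c v v r -
    pairing b α c v (sphLap b c v) r -
    pairing b α c (twist α c v) (sphLap b c v) r

lemma hasDerivAt_pairing (hb : -1 < b) {c : Space n} (hc : yCoord c = 0) {f g : Space n → ℝ}
    (hf : Flowable c f) (hg : Flowable c g) {r : ℝ} (hr : 0 < r) :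
    HasDerivAt (pairing b α c f g) (r ^ (2 * α - 1) *
      (dilInt (sphereWeight n b) c (fun X => twist α c f X * g X) r +
        dilInt (sphereWeight n b) c (fun X => f X * twist α c g X) r)) r := by
  have := isFiniteMeasure_sphereWeight (n := n) hb
  rw [← Admissible.dilInt_add (onUnitHalfBall_sphereWeight b) hc hr
    ((hf.twist_adm α).mul hg.adm) (hf.adm.mul (hg.twist_adm α))]
  exact hf.hasDerivAt_mul hg (onUnitHalfBall_sphereWeight b) hc α hr

/-- The spherical operator L is symmetric, so L can be moved from v onto the twist of v, and there
it commutes with the twist. -/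
lemma ExtensionSolution.dilInt_twist_mul_sphLap (hv : ExtensionSolution b v G) (hb₀ : -1 < b)
    (hb : b < 1) (hn : 0 < n) (α : ℝ) (x₀ : EuclideanSpace ℝ (Fin n)) {r : ℝ} (hr : 0 < r) :
    dilInt (sphereWeight n b) (bdry x₀)
        (fun X => twist α (bdry x₀) v X * sphLap b (bdry x₀) v X) r =
      dilInt (sphereWeight n b) (bdry x₀)
        (fun X => v X * twist α (bdry x₀) (sphLap b (bdry x₀) v) X) r := by
  have hc : yCoord (bdry x₀) = 0 := yCoord_bdry x₀
  have r0 : SphereRegular b (bdry x₀) v := hv.sphereRegular_v hb hc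
  have r1 : SphereRegular b (bdry x₀) (twist α (bdry x₀) v) := hv.sphereRegular_twist hb hc α
  rw [dilInt_congr (onUnitHalfBall_sphereWeight (n := n) b) hc hr
    (f := fun X => v X * twist α (bdry x₀) (sphLap b (bdry x₀) v) X)
    (g := fun X => v X * sphLap b (bdry x₀) (twist α (bdry x₀) v) X)
    (fun X hX => by rw [hv.twist_sphLap hb hc α X hX])]
  have h1 := r0.dilInt_mul_sphLap hb₀ hn r1 hr
  have h2 := r1.dilInt_mul_sphLap hb₀ hn r0 hr
  rw [show tangForm (bdry x₀) (twist α (bdry x₀) v) v = tangForm (bdry x₀) v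
    (twist α (bdry x₀) v) from funext fun X => tangForm_comm _ _ _ _] at h2
  exact h1.trans h2.symm

/-- The half-sphere form of Green's identity, in terms of the generator of the scaling. -/
lemma ExtensionSolution.sphere_balance (hv : ExtensionSolution b v G) (hb₀ : -1 < b) (hb : b < 1)
    (hn : 0 < n) (α : ℝ) (x₀ : EuclideanSpace ℝ (Fin n)) {r : ℝ} (hr : 0 < r) :
    let c := bdry x₀
    let S := fun q : Space n → ℝ => dilInt (sphereWeight n b) c q r
    let u₁ := twist α c v
    let u₂ := twist α c u₁
    let u₃ := twist α c u₂
    let l := sphLap b c v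
    let A := (n : ℝ) + b - 1 - 2 * α
    let B := α * (n + b - 1 - α)
    r ^ 2 * S (fun X => weightedLaplacian b v X * Dil c u₁ X -
        u₁ X * Dil c (weightedLaplacian b v) X) +
      (S (fun X => u₂ X * u₂ X) + S (fun X => u₁ X * u₃ X)) -
      (S (fun X => u₂ X * u₁ X) + S (fun X => u₁ X * u₂ X)) +
      B * (S (fun X => u₁ X * u₁ X) + S (fun X => v X * u₂ X)) +
      B * (S (fun X => u₁ X * v X) + S (fun X => v X * u₁ X)) -
      (S (fun X => u₁ X * l X) + S (fun X => v X * twist α c l X)) -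
      (S (fun X => u₂ X * l X) + S (fun X => u₁ X * twist α c l X)) =
    2 * S (fun X => u₂ X * u₂ X) + 2 * (A + B) * S (fun X => u₁ X * u₁ X) +
      2 * S (tangForm c u₁ u₁) := by
  intro c S u₁ u₂ u₃ l A B
  have := isFiniteMeasure_sphereWeight (n := n) hb₀
  have hc : yCoord c = 0 := yCoord_bdry x₀
  have hν := onUnitHalfBall_sphereWeight (n := n) b
  have f0 : Flowable c v := hv.flowable_v
  have f1 : Flowable c u₁ := hv.flowable_twist α
  have f2 : Flowable c u₂ := hv.flowable_twist_twist hb hc α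
  have f3 : Admissible u₃ := f2.twist_adm α
  have fl : Flowable c l := hv.flowable_sphLap hb hc
  have fl1 : Admissible (twist α c l) := fl.twist_adm α
  have fw := hv.flowable_lap hb hc
  have r0 : SphereRegular b c v := hv.sphereRegular_v hb hc
  have r1 : SphereRegular b c u₁ := hv.sphereRegular_twist hb hc α
  have hS : ∀ f g : Space n → ℝ, (∀ X ∈ halfSpace n, f X = g X) → S f = S g := fun f g h =>
    dilInt_congr hν hc hr h
  have hSa : ∀ f g : Space n → ℝ, Admissible f → Admissible g →
      S (fun X => f X + g X) = S f + S g := fun f g hf hg => Admissible.dilInt_add hν hc hr hf hg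
  have hSs : ∀ f g : Space n → ℝ, Admissible f → Admissible g →
      S (fun X => f X - g X) = S f - S g := fun f g hf hg => Admissible.dilInt_sub hν hc hr hf hg
  have hSc : ∀ (a : ℝ) (f : Space n → ℝ), S (fun X => a * f X) = a * S f := fun a f =>
    dilInt_const_mul _ _ a f r
  have hl1 : ∀ X ∈ halfSpace n, twist α c l X = sphLap b c u₁ X := hv.twist_sphLap hb hc α
  have e1 : S (fun X => u₁ X * l X) = S (fun X => v X * twist α c l X) :=
    hv.dilInt_twist_mul_sphLap hb₀ hb hn α x₀ hr
  have e2 : S (fun X => u₁ X * twist α c l X) = - S (tangForm c u₁ u₁) := by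
    rw [hS (fun X => u₁ X * twist α c l X) (fun X => u₁ X * sphLap b c u₁ X)
      (fun X hX => by rw [hl1 X hX])]
    exact r1.dilInt_mul_sphLap hb₀ hn r1 hr
  -- On the sphere |X - c| = r, the definitions of L v and L u₁ are solved for r²w and r²Dw, so the
  -- Green integrand becomes quadratic in v, u₁, u₂, u₃, L v and its twist.
  have e3 : r ^ 2 * S (fun X => weightedLaplacian b v X * Dil c u₁ X -
      u₁ X * Dil c (weightedLaplacian b v) X) =
      S (fun X => (((((((l X * u₂ X + 2 * (l X * u₁ X)) + u₂ X * u₂ X) + 2 * (u₁ X * u₂ X)) +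
        (2 * A + B) * (u₁ X * u₁ X)) - B * (v X * u₂ X)) - 2 * B * (v X * u₁ X)) -
        u₁ X * twist α c l X) - u₁ X * u₃ X) := by
    rw [← hSc]
    refine dilInt_sphereWeight_congr hc hr fun X hX hXr => ?_
    have h1 := hv.sphLap_v (c := c) α X hX
    have h2 := hv.sphLap_twist hc α X hX
    rw [← hl1 X hX] at h2
    rw [hXr] at h1 h2
    have h3 : Dil c u₁ X = u₂ X - α * u₁ X := by simp only [u₂, twist]; ring
    have h4 : l X = r ^ 2 * weightedLaplacian b v X - u₂ X - A * u₁ X + B * v X := h1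
    have h5 : twist α c l X = r ^ 2 * (Dil c (weightedLaplacian b v) X +
      (α + 2) * weightedLaplacian b v X) - u₃ X - A * u₂ X + B * u₁ X := h2
    rw [h3]
    have h6 : r ^ 2 * weightedLaplacian b v X = l X + u₂ X + A * u₁ X - B * v X := by
      rw [h4]; ring
    have h7 : r ^ 2 * Dil c (weightedLaplacian b v) X = twist α c l X + u₃ X + A * u₂ X -
        B * u₁ X - (α + 2) * (l X + u₂ X + A * u₁ X - B * v X) := by
      rw [h5, ← h6]; ring
    calc r ^ 2 * (weightedLaplacian b v X * (u₂ X - α * u₁ X) -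
          u₁ X * Dil c (weightedLaplacian b v) X)
        = (r ^ 2 * weightedLaplacian b v X) * (u₂ X - α * u₁ X) -
          u₁ X * (r ^ 2 * Dil c (weightedLaplacian b v) X) := by ring
      _ = _ := by rw [h6, h7]; ring
  have a1 := fl.adm.mul f2.adm
  have a2 := (fl.adm.mul f1.adm).const_mul 2
  have a3 := f2.adm.mul f2.adm
  have a4 := (f1.adm.mul f2.adm).const_mul 2
  have a5 := (f1.adm.mul f1.adm).const_mul (2 * A + B)
  have a6 := (f0.adm.mul f2.adm).const_mul B
  have a7 := (f0.adm.mul f1.adm).const_mul (2 * B)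
  have a8 := f1.adm.mul fl1
  have a9 := f1.adm.mul f3
  have b1 := a1.add a2
  have b2 := b1.add a3
  have b3 := b2.add a4
  have b4 := b3.add a5
  have b5 := b4.sub a6
  have b6 := b5.sub a7
  have b7 := b6.sub a8
  rw [e3, hSs _ _ b7 a9, hSs _ _ b6 a8, hSs _ _ b5 a7, hSs _ _ b4 a6, hSa _ _ b3 a5,
    -- With symmetry of L, all pairings involving u₃ or l without a sign cancel; `e2` turns the last
    -- one into the tangential energy of u₁.
    hSa _ _ b2 a4, hSa _ _ b1 a3, hSa _ _ a1 a2, hSc, hSc, hSc, hSc, hSc, e2, ← e1]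
  have c1 : S (fun X => l X * u₂ X) = S (fun X => u₂ X * l X) := hS _ _ fun X _ => mul_comm _ _
  have c2 : S (fun X => l X * u₁ X) = S (fun X => u₁ X * l X) := hS _ _ fun X _ => mul_comm _ _
  have c3 : S (fun X => u₂ X * u₁ X) = S (fun X => u₁ X * u₂ X) := hS _ _ fun X _ => mul_comm _ _
  have c4 : S (fun X => u₁ X * v X) = S (fun X => v X * u₁ X) := hS _ _ fun X _ => mul_comm _ _
  rw [c1, c2, c3, c4]
  ring

theorem ExtensionSolution.hasDerivAt_componentEnergy (hv : ExtensionSolution b v G)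
    (hb₀ : -1 < b) (hb : b < 1) (hn : 0 < n) (hG : Continuous G) (α : ℝ)
    (x₀ : EuclideanSpace ℝ (Fin n)) {r : ℝ} (hr : 0 < r) :
    HasDerivAt (componentEnergy b α (bdry x₀) v)
      (r ^ (2 * α - 1) *
        (2 * dilInt (sphereWeight n b) (bdry x₀) (fun X => twist α (bdry x₀)
          (twist α (bdry x₀) v) X * twist α (bdry x₀) (twist α (bdry x₀) v) X) r +
        2 * (((n : ℝ) + b - 1 - 2 * α) + α * (n + b - 1 - α)) * dilInt (sphereWeight n b) (bdry x₀)
          (fun X => twist α (bdry x₀) v X * twist α (bdry x₀) v X) r +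
        2 * dilInt (sphereWeight n b) (bdry x₀)
          (tangForm (bdry x₀) (twist α (bdry x₀) v) (twist α (bdry x₀) v)) r) +
        r ^ (2 * α + 2 - n - b) * ∫ x in Metric.ball x₀ r, bdryTwist α x₀ v x * G x) r := by
  have := isFiniteMeasure_ballWeight (n := n) hb₀
  have hc : yCoord (bdry x₀) = 0 := yCoord_bdry x₀
  have hνB := onUnitHalfBall_ballWeight (n := n) b
  have f0 : Flowable (bdry x₀) v := hv.flowable_v
  have f1 : Flowable (bdry x₀) (twist α (bdry x₀) v) := hv.flowable_twist α
  have f2 := hv.flowable_twist_twist hb hc α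
  have fl := hv.flowable_sphLap hb hc
  have fw := hv.flowable_lap hb hc
  -- The Laplacian scales with exponent α + 2, so here the twist is D + α + 2, matching the
  -- commutation formula for Δ_b.
  have hball := fw.hasDerivAt_mul fw hνB hc (α + 2) hr
  have hd := (((((((hball.const_mul (1 / 2)).add (hasDerivAt_pairing (α := α) hb₀ hc f1 f2 hr)).sub
    (hasDerivAt_pairing (α := α) hb₀ hc f1 f1 hr)).add
    ((hasDerivAt_pairing (α := α) hb₀ hc f0 f1 hr).const_mul (α * (n + b - 1 - α)))).add
    ((hasDerivAt_pairing (α := α) hb₀ hc f0 f0 hr).const_mul (α * (n + b - 1 - α)))).sub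
    (hasDerivAt_pairing (α := α) hb₀ hc f0 fl hr)).sub
    (hasDerivAt_pairing (α := α) hb₀ hc f1 fl hr))
  refine hd.congr_deriv ?_
  have hgreen := hv.green_identity hb₀ hb hn hG α x₀ hr
  have hbal := hv.sphere_balance hb₀ hb hn α x₀ hr
  simp only at hbal
  rw [← hbal]
  have hB : dilInt (ballWeight n b) (bdry x₀) (fun X =>
      twist (α + 2) (bdry x₀) (weightedLaplacian b v) X * weightedLaplacian b v X +
        weightedLaplacian b v X * twist (α + 2) (bdry x₀) (weightedLaplacian b v) X) r =
      2 * dilInt (ballWeight n b) (bdry x₀) (fun X => weightedLaplacian b v X *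
        (Dil (bdry x₀) (weightedLaplacian b v) X + (α + 2) * weightedLaplacian b v X)) r := by
    rw [← dilInt_const_mul]
    refine dilInt_congr hνB hc hr fun X _ => ?_
    rw [twist]; ring
  rw [hB]
  -- Green's identity multiplied by r^{2α+1-n-b}, which brings its bulk term to the power occurring
  -- in the derivative of the energy.
  have hkey : r ^ (2 * (α + 2) - 1) * dilInt (ballWeight n b) (bdry x₀)
      (fun X => weightedLaplacian b v X *
        (Dil (bdry x₀) (weightedLaplacian b v) X + (α + 2) * weightedLaplacian b v X)) r =
      r ^ (2 * α - 1) * (r ^ 2 * dilInt (sphereWeight n b) (bdry x₀)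
        (fun X => weightedLaplacian b v X * Dil (bdry x₀) (twist α (bdry x₀) v) X -
          twist α (bdry x₀) v X * Dil (bdry x₀) (weightedLaplacian b v) X) r) +
        r ^ (2 * α + 2 - n - b) * ∫ x in Metric.ball x₀ r, bdryTwist α x₀ v x * G x := by
    have p1 : r ^ (2 * (α + 2) - 1) = r ^ (2 * α + 1 - n - b) * r * r ^ ((n : ℝ) + 1 + b) := by
      rw [← Real.rpow_add_one hr.ne', ← Real.rpow_add hr]; congr 1; ring
    have p2 : r ^ (2 * α - 1) * r ^ 2 = r ^ (2 * α + 1 - n - b) * r ^ ((n : ℝ) + b) := by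
      rw [← Real.rpow_natCast, ← Real.rpow_add hr, ← Real.rpow_add hr]; congr 1; push_cast; ring
    have p3 : r ^ (2 * α + 2 - n - b) = r ^ (2 * α + 1 - n - b) * r := by
      rw [← Real.rpow_add_one hr.ne']; congr 1; ring
    rw [← mul_assoc (r ^ (2 * α - 1)), p1, p2, p3, mul_assoc _ (r ^ ((n : ℝ) + b)), ← hgreen]
    ring
  linear_combination hkey

end ComponentEnergy

/-! ### The boundary term of the energy and its derivative. -/

section BoundaryEnergy

variable {n : ℕ}

lemma setIntegral_ball_eq_dilation (x₀ : EuclideanSpace ℝ (Fin n)) {r : ℝ} (hr : 0 < r)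
    (φ : EuclideanSpace ℝ (Fin n) → ℝ) :
    ∫ x in Metric.ball x₀ r, φ x = r ^ n * ∫ z in Metric.ball 0 1, φ (x₀ + r • z) := by
  have h0 : ∀ z : EuclideanSpace ℝ (Fin n), x₀ + r • z ∈ Metric.ball x₀ r ↔
      z ∈ Metric.ball 0 1 := by
    intro z; simp [norm_smul, abs_of_pos hr, hr]
  have h1 := Measure.integral_comp_smul_of_nonneg (volume : Measure (EuclideanSpace ℝ (Fin n)))
    (fun x => (Metric.ball x₀ r).indicator φ (x₀ + x)) r (hR := hr.le)
  rw [integral_add_left_eq_self (f := (Metric.ball x₀ r).indicator φ),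
    integral_indicator measurableSet_ball, smul_eq_mul, finrank_euclideanSpace_fin] at h1
  have h2 : ∫ x in Metric.ball x₀ r, φ x = r ^ n *
      ∫ z, (Metric.ball x₀ r).indicator φ (x₀ + r • z) := by
    rw [h1, ← mul_assoc, mul_inv_cancel₀ (by positivity), one_mul]
  rw [h2, ← integral_indicator measurableSet_ball]
  congr 2
  ext z
  by_cases hz : z ∈ Metric.ball (0 : EuclideanSpace ℝ (Fin n)) 1
  · rw [indicator_of_mem ((h0 z).2 hz), indicator_of_mem hz]
  · rw [indicator_of_notMem fun h => hz ((h0 z).1 h), indicator_of_notMem hz]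

/-- Dilating to the unit ball produces r^n, whence a + n in the derivative. The function ψ is the
derivative of φ along dilations about x₀. -/
lemma hasDerivAt_rpow_mul_ball_integral (x₀ : EuclideanSpace ℝ (Fin n))
    {φ ψ : EuclideanSpace ℝ (Fin n) → ℝ} (hφ : Continuous φ) (hψ : Continuous ψ)
    (hd : ∀ z, ∀ r : ℝ, 0 < r → HasDerivAt (fun r : ℝ => φ (x₀ + r • z)) (r⁻¹ * ψ (x₀ + r • z)) r)
    (a : ℝ) {r : ℝ} (hr : 0 < r) :
    HasDerivAt (fun r => r ^ a * ∫ x in Metric.ball x₀ r, φ x)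
      (r ^ (a - 1) * ∫ x in Metric.ball x₀ r, ((a + n) * φ x + ψ x)) r := by
  have hnhds : Icc (r / 2) (r + 1) ∈ 𝓝 r := Icc_mem_nhds (half_lt_self hr) (lt_add_one r)
  have hpos : ∀ t ∈ Icc (r / 2) (r + 1), 0 < t := fun t ht => (half_pos hr).trans_le ht.1
  obtain ⟨M, hM⟩ := ((isCompact_Icc (a := r / 2) (b := r + 1)).prod
    (isCompact_closedBall (0 : EuclideanSpace ℝ (Fin n)) 1)).exists_bound_of_continuousOn
    (f := fun q : ℝ × EuclideanSpace ℝ (Fin n) => q.1⁻¹ * ψ (x₀ + q.1 • q.2)) (by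
      refine ContinuousOn.mul (continuousOn_fst.inv₀ fun q hq => (hpos _ hq.1).ne') ?_
      exact Continuous.continuousOn (by fun_prop))
  have hcball : ∀ g : EuclideanSpace ℝ (Fin n) → ℝ, Continuous g → ∀ (x : EuclideanSpace ℝ (Fin n)) s,
      IntegrableOn g (Metric.ball x s) := fun g hg x s =>
    (hg.continuousOn.integrableOn_compact (isCompact_closedBall x s)).mono_set
      Metric.ball_subset_closedBall
  have key := (hasDerivAt_integral_of_dominated_loc_of_deriv_le
    (μ := volume.restrict (Metric.ball (0 : EuclideanSpace ℝ (Fin n)) 1))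
    (F := fun t z => φ (x₀ + t • z)) (F' := fun t z => t⁻¹ * ψ (x₀ + t • z))
    (bound := fun _ => M) (x₀ := r) hnhds
    (Eventually.of_forall fun t => (by fun_prop : Continuous fun z : EuclideanSpace ℝ (Fin n) =>
      φ (x₀ + t • z)).aestronglyMeasurable)
    (hcball _ (by fun_prop) _ _)
    ((by fun_prop : Continuous fun z : EuclideanSpace ℝ (Fin n) =>
      r⁻¹ * ψ (x₀ + r • z)).aestronglyMeasurable)
    ((ae_restrict_mem measurableSet_ball).mono fun z hz t ht =>
      hM (t, z) ⟨ht, Metric.ball_subset_closedBall hz⟩)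
    (integrableOn_const measure_ball_lt_top.ne)
    (Eventually.of_forall fun z t ht => hd z t (hpos t ht))).2
  have h1 := (Real.hasDerivAt_rpow_const (p := a + n) (Or.inl hr.ne')).mul key
  have hpow : ∀ t : ℝ, 0 < t → t ^ a * ∫ x in Metric.ball x₀ t, φ x =
      t ^ (a + n) * ∫ z in Metric.ball 0 1, φ (x₀ + t • z) := by
    intro t ht
    rw [setIntegral_ball_eq_dilation x₀ ht, ← mul_assoc, ← Real.rpow_natCast, ← Real.rpow_add ht]
  refine (h1.congr_of_eventuallyEq ?_).congr_deriv ?_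
  · filter_upwards [Ioi_mem_nhds hr] with t ht using hpow t ht
  · rw [setIntegral_ball_eq_dilation x₀ hr, integral_add (hcball _ (by fun_prop) _ _)
      (hcball _ (by fun_prop) _ _), integral_const_mul, integral_const_mul]
    have p1 : r ^ (a - 1) * r ^ n = r ^ (a + n - 1) := by
      rw [← Real.rpow_natCast, ← Real.rpow_add hr]; congr 1; ring
    have p2 : r ^ (a + n) = r ^ (a + n - 1) * r := by
      rw [← Real.rpow_add_one hr.ne', sub_add_cancel]
    rw [← mul_assoc (r ^ (a - 1)), p1, p2]
    field_simp

lemma bdry_add_smul (x₀ z : EuclideanSpace ℝ (Fin n)) (r : ℝ) :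
    bdry (x₀ + r • z) = bdry x₀ + r • bdry z := by
  rw [← liftPt_zero, ← liftPt_zero, ← liftPt_zero]
  ext j
  refine Fin.lastCases ?_ (fun i => ?_) j <;> simp

/-- The values of f below the boundary are arbitrary, so only a derivative within the closed
half-space is available; it suffices because the path stays in the boundary. -/
lemma hasDerivAt_comp_bdry {f : Space n → ℝ} (hf : DifferentiableOn ℝ f (closedHalfSpace n))
    (x₀ z : EuclideanSpace ℝ (Fin n)) {r : ℝ} (hr : 0 < r) :
    HasDerivAt (fun r : ℝ => f (bdry (x₀ + r • z)))
      (r⁻¹ * fderivWithin ℝ f (closedHalfSpace n) (bdry (x₀ + r • z))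
        (bdry (x₀ + r • z) - bdry x₀)) r := by
  have hd : HasFDerivWithinAt f (fderivWithin ℝ f (closedHalfSpace n) (bdry (x₀ + r • z)))
      (closedHalfSpace n) (bdry (x₀ + r • z)) :=
    (hf _ (bdry_mem_closedHalfSpace _)).hasFDerivWithinAt
  have hl : HasDerivAt (fun t : ℝ => bdry (x₀ + t • z)) (bdry z) r := by
    simp only [bdry_add_smul]
    simpa using ((hasDerivAt_id r).smul_const (bdry z)).const_add (bdry x₀)
  have h := hd.comp_hasDerivAt r hl (Eventually.of_forall fun t => bdry_mem_closedHalfSpace _)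
  refine h.congr_deriv ?_
  have : bdry (x₀ + r • z) - bdry x₀ = r • bdry z := by rw [bdry_add_smul, add_sub_cancel_left]
  rw [this, map_smul, smul_eq_mul, inv_mul_cancel_left₀ hr.ne']

variable {m : ℕ}

/-- The length is not differentiable where v vanishes, but its square is a sum of squares; for p > 1
the power (p+1)/2 of that sum is differentiable even at zeros. -/
lemma vecNorm_rpow (v : Fin m → Space n → ℝ) (X : Space n) (a : ℝ) :
    vecNorm v X ^ a = (∑ i, v i X ^ 2) ^ (a / 2) := by
  rw [vecNorm, Real.sqrt_eq_rpow, ← Real.rpow_mul (Finset.sum_nonneg fun i _ => sq_nonneg _)]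
  congr 1; ring

lemma continuous_comp_bdry {f : Space n → ℝ} (hf : ContinuousOn f (closedHalfSpace n)) :
    Continuous fun x => f (bdry x) :=
  hf.comp_continuous continuous_bdry bdry_mem_closedHalfSpace

lemma continuous_vecNorm_bdry_rpow {v : Fin m → Space n → ℝ}
    (hv : ∀ i, ContinuousOn (v i) (closedHalfSpace n)) {a : ℝ} (ha : 0 ≤ a) :
    Continuous fun x => vecNorm v (bdry x) ^ a := by
  simp only [vecNorm_rpow]
  exact (continuous_finsetSum _ fun i _ => (continuous_comp_bdry (hv i)).pow 2).rpow_const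
    fun _ => Or.inr (by linarith)

/-- The derivative in the radius of the boundary term of the energy. -/
lemma hasDerivAt_boundaryEnergy {v : Fin m → Space n → ℝ} {p α a : ℝ} (hp : 1 < p)
    (hv : ∀ i, ContDiffOn ℝ 2 (v i) (closedHalfSpace n)) (ha : a + n = (p + 1) * α)
    (x₀ : EuclideanSpace ℝ (Fin n)) {r : ℝ} (hr : 0 < r) :
    HasDerivAt (fun r => r ^ a * ∫ x in Metric.ball x₀ r, vecNorm v (bdry x) ^ (p + 1))
      ((p + 1) * (r ^ (a - 1) * ∫ x in Metric.ball x₀ r, vecNorm v (bdry x) ^ (p - 1) *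
        ∑ i, v i (bdry x) * ExtensionSolution.bdryTwist α x₀ (v i) x)) r := by
  have hcv : ∀ i, Continuous fun x => v i (bdry x) := fun i =>
    continuous_comp_bdry (hv i).continuousOn
  have hcd : ∀ i, Continuous fun x => fderivWithin ℝ (v i) (closedHalfSpace n) (bdry x)
      (bdry x - bdry x₀) := fun i =>
    continuous_comp_bdry (f := fun X => fderivWithin ℝ (v i) (closedHalfSpace n) X (X - bdry x₀))
      (((hv i).continuousOn_fderivWithin uniqueDiffOn_closedHalfSpace (by norm_num)).clm_apply
        (by fun_prop))
  have hcn : ∀ a : ℝ, 0 ≤ a → Continuous fun x => vecNorm v (bdry x) ^ a := fun a ha =>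
    continuous_vecNorm_bdry_rpow (fun i => (hv i).continuousOn) ha
  have key := hasDerivAt_rpow_mul_ball_integral x₀ (φ := fun x => vecNorm v (bdry x) ^ (p + 1))
    (ψ := fun x => (p + 1) * (vecNorm v (bdry x) ^ (p - 1) * ∑ i, v i (bdry x) *
      fderivWithin ℝ (v i) (closedHalfSpace n) (bdry x) (bdry x - bdry x₀)))
    (hcn _ (by linarith))
    (continuous_const.mul ((hcn _ (by linarith)).mul
      (continuous_finsetSum _ fun i _ => (hcv i).mul (hcd i))))
    (fun z t ht => by
      simp only [vecNorm_rpow]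
      have h1 : HasDerivAt (fun t : ℝ => ∑ i, v i (bdry (x₀ + t • z)) ^ 2)
          (∑ i, 2 * v i (bdry (x₀ + t • z)) * (t⁻¹ * fderivWithin ℝ (v i) (closedHalfSpace n)
            (bdry (x₀ + t • z)) (bdry (x₀ + t • z) - bdry x₀))) t := by
        refine HasDerivAt.fun_sum fun i _ => ?_
        exact ((hasDerivAt_comp_bdry ((hv i).differentiableOn (by norm_num)) x₀ z ht).fun_pow
          2).congr_deriv (by norm_num)
      refine (h1.rpow_const (p := (p + 1) / 2) (Or.inr (by linarith))).congr_deriv ?_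
      rw [show (p + 1) / 2 - 1 = (p - 1) / 2 by ring, Finset.sum_mul, Finset.sum_mul,
        Finset.mul_sum, Finset.mul_sum, Finset.mul_sum]
      exact Finset.sum_congr rfl fun i _ => by ring) a hr
  refine key.congr_deriv ?_
  rw [mul_left_comm, ← integral_const_mul (p + 1)]
  congr 1
  refine integral_congr_ae (Eventually.of_forall fun x => ?_)
  beta_reduce
  have h2 : vecNorm v (bdry x) ^ (p + 1) = vecNorm v (bdry x) ^ (p - 1) * ∑ i, v i (bdry x) ^ 2 := by
    have h0 : 0 ≤ vecNorm v (bdry x) := Real.sqrt_nonneg _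
    rw [show p + 1 = (p - 1) + (2 : ℕ) by push_cast; ring, Real.rpow_add_natCast' h0 (by
      push_cast; linarith), vecNorm, Real.sq_sqrt (Finset.sum_nonneg fun i _ => sq_nonneg _)]
  -- The relation a + n = (p+1)α is what combines the undifferentiated |v|^{p+1} with the dilation
  -- derivative into D + α.
  rw [h2, ha]
  simp only [ExtensionSolution.bdryTwist, mul_add, Finset.sum_add_distrib]
  have h3 : ∑ i, v i (bdry x) * (α * v i (bdry x)) = α * ∑ i, v i (bdry x) ^ 2 := by
    rw [Finset.mul_sum]; exact Finset.sum_congr rfl fun i _ => by ring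
  rw [h3]; ring

end BoundaryEnergy

/-! ### The energy densities in terms of dilations. -/

section Densities

variable {n m : ℕ}

lemma ae_surfaceMeasure_norm (c : Space n) {r : ℝ} (hr : 0 < r) :
    ∀ᵐ X ∂surfaceMeasure c r, ‖X - c‖ = r := by
  refine Measure.ae_smul_measure ?_ _
  have hm : Measurable fun ω : Metric.sphere (0 : Space n) 1 => c + r • (ω : Space n) := by
    fun_prop
  rw [ae_map_iff hm.aemeasurable (measurableSet_eq_fun (by fun_prop) measurable_const)]
  refine Eventually.of_forall fun ω => ?_
  rw [add_sub_cancel_left, norm_smul, norm_eq_of_mem_sphere ω, mul_one, Real.norm_of_nonneg hr.le]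

lemma Admissible.dilInt_sum {ν : Measure (Space n)} [IsFiniteMeasure ν] {c : Space n}
    (hν : OnUnitHalfBall ν) (hc : yCoord c = 0) {r : ℝ} (hr : 0 < r) {q : Fin m → Space n → ℝ}
    (hq : ∀ i, Admissible (q i)) :
    dilInt ν c (fun X => ∑ i, q i X) r = ∑ i, dilInt ν c (q i) r :=
  integral_finsetSum _ fun i _ => (hq i).integrable_dil hν hc hr

/-- Integrability and scaling form of a density that is a sum of admissible terms on the
half-sphere of radius `r`. -/
lemma halfSphere_of_eq {b : ℝ} (hb : -1 < b) {q : Fin m → Space n → ℝ}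
    (hq : ∀ i, Admissible (q i)) (x₀ : EuclideanSpace ℝ (Fin n)) {r : ℝ} (hr : 0 < r) (a : ℝ)
    {F : Space n → ℝ} (h : ∀ X ∈ halfSpace n, ‖X - bdry x₀‖ = r →
      F X = yCoord X ^ b * (a * ∑ i, q i X)) :
    IntegrableOn F (halfSpace n) (surfaceMeasure (bdry x₀) r) ∧
      halfSphereIntegral x₀ r F = r ^ ((n : ℝ) + b) *
        (a * ∑ i, dilInt (sphereWeight n b) (bdry x₀) (q i) r) := by
  have := isFiniteMeasure_sphereWeight (n := n) hb
  have hae : F =ᵐ[(surfaceMeasure (bdry x₀) r).restrict (halfSpace n)]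
      fun X => yCoord X ^ b * (a * ∑ i, q i X) := by
    filter_upwards [ae_restrict_mem isOpen_halfSpace.measurableSet,
      ae_restrict_of_ae (ae_surfaceMeasure_norm (bdry x₀) hr)] with X h1 h2 using h X h1 h2
  have hs : Admissible fun X => ∑ i, q i X := admissible_sum _ fun i _ => hq i
  refine ⟨((hs.const_mul a).integrableOn_surfaceMeasure hb x₀ hr).congr hae.symm, ?_⟩
  rw [halfSphereIntegral, integral_congr_ae hae, ← halfSphereIntegral,
    halfSphereIntegral_weight_mul x₀ hr, dilInt_const_mul,
    Admissible.dilInt_sum (onUnitHalfBall_sphereWeight b) (yCoord_bdry x₀) hr hq]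

lemma radialDeriv_eq {c : Space n} {f : Space n → ℝ} {X : Space n} (h : DifferentiableAt ℝ f X) :
    radialDeriv c f X = ‖X - c‖⁻¹ * Dil c f X := by
  rw [radialDeriv, h.lineDeriv_eq_fderiv, map_smul, smul_eq_mul, Dil]

lemma vecNorm_sq (v : Fin m → Space n → ℝ) (X : Space n) : vecNorm v X ^ 2 = ∑ i, v i X * v i X := by
  rw [vecNorm, Real.sq_sqrt (Finset.sum_nonneg fun i _ => sq_nonneg _)]
  exact Finset.sum_congr rfl fun i _ => sq _

lemma massDensity_eq (s : ℝ) (v : Fin m → Space n → ℝ) (X : Space n) :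
    massDensity s v X = yCoord X ^ (3 - 2 * s) * (1 * ∑ i, v i X * v i X) := by
  rw [massDensity, vecNorm_sq, one_mul]

/-- Because ∂_r is r⁻¹D, the homogeneity defect is r⁻¹ times the twist with exponent 2s/(p-1). -/
lemma homogeneityDensity_eq (s p : ℝ) {v : Fin m → Space n → ℝ} {x₀ : EuclideanSpace ℝ (Fin n)}
    {X : Space n} (h : ∀ i, DifferentiableAt ℝ (v i) X) :
    homogeneityDensity s p v x₀ X = yCoord X ^ (3 - 2 * s) * ((‖X - bdry x₀‖ ^ 2)⁻¹ *
      ∑ i, twist (2 * s / (p - 1)) (bdry x₀) (v i) X *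
        twist (2 * s / (p - 1)) (bdry x₀) (v i) X) := by
  rw [homogeneityDensity]
  congr 1
  rw [Finset.mul_sum]
  refine Finset.sum_congr rfl fun i _ => ?_
  rw [radialDeriv_eq (h i), twist, ← inv_pow]
  ring

lemma tangentialDensity_eq (s : ℝ) {v : Fin m → Space n → ℝ} {x₀ : EuclideanSpace ℝ (Fin n)}
    {X : Space n} (h : ∀ i, DifferentiableAt ℝ (v i) X) (hX : ‖X - bdry x₀‖ ≠ 0) :
    tangentialDensity s v x₀ X = yCoord X ^ (3 - 2 * s) * ((‖X - bdry x₀‖ ^ 2)⁻¹ *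
      ∑ i, tangForm (bdry x₀) (v i) (v i) X) := by
  rw [tangentialDensity]
  congr 1
  rw [Finset.mul_sum]
  refine Finset.sum_congr rfl fun i _ => ?_
  rw [radialDeriv_eq (h i), tangForm, gradSq]
  simp only [← sq]
  field_simp

end Densities

/-! ### Scaled pairings on the half-sphere. -/

section Pairing

variable {n : ℕ} {b α : ℝ} {c : Space n} {f g : Space n → ℝ}

lemma pairing_comm (b α : ℝ) (c : Space n) (f g : Space n → ℝ) (r : ℝ) :
    pairing b α c f g r = pairing b α c g f r := by
  simp only [pairing, mul_comm (f _)]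

/-- The derivative is again expressed through pairings, so the brackets of the energy can be
differentiated without tracking powers of r. -/
lemma hasDerivAt_pairing_inv_mul (hb : -1 < b) (hc : yCoord c = 0) (hf : Flowable c f)
    (hg : Flowable c g) {r : ℝ} (hr : 0 < r) :
    HasDerivAt (pairing b α c f g)
      (r⁻¹ * (pairing b α c (twist α c f) g r + pairing b α c f (twist α c g) r)) r := by
  refine (hasDerivAt_pairing hb hc hf hg hr).congr_deriv ?_
  rw [pairing, pairing, ← mul_add, Real.rpow_sub_one hr.ne']
  ring

end Pairing

/-! ### The full system: rewriting the energy, its derivative, and positivity. -/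

section System

variable {n m : ℕ} {s p κ : ℝ} {v : Fin m → Space n → ℝ}

lemma IsClassicalSolution.extensionSolution (hv : IsClassicalSolution s p κ v) (i : Fin m) :
    ExtensionSolution (3 - 2 * s) (v i)
      (fun x => κ * vecNorm v (bdry x) ^ (p - 1) * v i (bdry x)) :=
  ⟨hv.smooth i, hv.regular i, hv.regular_tangential i, hv.regular_laplacian i, hv.equation i,
    hv.neumann i, hv.flux i⟩

lemma IsClassicalSolution.continuous_flux (hv : IsClassicalSolution s p κ v) (hp : 1 < p)
    (i : Fin m) : Continuous fun x => κ * vecNorm v (bdry x) ^ (p - 1) * v i (bdry x) :=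
  (continuous_const.mul (continuous_vecNorm_bdry_rpow (fun i => (hv.regular i).continuousOn)
    (by linarith))).mul (continuous_comp_bdry (hv.regular i).continuousOn)

lemma IsClassicalSolution.mass_halfSphere (hv : IsClassicalSolution s p κ v) (hs₂ : s < 2)
    (x₀ : EuclideanSpace ℝ (Fin n)) {r : ℝ} (hr : 0 < r) :
    IntegrableOn (massDensity s v) (halfSpace n) (surfaceMeasure (bdry x₀) r) ∧
      halfSphereIntegral x₀ r (massDensity s v) = r ^ ((n : ℝ) + (3 - 2 * s)) * (1 * ∑ i,
        dilInt (sphereWeight n (3 - 2 * s)) (bdry x₀) (fun X => v i X * v i X) r) :=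
  halfSphere_of_eq (by linarith) (fun i =>
    (hv.extensionSolution i).adm_v.mul (hv.extensionSolution i).adm_v) x₀ hr 1
    fun X _ _ => massDensity_eq s v X

lemma IsClassicalSolution.homogeneity_halfSphere (hv : IsClassicalSolution s p κ v) (hs₂ : s < 2)
    (x₀ : EuclideanSpace ℝ (Fin n)) {r : ℝ} (hr : 0 < r) :
    IntegrableOn (homogeneityDensity s p v x₀) (halfSpace n) (surfaceMeasure (bdry x₀) r) ∧
      halfSphereIntegral x₀ r (homogeneityDensity s p v x₀) = r ^ ((n : ℝ) + (3 - 2 * s)) *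
        ((r ^ 2)⁻¹ * ∑ i, dilInt (sphereWeight n (3 - 2 * s)) (bdry x₀)
          (fun X => twist (2 * s / (p - 1)) (bdry x₀) (v i) X *
            twist (2 * s / (p - 1)) (bdry x₀) (v i) X) r) :=
  halfSphere_of_eq (by linarith) (fun i =>
    ((hv.extensionSolution i).flowable_twist _).adm.mul
      ((hv.extensionSolution i).flowable_twist _).adm) x₀ hr _ fun X hX hXr => by
    rw [homogeneityDensity_eq s p fun i => (hv.extensionSolution i).differentiableAt_v X hX, hXr]

lemma IsClassicalSolution.tangential_halfSphere (hv : IsClassicalSolution s p κ v) (hs₁ : 1 < s)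
    (hs₂ : s < 2) (x₀ : EuclideanSpace ℝ (Fin n)) {r : ℝ} (hr : 0 < r) :
    IntegrableOn (tangentialDensity s v x₀) (halfSpace n) (surfaceMeasure (bdry x₀) r) ∧
      halfSphereIntegral x₀ r (tangentialDensity s v x₀) = r ^ ((n : ℝ) + (3 - 2 * s)) *
        ((r ^ 2)⁻¹ * ∑ i, dilInt (sphereWeight n (3 - 2 * s)) (bdry x₀)
          (tangForm (bdry x₀) (v i) (v i)) r) :=
  halfSphere_of_eq (by linarith) (fun i =>
    ((hv.extensionSolution i).sphereRegular_v (by linarith) (yCoord_bdry x₀)).adm_tangForm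
      ((hv.extensionSolution i).sphereRegular_v (by linarith) (yCoord_bdry x₀))) x₀ hr _
    fun X hX hXr => by
    rw [tangentialDensity_eq s (fun i => (hv.extensionSolution i).differentiableAt_v X hX)
      (hXr ▸ hr.ne'), hXr]

lemma IsClassicalSolution.massBracket_eq (hv : IsClassicalSolution s p κ v) (hs₂ : s < 2)
    (x₀ : EuclideanSpace ℝ (Fin n)) {r : ℝ} (hr : 0 < r) :
    massBracket s p v x₀ r =
      r * ∑ i, pairing (3 - 2 * s) (2 * s / (p - 1)) (bdry x₀) (v i) (v i) r := by
  rw [massBracket, (hv.mass_halfSphere hs₂ x₀ hr).2]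
  simp only [pairing]
  rw [← Finset.mul_sum, ← mul_assoc, ← mul_assoc, ← Real.rpow_add hr, mul_one,
    ← mul_assoc]
  congr 1
  rw [mul_comm r, ← Real.rpow_add_one hr.ne']
  congr 1; ring

lemma IsClassicalSolution.homogeneityBracket_eq (hv : IsClassicalSolution s p κ v) (hs₂ : s < 2)
    (x₀ : EuclideanSpace ℝ (Fin n)) {r : ℝ} (hr : 0 < r) :
    homogeneityBracket s p v x₀ r = (r ^ 2)⁻¹ *
      ∑ i, pairing (3 - 2 * s) (2 * s / (p - 1)) (bdry x₀)
        (twist (2 * s / (p - 1)) (bdry x₀) (v i)) (twist (2 * s / (p - 1)) (bdry x₀) (v i)) r := by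
  rw [homogeneityBracket, (hv.homogeneity_halfSphere hs₂ x₀ hr).2]
  simp only [pairing]
  rw [← Finset.mul_sum, ← mul_assoc, ← Real.rpow_add hr, mul_left_comm]
  congr 3; ring

/-- Integration by parts on the half-sphere replaces the gradient density by a pairing of v with its
spherical Laplacian, to which the differentiation rule for pairings applies. -/
lemma IsClassicalSolution.tangentialBracket_eq (hv : IsClassicalSolution s p κ v) (hs₁ : 1 < s)
    (hs₂ : s < 2) (hn : 0 < n) (hp : p ≠ 1) (x₀ : EuclideanSpace ℝ (Fin n)) {r : ℝ} (hr : 0 < r) :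
    tangentialBracket s p v x₀ r = - (r * ∑ i, pairing (3 - 2 * s) (2 * s / (p - 1)) (bdry x₀)
      (v i) (sphLap (3 - 2 * s) (bdry x₀) (v i)) r) := by
  have hsp : ∀ i, dilInt (sphereWeight n (3 - 2 * s)) (bdry x₀)
      (tangForm (bdry x₀) (v i) (v i)) r = - dilInt (sphereWeight n (3 - 2 * s)) (bdry x₀)
        (fun X => v i X * sphLap (3 - 2 * s) (bdry x₀) (v i) X) r := fun i => by
    have h0 := (hv.extensionSolution i).sphereRegular_v (by linarith) (yCoord_bdry x₀)
    rw [h0.dilInt_mul_sphLap (by linarith) hn h0 hr, neg_neg]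
  rw [tangentialBracket, (hv.tangential_halfSphere hs₁ hs₂ x₀ hr).2]
  simp only [pairing, hsp]
  rw [← Finset.mul_sum, Finset.sum_neg_distrib, ← mul_assoc, ← Real.rpow_add hr, ← mul_assoc,
    mul_neg, ← mul_assoc, neg_inj]
  congr 1
  have hp' : p - 1 ≠ 0 := sub_ne_zero.2 hp
  rw [← Real.rpow_natCast, ← Real.rpow_neg hr.le, ← Real.rpow_add hr, mul_comm r,
    ← Real.rpow_add_one hr.ne']
  congr 1
  field_simp
  push_cast
  ring

lemma IsClassicalSolution.hasDerivAt_massBracket (hv : IsClassicalSolution s p κ v) (hs₂ : s < 2)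
    (x₀ : EuclideanSpace ℝ (Fin n)) {r : ℝ} (hr : 0 < r) :
    HasDerivAt (massBracket s p v x₀)
      (∑ i, (pairing (3 - 2 * s) (2 * s / (p - 1)) (bdry x₀) (v i) (v i) r +
        2 * pairing (3 - 2 * s) (2 * s / (p - 1)) (bdry x₀) (v i)
          (twist (2 * s / (p - 1)) (bdry x₀) (v i)) r)) r := by
  have h := (hasDerivAt_id r).mul (HasDerivAt.fun_sum fun i (_ : i ∈ Finset.univ) =>
    hasDerivAt_pairing_inv_mul (α := 2 * s / (p - 1)) (by linarith : -1 < 3 - 2 * s)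
      (yCoord_bdry x₀) (hv.extensionSolution i).flowable_v (hv.extensionSolution i).flowable_v hr)
  refine (h.congr_of_eventuallyEq ?_).congr_deriv ?_
  · filter_upwards [Ioi_mem_nhds hr] with t ht using hv.massBracket_eq hs₂ x₀ ht
  · rw [Finset.sum_add_distrib, ← Finset.mul_sum, id, mul_inv_cancel_left₀ hr.ne', one_mul]
    congr 1
    refine Finset.sum_congr rfl fun i _ => ?_
    rw [pairing_comm _ _ _ (twist _ _ _)]; ring

lemma IsClassicalSolution.hasDerivAt_homogeneityBracket (hv : IsClassicalSolution s p κ v)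
    (hs₂ : s < 2) (x₀ : EuclideanSpace ℝ (Fin n)) {r : ℝ} (hr : 0 < r) :
    HasDerivAt (homogeneityBracket s p v x₀)
      ((r ^ 3)⁻¹ * ∑ i, (2 * pairing (3 - 2 * s) (2 * s / (p - 1)) (bdry x₀)
          (twist (2 * s / (p - 1)) (bdry x₀) (v i))
          (twist (2 * s / (p - 1)) (bdry x₀) (twist (2 * s / (p - 1)) (bdry x₀) (v i))) r -
        2 * pairing (3 - 2 * s) (2 * s / (p - 1)) (bdry x₀)
          (twist (2 * s / (p - 1)) (bdry x₀) (v i))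
          (twist (2 * s / (p - 1)) (bdry x₀) (v i)) r)) r := by
  have h := ((hasDerivAt_pow 2 r).fun_inv (by positivity)).mul
    (HasDerivAt.fun_sum fun i (_ : i ∈ Finset.univ) =>
    hasDerivAt_pairing_inv_mul (α := 2 * s / (p - 1)) (by linarith : -1 < 3 - 2 * s)
      (yCoord_bdry x₀) ((hv.extensionSolution i).flowable_twist (2 * s / (p - 1)))
      ((hv.extensionSolution i).flowable_twist (2 * s / (p - 1))) hr)
  refine (h.congr_of_eventuallyEq ?_).congr_deriv ?_
  · filter_upwards [Ioi_mem_nhds hr] with t ht using hv.homogeneityBracket_eq hs₂ x₀ ht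
  · rw [← Finset.mul_sum, Finset.sum_sub_distrib, ← Finset.mul_sum, ← Finset.mul_sum,
      Finset.sum_add_distrib]
    simp only [pairing_comm _ _ _ (twist _ _ (twist _ _ _))]
    field_simp
    push_cast
    ring

lemma IsClassicalSolution.hasDerivAt_tangentialBracket (hv : IsClassicalSolution s p κ v)
    (hs₁ : 1 < s) (hs₂ : s < 2) (hn : 0 < n) (hp : p ≠ 1) (x₀ : EuclideanSpace ℝ (Fin n)) {r : ℝ}
    (hr : 0 < r) :
    HasDerivAt (tangentialBracket s p v x₀)
      (- ∑ i, (pairing (3 - 2 * s) (2 * s / (p - 1)) (bdry x₀) (v i)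
          (sphLap (3 - 2 * s) (bdry x₀) (v i)) r +
        2 * pairing (3 - 2 * s) (2 * s / (p - 1)) (bdry x₀)
          (twist (2 * s / (p - 1)) (bdry x₀) (v i)) (sphLap (3 - 2 * s) (bdry x₀) (v i)) r)) r := by
  have h := ((hasDerivAt_id r).mul (HasDerivAt.fun_sum fun i (_ : i ∈ Finset.univ) =>
    hasDerivAt_pairing_inv_mul (α := 2 * s / (p - 1)) (by linarith : -1 < 3 - 2 * s)
      (yCoord_bdry x₀) (hv.extensionSolution i).flowable_v
      ((hv.extensionSolution i).flowable_sphLap (by linarith) (yCoord_bdry x₀)) hr)).neg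
  refine (h.congr_of_eventuallyEq ?_).congr_deriv ?_
  · filter_upwards [Ioi_mem_nhds hr] with t ht using hv.tangentialBracket_eq hs₁ hs₂ hn hp x₀ ht
  · rw [Finset.sum_add_distrib, ← Finset.mul_sum, id, mul_inv_cancel_left₀ hr.ne', one_mul]
    congr 2
    refine Finset.sum_congr rfl fun i _ => ?_
    -- Symmetry and commutation of the spherical Laplacian make the two halves of the product rule
    -- equal.
    have h1 : pairing (3 - 2 * s) (2 * s / (p - 1)) (bdry x₀) (v i)
        (twist (2 * s / (p - 1)) (bdry x₀) (sphLap (3 - 2 * s) (bdry x₀) (v i))) r =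
      pairing (3 - 2 * s) (2 * s / (p - 1)) (bdry x₀)
        (twist (2 * s / (p - 1)) (bdry x₀) (v i)) (sphLap (3 - 2 * s) (bdry x₀) (v i)) r := by
      rw [pairing, pairing, (hv.extensionSolution i).dilInt_twist_mul_sphLap (by linarith)
        (by linarith) hn _ x₀ hr]
    rw [h1]; ring

lemma IsClassicalSolution.bulkDensity_admissible (hv : IsClassicalSolution s p κ v) :
    Admissible fun X => ∑ i, weightedLaplacian (3 - 2 * s) (v i) X ^ 2 := by
  simp only [sq]
  exact admissible_sum _ fun i _ =>
    (hv.extensionSolution i).adm_lap.mul (hv.extensionSolution i).adm_lap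

lemma IsClassicalSolution.energyWellDefined (hv : IsClassicalSolution s p κ v) (hs₁ : 1 < s)
    (hs₂ : s < 2) (hn : 0 < n) (hp : 1 < p) (x₀ : EuclideanSpace ℝ (Fin n)) {r : ℝ} (hr : 0 < r) :
    EnergyWellDefined s p v x₀ r where
  bulk := hv.bulkDensity_admissible.integrableOn_ball (by linarith) _ _
  boundary := ((continuous_vecNorm_bdry_rpow (fun i => (hv.regular i).continuousOn)
    (by linarith)).continuousOn.integrableOn_compact (isCompact_closedBall x₀ r)).mono_set
      Metric.ball_subset_closedBall
  mass := (hv.mass_halfSphere hs₂ x₀ hr).1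
  homogeneity := (hv.homogeneity_halfSphere hs₂ x₀ hr).1
  tangential := (hv.tangential_halfSphere hs₁ hs₂ x₀ hr).1
  mass_deriv := (hv.hasDerivAt_massBracket hs₂ x₀ hr).differentiableAt
  homogeneity_deriv := (hv.hasDerivAt_homogeneityBracket hs₂ x₀ hr).differentiableAt
  tangential_deriv := (hv.hasDerivAt_tangentialBracket hs₁ hs₂ hn hp.ne' x₀ hr).differentiableAt

lemma IsClassicalSolution.bulk_eq (hv : IsClassicalSolution s p κ v) (hs₂ : s < 2) (hp : p ≠ 1)
    (x₀ : EuclideanSpace ℝ (Fin n)) {r : ℝ} (hr : 0 < r) :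
    r ^ (2 * s * (p + 1) / (p - 1) - n) *
        ∫ X in halfSpace n ∩ Metric.ball (bdry x₀) r, 1 / 2 * bulkDensity s v X =
      ∑ i, 1 / 2 * (r ^ (2 * (2 * s / (p - 1) + 2)) * dilInt (ballWeight n (3 - 2 * s)) (bdry x₀)
        (fun X => weightedLaplacian (3 - 2 * s) (v i) X * weightedLaplacian (3 - 2 * s) (v i) X)
        r) := by
  have := isFiniteMeasure_ballWeight (n := n) (b := 3 - 2 * s) (by linarith)
  have hp' : p - 1 ≠ 0 := sub_ne_zero.2 hp
  unfold bulkDensity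
  simp only [sq]
  rw [integral_const_mul, setIntegral_ball_weight_mul (yCoord_bdry x₀) hr,
    Admissible.dilInt_sum (onUnitHalfBall_ballWeight _) (yCoord_bdry x₀) hr fun i =>
      (hv.extensionSolution i).adm_lap.mul (hv.extensionSolution i).adm_lap,
    ← Finset.mul_sum, ← Finset.mul_sum, mul_left_comm, ← mul_assoc (r ^ _), ← Real.rpow_add hr]
  congr 3
  field_simp
  ring

/-- The energy splits into the contributions of the components and the boundary term. -/
lemma IsClassicalSolution.energy_eq (hv : IsClassicalSolution s p κ v) (hs₁ : 1 < s) (hs₂ : s < 2)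
    (hn : 0 < n) (hp : p ≠ 1) (x₀ : EuclideanSpace ℝ (Fin n)) {r : ℝ} (hr : 0 < r) :
    energy s p κ v x₀ r =
      ∑ i, componentEnergy (3 - 2 * s) (2 * s / (p - 1)) (bdry x₀) (v i) r -
        κ / (p + 1) * (r ^ (2 * s * (p + 1) / (p - 1) - n) *
          ∫ x in Metric.ball x₀ r, vecNorm v (bdry x) ^ (p + 1)) := by
  have hp' : p - 1 ≠ 0 := sub_ne_zero.2 hp
  have hmass : r ^ (-3 + 2 * s + 4 * s / (p - 1) - n) * halfSphereIntegral x₀ r (massDensity s v) =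
      ∑ i, pairing (3 - 2 * s) (2 * s / (p - 1)) (bdry x₀) (v i) (v i) r := by
    rw [← mul_right_inj' hr.ne', ← hv.massBracket_eq hs₂ x₀ hr, massBracket, ← mul_assoc,
      mul_comm r, ← Real.rpow_add_one hr.ne']
    congr 2; ring
  have htang : r ^ (2 * s * (p + 1) / (p - 1) - n - 1) *
      halfSphereIntegral x₀ r (tangentialDensity s v x₀) =
      - ∑ i, pairing (3 - 2 * s) (2 * s / (p - 1)) (bdry x₀) (v i)
        (sphLap (3 - 2 * s) (bdry x₀) (v i)) r := by
    rw [← mul_right_inj' hr.ne', mul_neg, ← hv.tangentialBracket_eq hs₁ hs₂ hn hp x₀ hr,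
      tangentialBracket, ← mul_assoc, mul_comm r, ← Real.rpow_add_one hr.ne', sub_add_cancel]
  -- Since (p+2s-1)/(p-1) = 1 + 2s/(p-1), the coefficient in the energy is -B/2 with B = α(n+b-1-α).
  have hk : s / (p - 1) * ((p + 2 * s - 1) / (p - 1) - n - (3 - 2 * s)) =
      - (2 * s / (p - 1) * (n + (3 - 2 * s) - 1 - 2 * s / (p - 1))) / 2 := by
    field_simp; ring
  have hbulk := hv.bulk_eq hs₂ hp x₀ hr
  rw [energy, (hv.hasDerivAt_massBracket hs₂ x₀ hr).deriv,
    (hv.hasDerivAt_homogeneityBracket hs₂ x₀ hr).deriv,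
    (hv.hasDerivAt_tangentialBracket hs₁ hs₂ hn hp x₀ hr).deriv, hk, mul_sub, hbulk,
    mul_assoc _ (r ^ (-3 + 2 * s + 4 * s / (p - 1) - (n : ℝ))), hmass,
    mul_assoc _ (r ^ (2 * s * (p + 1) / (p - 1) - n - 1)), htang]
  simp only [componentEnergy, Finset.sum_add_distrib, Finset.sum_sub_distrib, ← Finset.mul_sum]
  field_simp
  ring

/-- Only half-sphere integrals remain: the flux terms of the components add up to the derivative of
the |v|^{p+1} term and cancel against it. -/
lemma IsClassicalSolution.hasDerivAt_energy (hv : IsClassicalSolution s p κ v) (hs₁ : 1 < s)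
    (hs₂ : s < 2) (hn : 0 < n) (hp : 1 < p) (x₀ : EuclideanSpace ℝ (Fin n)) {r : ℝ} (hr : 0 < r) :
    let α := 2 * s / (p - 1)
    let c := bdry x₀
    let S := fun q : Space n → ℝ => dilInt (sphereWeight n (3 - 2 * s)) c q r
    HasDerivAt (energy s p κ v x₀) (∑ i, r ^ (2 * α - 1) *
      (2 * S (fun X => twist α c (twist α c (v i)) X * twist α c (twist α c (v i)) X) +
        2 * ((n + (3 - 2 * s) - 1 - 2 * α) + α * (n + (3 - 2 * s) - 1 - α)) *
          S (fun X => twist α c (v i) X * twist α c (v i) X) +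
        2 * S (tangForm c (twist α c (v i)) (twist α c (v i))))) r := by
  intro α c S
  have hp' : p - 1 ≠ 0 := by linarith
  have h1 := HasDerivAt.fun_sum fun i (_ : i ∈ Finset.univ) =>
    (hv.extensionSolution i).hasDerivAt_componentEnergy (by linarith) (by linarith) hn
      (hv.continuous_flux hp i) α x₀ hr
  have h2 := (hasDerivAt_boundaryEnergy (α := α) (a := 2 * s * (p + 1) / (p - 1) - n) hp hv.regular
    (by simp only [α]; field_simp; ring) x₀ hr).const_mul (κ / (p + 1))
  refine ((h1.sub h2).congr_of_eventuallyEq ?_).congr_deriv ?_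
  · filter_upwards [Ioi_mem_nhds hr] with t ht using hv.energy_eq hs₁ hs₂ hn hp.ne' x₀ ht
  · have h3 : ∑ i, r ^ (2 * α + 2 - n - (3 - 2 * s)) * ∫ x in Metric.ball x₀ r,
        ExtensionSolution.bdryTwist α x₀ (v i) x *
          (κ * vecNorm v (bdry x) ^ (p - 1) * v i (bdry x)) =
        κ / (p + 1) * ((p + 1) * (r ^ (2 * s * (p + 1) / (p - 1) - n - 1) *
          ∫ x in Metric.ball x₀ r, vecNorm v (bdry x) ^ (p - 1) *
            ∑ i, v i (bdry x) * ExtensionSolution.bdryTwist α x₀ (v i) x)) := by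
      -- The powers of r agree exactly because α = 2s/(p-1).
      have he : 2 * α + 2 - n - (3 - 2 * s) = 2 * s * (p + 1) / (p - 1) - n - 1 := by
        simp only [α]; field_simp; ring
      have hp1 : p + 1 ≠ 0 := by linarith
      rw [← mul_assoc (κ / (p + 1)), div_mul_cancel₀ _ hp1, ← Finset.mul_sum, he,
        mul_left_comm κ, ← integral_const_mul κ, ← integral_finsetSum]
      · congr 2
        funext x
        rw [Finset.mul_sum, Finset.mul_sum]
        exact Finset.sum_congr rfl fun i _ => by ring
      · intro i _
        exact ((((hv.extensionSolution i).continuous_bdryTwist α x₀).mul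
          (hv.continuous_flux hp i)).continuousOn.integrableOn_compact
          (isCompact_closedBall x₀ r)).mono_set Metric.ball_subset_closedBall
    rw [Finset.sum_add_distrib, h3, add_sub_cancel_right]

lemma dilInt_nonneg {ν : Measure (Space n)} (hν : OnUnitHalfBall ν) {c : Space n}
    (hc : yCoord c = 0) {r : ℝ} (hr : 0 < r) {q : Space n → ℝ} (hq : ∀ X ∈ halfSpace n, 0 ≤ q X) :
    0 ≤ dilInt ν c q r :=
  integral_nonneg_of_ae (hν.mono fun _ hZ => hq _ ((add_smul_mem_halfSpace hc hr).2 hZ.1))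

/-- The squares of the second twists and the tangential energies are nonnegative and are dropped;
the squares of the first twists give the homogeneity integral. -/
lemma IsClassicalSolution.le_deriv_energy (hv : IsClassicalSolution s p κ v) (hs₁ : 1 < s)
    (hs₂ : s < 2) (hn : 0 < n) (hp : 1 < p) (x₀ : EuclideanSpace ℝ (Fin n)) {r : ℝ} (hr : 0 < r) :
    2 * ((n + (3 - 2 * s) - 1 - 2 * (2 * s / (p - 1))) +
        2 * s / (p - 1) * (n + (3 - 2 * s) - 1 - 2 * s / (p - 1))) *
        r ^ (4 * s / (p - 1) + 2 * s - 2 - n) *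
          halfSphereIntegral x₀ r (homogeneityDensity s p v x₀) ≤
      deriv (energy s p κ v x₀) r := by
  have hc : yCoord (bdry x₀) = 0 := yCoord_bdry x₀
  have hν := onUnitHalfBall_sphereWeight (n := n) (3 - 2 * s)
  have hd := hv.hasDerivAt_energy hs₁ hs₂ hn hp x₀ hr
  have hpow : r ^ (4 * s / (p - 1) + 2 * s - 2 - n) * (r ^ ((n : ℝ) + (3 - 2 * s)) * (r ^ 2)⁻¹) =
      r ^ (2 * (2 * s / (p - 1)) - 1) := by
    rw [← Real.rpow_natCast, ← Real.rpow_neg hr.le, ← Real.rpow_add hr, ← Real.rpow_add hr]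
    congr 1; push_cast; ring
  rw [hd.deriv, (hv.homogeneity_halfSphere hs₂ x₀ hr).2, ← mul_assoc (r ^ ((n : ℝ) + (3 - 2 * s))),
    mul_assoc (2 * _), ← mul_assoc (r ^ _) (_ * _), hpow, mul_left_comm, ← Finset.mul_sum,
    Finset.mul_sum]
  refine mul_le_mul_of_nonneg_left (Finset.sum_le_sum fun i _ => ?_) (Real.rpow_nonneg hr.le _)
  have h1 := dilInt_nonneg hν hc hr (q := fun X =>
    twist (2 * s / (p - 1)) (bdry x₀) (twist (2 * s / (p - 1)) (bdry x₀) (v i)) X *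
      twist (2 * s / (p - 1)) (bdry x₀) (twist (2 * s / (p - 1)) (bdry x₀) (v i)) X)
    fun X _ => mul_self_nonneg _
  have h2 := dilInt_nonneg hν hc hr fun X hX => tangForm_self_nonneg (bdry x₀)
    (((hv.extensionSolution i).flowable_twist (2 * s / (p - 1)) (c := bdry x₀)).diff X hX)
  linarith

lemma IsClassicalSolution.monotoneOn_energy (hv : IsClassicalSolution s p κ v) (hs₁ : 1 < s)
    (hs₂ : s < 2) (hn : 0 < n) (hp : 1 < p) (hC : 0 ≤ (n + (3 - 2 * s) - 1 -
      2 * (2 * s / (p - 1))) + 2 * s / (p - 1) * (n + (3 - 2 * s) - 1 - 2 * s / (p - 1)))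
    (x₀ : EuclideanSpace ℝ (Fin n)) : MonotoneOn (energy s p κ v x₀) (Ioi 0) := by
  have hd : ∀ r ∈ Ioi (0 : ℝ), DifferentiableAt ℝ (energy s p κ v x₀) r := fun r hr =>
    (hv.hasDerivAt_energy hs₁ hs₂ hn hp x₀ hr).differentiableAt
  refine monotoneOn_of_deriv_nonneg (convex_Ioi 0)
    (fun r hr => (hd r hr).continuousAt.continuousWithinAt) ?_ ?_
  · rw [interior_Ioi]; exact fun r hr => (hd r hr).differentiableWithinAt
  · rw [interior_Ioi]
    intro r hr
    refine le_trans ?_ (hv.le_deriv_energy hs₁ hs₂ hn hp x₀ hr)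
    refine mul_nonneg (mul_nonneg (by linarith) (Real.rpow_nonneg (le_of_lt hr) _)) ?_
    refine setIntegral_nonneg isOpen_halfSpace.measurableSet fun X hX => ?_
    exact mul_nonneg (Real.rpow_nonneg (le_of_lt hX) _) (Finset.sum_nonneg fun i _ => sq_nonneg _)

/-- The constant in the monotonicity formula is positive in the supercritical range. -/
lemma monotonicityConstant_pos (hs : 0 < s) (hn : 2 * s < n)
    (hp : ((n : ℝ) + 2 * s) / ((n : ℝ) - 2 * s) < p) :
    0 < (n + (3 - 2 * s) - 1 - 2 * (2 * s / (p - 1))) +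
      2 * s / (p - 1) * (n + (3 - 2 * s) - 1 - 2 * s / (p - 1)) := by
  have hd : (0 : ℝ) < n - 2 * s := by linarith
  rw [div_lt_iff₀ hd] at hp
  have hp1 : 0 < p - 1 := by
    by_contra h
    nlinarith
  have h0 : 0 < 2 * s / (p - 1) := by positivity
  -- This is supercriticality restated; it makes the first bracket exceed 2, and the second product
  -- is positive by `h2`.
  have h1 : 2 * s / (p - 1) < (n - 2 * s) / 2 := by
    rw [div_lt_iff₀ hp1]
    nlinarith
  have h2 : 0 < (n : ℝ) + 1 - 2 * s - 2 * s / (p - 1) := by linarith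
  nlinarith [mul_pos h0 h2]

end System

end YangExtension

end

theorem theorem1p4 (n : ℕ) (s p : ℝ) (hs₁ : 1 < s) (hs₂ : s < 2) (hn : 2 * s < n)
    (hp : ((n : ℝ) + 2 * s) / ((n : ℝ) - 2 * s) < p) :
    ∃ C : ℝ, 0 < C ∧
      ∀ (m : ℕ) (κ : ℝ) (v : Fin m → YangExtension.Space n → ℝ),
        YangExtension.IsClassicalSolution s p κ v →
        ∀ x₀ : EuclideanSpace ℝ (Fin n),
          (∀ r : ℝ, 0 < r → YangExtension.EnergyWellDefined s p v x₀ r) ∧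
          MonotoneOn (YangExtension.energy s p κ v x₀) (Set.Ioi 0) ∧
          ∀ r : ℝ, 0 < r →
            DifferentiableAt ℝ (YangExtension.energy s p κ v x₀) r ∧
            C * r ^ (4 * s / (p - 1) + 2 * s - 2 - n) *
                YangExtension.halfSphereIntegral x₀ r
                  (YangExtension.homogeneityDensity s p v x₀) ≤
              deriv (YangExtension.energy s p κ v x₀) r := by
  have hC := YangExtension.monotonicityConstant_pos (by linarith) hn hp
  have hn0 : 0 < n := by
    have : (0 : ℝ) < n := by linarith
    exact_mod_cast this
  have hp1 : 1 < p := by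
    refine lt_trans ?_ hp
    rw [one_lt_div (by linarith)]
    linarith
  -- The witness is 2(A+B) with A = n+b-1-2α and B = α(n+b-1-α), which involves only n, s and p.
  exact ⟨_, mul_pos two_pos hC, fun m κ v hv x₀ =>
    ⟨fun r hr => hv.energyWellDefined hs₁ hs₂ hn0 hp1 x₀ hr,
      hv.monotoneOn_energy hs₁ hs₂ hn0 hp1 hC.le x₀, fun r hr =>
      ⟨(hv.hasDerivAt_energy hs₁ hs₂ hn0 hp1 x₀ hr).differentiableAt,
        hv.le_deriv_energy hs₁ hs₂ hn0 hp1 x₀ hr⟩⟩⟩
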